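/- Let $\mathbb T^2=(\mathbb R/2\pi\mathbb Z)^2$, $m(f)=\frac1{|\mathbb T^2|}\int_{\mathbb T^2}f\,dx$, and let $(-\Delta)^{-1}$ be the inverse Laplacian on mean-zero distributions. Let $\Phi\in C([-1,1])\cap C^\infty((-1,1))$ be such that $\phi=\Phi'$ satisfies $\phi(s)\to-\infty$ as $s\to-1^+$, $\phi(s)\to+\infty$ as $s\to1^-$, and, for some constants $\alpha,C_1,C_2,C_3>0$, $$\phi'(s)\ge-\alpha,\qquad |\phi'(s)|\le C_1e^{C_2|\phi(s)|}+C_3\qquad\text{for all } s\in(-1,1).$$ For $\varepsilon\in(0,1]$ put $\varphi(f)=(\varepsilon+(-\Delta)^{-1})^{-1}[\Delta f-\phi(f)+m(\phi(f))]$ and let $\mathbb D_{0,\varepsilon}$ be the set of all $f\in H^2(\mathbb T^2)$ with $\|f\|_{L^\infty}\le1$, $m(f)=0$, $\phi(f)\in L^2(\mathbb T^2)$ (in particular $|f|<1$ almost everywhere), $\varepsilon^{1/2}\varphi(f)\in L^2(\mathbb T^2)$ and $\varphi(f)\in\dot H^{-1}(\mathbb T^2)$. Write $$\|f\|_{\mathbb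 D_{0,\varepsilon}}^2=\|f\|_{H^2}^2+\|\phi(f)\|_{L^2}^2+\varepsilon\|\varphi(f)\|_{L^2}^2+\|\varphi(f)\|_{\dot H^{-1}}^2,$$ and give $\mathbb D_{0,\varepsilon}$ the metric whose square is $\|f-g\|_{H^2}^2+\|\phi(f)-\phi(g)\|_{L^2}^2+\varepsilon\|\varphi(f)-\varphi(g)\|_{L^2}^2+\|\varphi(f)-\varphi(g)\|_{\dot H^{-1}}^2$. Let $0<T<\infty$, $M,R\in\mathbb R$. Then there is a constant $C_T$, depending only on $\Phi,T,M,R$ (and not on $\varepsilon$), with the following property. Let $\varepsilon\in(0,1]$ and $\delta_0\in(0,1)$. Let $u$ be a divergence-free vector field on $(0,T)\times\mathbb T^2$ such that $\|u\|_{L^\infty(0,T;H^1)}$, $\|u\|_{L^2(0,T;H^2)}$ and $\|\partial_tu\|_{L^2(0,T;L^2)}$ are at most $|R|$. Let $\theta_0\in\mathbb D_{0,\varepsilon}$ with $\|\theta_0\|_{\mathbb D_{0,\varepsilon}}\le |M|$ and $\|\theta_0\|_{L^\infty}\le1-\delta_0$. Let $\theta\in C([0,T);\mathbb D_{0,\varepsilon})$,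 with $\partial_t\theta\in L^2_{loc}([0,T);H^1(\mathbb T^2))$, be a weak solution on $[0,T)$ of $$\varepsilon\,\partial_t\theta+(-\Delta)^{-1}\big((u\cdot\nabla)\theta+\partial_t\theta\big)=\Delta\theta-\phi(\theta)+m(\phi(\theta)),\qquad \theta|_{t=0}=\theta_0,$$ that is, the initial condition holds and, with $(u\cdot\nabla)\theta=\operatorname{div}(u\theta)$, the equation holds in the sense of distributions on $\mathbb T^2$ for almost every $t\in(0,T)$. Then $$\int_0^T\|\phi(\theta(\tau))\|_{L^\infty(\mathbb T^2)}^2\,d\tau\le C_T\qquad\text{and}\qquad\|\theta\|_{L^\infty((0,T)\times\mathbb T^2)}<1.$$ -/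

import Mathlib

open MeasureTheory Set Filter Topology
open scoped ENNReal

noncomputable section

namespace CahnHilliard

instance instFactTwoPiPos : Fact (0 < 2 * Real.pi) := ⟨Real.two_pi_pos⟩

/-- The two-dimensional torus `(ℝ / 2πℤ)²`, with its Lebesgue measure of total mass `(2π)²`. -/
abbrev T2 : Type := Fin 2 → AddCircle (2 * Real.pi)

/-- The real Hilbert space `L²(𝕋²)`. -/
abbrev L2T : Type := Lp ℝ 2 (volume : Measure T2)

/-- The trigonometric monomial `x ↦ exp (i n · x)`. -/
def mode (n : Fin 2 → ℤ) (x : T2) : ℂ := ∏ j, fourier (n j) (x j)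

/-- The Fourier coefficient `(2π)⁻² ∫ f(x) exp (-i n · x) dx`. -/
def fc (f : T2 → ℝ) (n : Fin 2 → ℤ) : ℂ :=
  ((2 * Real.pi) ^ 2 : ℂ)⁻¹ * ∫ x, (f x : ℂ) * mode (-n) x

/-- The mean value `m(f)` over the torus. -/
def mean (f : T2 → ℝ) : ℝ := ((2 * Real.pi) ^ 2)⁻¹ * ∫ x, f x

/-- `|n|²`, the symbol of `-Δ`. -/
def freqSq (n : Fin 2 → ℤ) : ℝ := ∑ j, (n j : ℝ) ^ 2

/-- The squared `H^k(𝕋²)` norm of the distribution with Fourier coefficients `a`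
(infinite if it is not in `H^k`). -/
def sobolevSq (k : ℕ) (a : (Fin 2 → ℤ) → ℂ) : ℝ≥0∞ :=
  ∑' n, ENNReal.ofReal ((1 + freqSq n) ^ k * ‖a n‖ ^ 2)

/-- The squared homogeneous `Ḣ⁻¹(𝕋²)` norm of the mean-zero distribution with Fourier
coefficients `a`; the zero mode has weight `0⁻¹ = 0`. -/
def homNegSq (a : (Fin 2 → ℤ) → ℂ) : ℝ≥0∞ :=
  ∑' n, ENNReal.ofReal ((freqSq n)⁻¹ * ‖a n‖ ^ 2)

/-- The singular free energy densities on `[-1, 1]`. -/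
structure IsSingularPotential (Φ : ℝ → ℝ) : Prop where
  continuousOn : ContinuousOn Φ (Icc (-1) 1)
  smooth : ContDiffOn ℝ (⊤ : ℕ∞) Φ (Ioo (-1) 1)
  tendsto_left : Tendsto (deriv Φ) (𝓝[>] (-1)) atBot
  tendsto_right : Tendsto (deriv Φ) (𝓝[<] 1) atTop
  bounds : ∃ α C₁ C₂ C₃ : ℝ, 0 < α ∧ 0 < C₁ ∧ 0 < C₂ ∧ 0 < C₃ ∧
    ∀ s ∈ Ioo (-1 : ℝ) 1, -α ≤ deriv (deriv Φ) s ∧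
      |deriv (deriv Φ) s| ≤ C₁ * Real.exp (C₂ * |deriv Φ s|) + C₃

/-- Fourier coefficients of `Δf - φ(f) + m(φ(f))`. -/
def rhsCoef (φ : ℝ → ℝ) (f : T2 → ℝ) (n : Fin 2 → ℤ) : ℂ :=
  -(freqSq n : ℂ) * fc f n - fc (fun x => φ (f x)) n
    + if n = 0 then (mean (fun x => φ (f x)) : ℂ) else 0

/-- Fourier coefficients of `(ε + (-Δ)⁻¹)⁻¹ [Δf - φ(f) + m(φ(f))]`. The bracket has mean zero,
so the value of the symbol at `n = 0` is irrelevant. -/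
def varphiCoef (ε : ℝ) (φ : ℝ → ℝ) (f : T2 → ℝ) (n : Fin 2 → ℤ) : ℂ :=
  ((ε + (freqSq n)⁻¹)⁻¹ : ℝ) * rhsCoef φ f n

/-- The squared norm of the phase space `𝔻_{0,ε}`. -/
def phaseNormSq (ε : ℝ) (φ : ℝ → ℝ) (f : T2 → ℝ) : ℝ≥0∞ :=
  sobolevSq 2 (fc f) + eLpNorm (fun x => φ (f x)) 2 volume ^ 2
    + ENNReal.ofReal ε * sobolevSq 0 (varphiCoef ε φ f) + homNegSq (varphiCoef ε φ f)

/-- The squared distance of the phase space `𝔻_{0,ε}` (which is not a linear space). -/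
def phaseDistSq (ε : ℝ) (φ : ℝ → ℝ) (f g : T2 → ℝ) : ℝ≥0∞ :=
  sobolevSq 2 (fun n => fc f n - fc g n)
    + eLpNorm (fun x => φ (f x) - φ (g x)) 2 volume ^ 2
    + ENNReal.ofReal ε * sobolevSq 0 (fun n => varphiCoef ε φ f n - varphiCoef ε φ g n)
    + homNegSq (fun n => varphiCoef ε φ f n - varphiCoef ε φ g n)

/-- Membership in the phase space `𝔻_{0,ε}`. As `φ` is defined on `(-1, 1)` only and is infinite
at `±1`, `φ(f) ∈ L²` includes that `f` takes values in `(-1, 1)` almost everywhere. -/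
structure InPhaseSpace (ε : ℝ) (φ : ℝ → ℝ) (f : L2T) : Prop where
  h2 : sobolevSq 2 (fc f) < ∞
  bound : eLpNorm f ∞ volume ≤ 1
  mean_zero : mean f = 0
  interior : ∀ᵐ x, f x ∈ Ioo (-1 : ℝ) 1
  phi_l2 : MemLp (fun x => φ (f x)) 2 volume
  varphi_l2 : ENNReal.ofReal ε * sobolevSq 0 (varphiCoef ε φ f) < ∞
  varphi_neg : homNegSq (varphiCoef ε φ f) < ∞

/-- `g` is the weak derivative of `f` on `(0, T)` (as `L²(𝕋²)`-valued functions of time). -/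
def HasWeakTimeDeriv (T : ℝ) (f g : ℝ → L2T) : Prop :=
  ∀ η : ℝ → ℝ, ContDiff ℝ (⊤ : ℕ∞) η → HasCompactSupport η → tsupport η ⊆ Ioo 0 T →
    ∫ t in Ioo 0 T, deriv η t • f t = -∫ t in Ioo 0 T, η t • g t

/-- `u` is divergence free, and its squared norms in `L^∞(0,T; H¹)` and `L²(0,T; H²)` and that of
`∂ₜu` in `L²(0,T; L²)` are at most `R²`. -/
structure IsVelocity (T R : ℝ) (u : ℝ → Fin 2 → L2T) : Prop where
  measurable : ∀ j, AEStronglyMeasurable (fun t => u t j) (volume.restrict (Ioo 0 T))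
  linfty_h1 : ∀ᵐ t ∂volume.restrict (Ioo 0 T),
    ∑ j, sobolevSq 1 (fc (u t j)) ≤ ENNReal.ofReal (R ^ 2)
  l2_h2 : ∫⁻ t in Ioo 0 T, ∑ j, sobolevSq 2 (fc (u t j)) ≤ ENNReal.ofReal (R ^ 2)
  time_deriv : ∃ v : ℝ → Fin 2 → L2T,
    (∀ j, AEStronglyMeasurable (fun t => v t j) (volume.restrict (Ioo 0 T))) ∧
    (∀ j, HasWeakTimeDeriv T (fun t => u t j) (fun t => v t j)) ∧
    ∫⁻ t in Ioo 0 T, ∑ j, ‖v t j‖ₑ ^ 2 ≤ ENNReal.ofReal (R ^ 2)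
  div_free : ∀ᵐ t ∂volume.restrict (Ioo 0 T), ∀ n : Fin 2 → ℤ,
    ∑ j, Complex.I * (n j : ℂ) * fc (u t j) n = 0

/-- Fourier coefficients of the distribution `(u · ∇)f = div (u f)`, for divergence-free `u`. -/
def advCoef (u : Fin 2 → L2T) (f : L2T) (n : Fin 2 → ℤ) : ℂ :=
  ∑ j, Complex.I * (n j : ℂ) * fc (fun x => u j x * f x) n

/-- `θ ∈ C([0,T); 𝔻_{0,ε})` with `∂ₜθ ∈ L²_loc([0,T); H¹)` and `θ(0) = θ₀` is a weak solution of
`ε ∂ₜθ + (-Δ)⁻¹ ((u · ∇)θ + ∂ₜθ) = Δθ - φ(θ) + m(φ(θ))`: for almost every time the equation holds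
in the sense of distributions on the torus, that is, tested against every `exp (-i n · x)`.
On the zero mode `(-Δ)⁻¹`, which acts on mean-zero distributions, has symbol `0⁻¹ = 0`. -/
structure IsWeakSolution (ε T : ℝ) (φ : ℝ → ℝ) (u : ℝ → Fin 2 → L2T) (θ₀ : L2T)
    (θ : ℝ → L2T) : Prop where
  initial : θ 0 = θ₀
  mem : ∀ t ∈ Ico 0 T, InPhaseSpace ε φ (θ t)
  continuous : ∀ t ∈ Ico 0 T,
    Tendsto (fun s => phaseDistSq ε φ (θ s) (θ t)) (𝓝[Ico 0 T] t) (𝓝 0)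
  equation : ∃ g : ℝ → L2T,
    AEStronglyMeasurable g (volume.restrict (Ioo 0 T)) ∧
    (∀ t ∈ Ioo 0 T, ∫⁻ s in Ioo 0 t, sobolevSq 1 (fc (g s)) < ∞) ∧
    HasWeakTimeDeriv T θ g ∧
    ∀ᵐ t ∂volume.restrict (Ioo 0 T), ∀ n : Fin 2 → ℤ,
      (ε : ℂ) * fc (g t) n + ((freqSq n)⁻¹ : ℝ) * (advCoef (u t) (θ t) n + fc (g t) n)
        = rhsCoef φ (θ t) n

end CahnHilliard

end

/-! Move everything nonlocal to the right: `ε ∂ₜθ - Δθ + φ(θ) = F`, where `F = m(φ(θ)) - (-Δ)⁻¹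
div(uθ) - (-Δ)⁻¹ ∂ₜθ`. If `|F(t, x)| ≤ H(t)` with `H` in `L²(0,T)` uniformly in `ε`, the comparison
principle traps `θ` between spatially constant barriers: `θ ≤ p` with `ε p' + φ(p) = H`, and `-θ ≤
q` with the same equation for the reflected nonlinearity `-φ(-s)`. Multiplying the barrier equation
by `φ(p)` gives `∫ φ(p)² ≤ ∫ H² + 4ε sup|Φ|`, because `φ(p) p'` is the derivative of the bounded
function `Φ(p)`. As `φ` is increasing up to a linear term, `|φ(θ)|` is controlled by `|φ(p)|`,
`|φ(-q)|` and a constant, which is the first claim.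

The bound `H` comes from an energy estimate for `∂ₜθ`. Difference quotients of the equation in time
are tested with themselves (`Slice.energy_inequality`). The one-sided bound `φ' ≥ -α` and the
advection are absorbed by the Dirichlet integral and by the energy `‖(ε + (-Δ)⁻¹)^{1/2} ∂ₜθ‖²`, and
Grönwall's inequality bounds this energy uniformly in time and `∂ₜθ` in `L²(0,T; L²)`
(`Evolution.energy_le`). The initial energy is controlled through `φ_ε(θ₀) = (ε + (-Δ)⁻¹)⁻¹[...]`,
the quantity built into the phase space. Testing the equation with `θ` then bounds `∇θ` in `L²` and
`φ(θ)` in `L¹` (`Slice.elliptic_bound`). In dimension two the Fourier coefficients of `(-Δ)⁻¹ ∂ₜθ`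
and `(-Δ)⁻¹ div(uθ)` are absolutely summable, so `F` is bounded in space (`Slice.abs_tested_le`).

For the separation `ε` is fixed, and the energy also bounds `ε ‖∂ₜθ‖²`. Hence `H ≤ A` for a constant
`A`, possibly huge as `ε → 0`. Since `φ` blows up at `±1`, there is `b < 1` with `φ(b) ≥ A` and
`φ(-b) ≤ -A`, and the barriers never leave `[-b, b]`. -/

noncomputable section

namespace CahnHilliard

open scoped ComplexConjugate

/-! ### Trigonometric monomials on the torus -/

section Modes

variable (n m : Fin 2 → ℤ) (x y : T2)

/-- `mode n` as a continuous function. -/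
def modeC : C(T2, ℂ) where
  toFun := mode n
  continuous_toFun := by unfold mode; fun_prop

@[simp] lemma modeC_apply : modeC n x = mode n x := rfl

lemma continuous_mode : Continuous (mode n) := (modeC n).continuous

lemma mode_neg : mode (-n) x = conj (mode n x) := by
  simp [mode]

lemma mode_add : mode (m + n) x = mode m x * mode n x := by
  simp [mode, Finset.prod_mul_distrib]

@[simp] lemma mode_zero : mode 0 x = 1 := by simp [mode]

@[simp] lemma norm_mode : ‖mode n x‖ = 1 := by
  simp only [mode, fourier_apply, norm_prod, Circle.norm_coe, Finset.prod_const_one]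

lemma mode_add_point : mode n (x + y) = mode n x * mode n y := by
  simp [mode, fourier_apply, smul_add, AddCircle.toCircle_add, Finset.prod_mul_distrib]

end Modes

/-! ### Density of trigonometric polynomials -/

section Algebra

open Algebra Submodule

/-- The star subalgebra of `C(𝕋², ℂ)` generated by the trigonometric monomials. -/
def modeSubalgebra : StarSubalgebra ℂ C(T2, ℂ) where
  toSubalgebra := Algebra.adjoin ℂ (range modeC)
  star_mem' := by
    change Algebra.adjoin ℂ (range modeC) ≤ star (Algebra.adjoin ℂ (range modeC))
    refine adjoin_le ?_
    rintro _ ⟨n, rfl⟩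
    refine subset_adjoin ⟨-n, ?_⟩
    ext1 x
    simp [mode_neg]

lemma modeSubalgebra_coe :
    modeSubalgebra.toSubalgebra.toSubmodule = span ℂ (range modeC) := by
  apply adjoin_eq_span_of_subset
  refine .trans (fun x ↦ Submonoid.closure_induction (fun _ ↦ id) ⟨0, ?_⟩ ?_) subset_span
  · ext z
    simp
  · rintro _ _ _ _ ⟨m, rfl⟩ ⟨n, rfl⟩
    refine ⟨m + n, ?_⟩
    ext z
    simp [mode_add]

/-- Points that differ in the coordinate `i` are told apart by `exp (i xᵢ)`, which is injective on
the circle. -/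
lemma modeSubalgebra_separatesPoints : modeSubalgebra.SeparatesPoints := by
  intro x y hxy
  rw [Ne, funext_iff, not_forall] at hxy
  obtain ⟨i, hi⟩ := hxy
  refine ⟨_, ⟨modeC (Pi.single i 1), subset_adjoin ⟨Pi.single i 1, rfl⟩, rfl⟩, ?_⟩
  have key : ∀ z : T2, mode (Pi.single i 1) z = fourier 1 (z i) := by
    intro z
    unfold mode
    rw [Finset.prod_eq_single i]
    · simp
    · intro j _ hj
      simp [Pi.single_eq_of_ne hj]
    · simp
  simp only [modeC_apply, key, fourier_one, Ne]
  contrapose! hi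
  exact AddCircle.injective_toCircle Real.two_pi_pos.ne' (Circle.ext hi)

/-- Stone–Weierstrass, applicable because the span is already a star subalgebra. -/
lemma span_modeC_closure_eq_top : (span ℂ (range modeC)).topologicalClosure = ⊤ := by
  rw [← modeSubalgebra_coe]
  exact congr_arg (Subalgebra.toSubmodule <| StarSubalgebra.toSubalgebra ·)
    (ContinuousMap.starSubalgebra_topologicalClosure_eq_top_of_separatesPoints _
      modeSubalgebra_separatesPoints)

end Algebra

/-! ### Fourier series in `L²` and Parseval's identity -/

section Basis

lemma conj_two_pi : conj (2 * Real.pi : ℂ) = 2 * Real.pi := by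
  exact_mod_cast Complex.conj_ofReal (2 * Real.pi)

/-- The trigonometric monomials, normalised in `L²(𝕋²)`. -/
def modeLp (n : Fin 2 → ℤ) : Lp ℂ 2 (volume : Measure T2) :=
  ((2 * Real.pi : ℂ)⁻¹) • ContinuousMap.toLp (E := ℂ) 2 volume ℂ (modeC n)

lemma coeFn_modeLp (n : Fin 2 → ℤ) :
    modeLp n =ᵐ[volume] fun x => (2 * Real.pi : ℂ)⁻¹ * mode n x := by
  filter_upwards [Lp.coeFn_smul ((2 * Real.pi : ℂ)⁻¹)
    (ContinuousMap.toLp (E := ℂ) 2 volume ℂ (modeC n)),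
    ContinuousMap.coeFn_toLp (E := ℂ) (p := 2) (𝕜 := ℂ) (volume : Measure T2) (modeC n)]
    with x h1 h2
  rw [modeLp, h1, Pi.smul_apply, h2, smul_eq_mul, modeC_apply]

lemma integral_fourier (k : ℤ) :
    ∫ x : AddCircle (2 * Real.pi), fourier k x = if k = 0 then (2 * Real.pi : ℂ) else 0 := by
  have h := (orthonormal_iff_ite.mp (orthonormal_fourier (T := 2 * Real.pi))) 0 k
  simp only [ContinuousMap.inner_toLp, fourier_zero] at h
  rw [AddCircle.volume_eq_smul_haarAddCircle, integral_smul_measure]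
  simp only [map_one, mul_one] at h
  rw [h]
  by_cases hk : k = 0
  · simp [hk, Real.pi_pos.le]
  · simp [hk, Ne.symm hk]

lemma integral_mode (n : Fin 2 → ℤ) :
    ∫ x, mode n x = if n = 0 then ((2 * Real.pi) ^ 2 : ℂ) else 0 := by
  unfold mode
  rw [MeasureTheory.integral_fintype_prod_volume_eq_prod]
  simp only [integral_fourier]
  split_ifs with h
  · simp [h]
  · obtain ⟨i, hi⟩ := Function.ne_iff.mp h
    exact Finset.prod_eq_zero (Finset.mem_univ i) (by simpa using hi)

lemma orthonormal_modeLp : Orthonormal ℂ modeLp := by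
  rw [orthonormal_iff_ite]
  intro m n
  simp only [modeLp, inner_smul_left, inner_smul_right, ContinuousMap.inner_toLp, modeC_apply]
  simp only [← mode_neg, ← mode_add, integral_mode]
  have hpi : (Real.pi : ℂ) ≠ 0 := by exact_mod_cast Real.pi_ne_zero
  by_cases h : m = n
  · subst h
    simp only [map_inv₀, conj_two_pi, add_neg_cancel, if_true]
    field_simp
  · have : n + -m ≠ 0 := by
      intro h'
      exact h (by rw [← sub_eq_add_neg, sub_eq_zero] at h'; exact h'.symm)
    simp [this, h]

lemma span_modeLp_closure_eq_top : (Submodule.span ℂ (range modeLp)).topologicalClosure = ⊤ := by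
  have h1 : Submodule.span ℂ (range modeLp) = Submodule.span ℂ (range fun n =>
      ContinuousMap.toLp (E := ℂ) 2 (volume : Measure T2) ℂ (modeC n)) := by
    have hpi : (2 * Real.pi : ℂ)⁻¹ ≠ 0 := by
      have : (Real.pi : ℂ) ≠ 0 := by exact_mod_cast Real.pi_ne_zero
      simp [this]
    apply le_antisymm
    · rw [Submodule.span_le]
      rintro _ ⟨n, rfl⟩
      exact Submodule.smul_mem _ _ (Submodule.subset_span ⟨n, rfl⟩)
    · rw [Submodule.span_le]
      rintro _ ⟨n, rfl⟩
      have := Submodule.smul_mem _ ((2 * Real.pi : ℂ)⁻¹)⁻¹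
        (Submodule.subset_span (R := ℂ) (s := range modeLp) ⟨n, rfl⟩)
      rwa [modeLp, smul_smul, inv_mul_cancel₀ hpi, one_smul] at this
  rw [h1]
  simpa only [Submodule.map_span, ContinuousLinearMap.coe_coe, ← range_comp, Function.comp_def]
    using (ContinuousMap.toLp_denseRange ℂ (volume : Measure T2) ℂ
      (p := 2) (by simp)).topologicalClosure_map_submodule span_modeC_closure_eq_top

/-- The Hilbert basis of normalised trigonometric monomials. -/
def modeBasis : HilbertBasis (Fin 2 → ℤ) ℂ (Lp ℂ 2 (volume : Measure T2)) :=
  HilbertBasis.mk orthonormal_modeLp span_modeLp_closure_eq_top.ge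

/-- Fourier coefficients of complex functions. -/
def fcC (f : T2 → ℂ) (n : Fin 2 → ℤ) : ℂ :=
  ((2 * Real.pi) ^ 2 : ℂ)⁻¹ * ∫ x, f x * mode (-n) x

lemma fc_eq_fcC (f : T2 → ℝ) (n : Fin 2 → ℤ) : fc f n = fcC (fun x => (f x : ℂ)) n := rfl

lemma inner_modeLp (n : Fin 2 → ℤ) (f : T2 → ℂ) (hf : MemLp f 2 volume) :
    inner ℂ (modeLp n) (hf.toLp f) = (2 * Real.pi : ℂ) * fcC f n := by
  have hpi : (Real.pi : ℂ) ≠ 0 := by exact_mod_cast Real.pi_ne_zero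
  rw [MeasureTheory.L2.inner_def, fcC]
  have : ∫ a, inner ℂ (modeLp n a) (hf.toLp f a) = ∫ x, (2 * Real.pi : ℂ)⁻¹ * (f x * mode (-n) x) := by
    apply integral_congr_ae
    filter_upwards [coeFn_modeLp n, hf.coeFn_toLp] with x h1 h2
    rw [h1, h2, mode_neg, RCLike.inner_apply, map_mul, map_inv₀, conj_two_pi]
    ring
  rw [this, integral_const_mul]
  field_simp

lemma hasSum_fcC {f g : T2 → ℂ} (hf : MemLp f 2 volume) (hg : MemLp g 2 volume) :
    HasSum (fun n => conj (fcC f n) * fcC g n)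
      (((2 * Real.pi) ^ 2 : ℂ)⁻¹ * ∫ x, conj (f x) * g x) := by
  have h := modeBasis.hasSum_inner_mul_inner (hf.toLp f) (hg.toLp g)
  have e : ∀ n, modeBasis n = modeLp n := fun n => by
    simp [modeBasis]
  have hpi : (Real.pi : ℂ) ≠ 0 := by exact_mod_cast Real.pi_ne_zero
  have h2 := h.mul_left (((2 * Real.pi) ^ 2 : ℂ)⁻¹)
  have e3 : inner ℂ (hf.toLp f) (hg.toLp g) = ∫ x, conj (f x) * g x := by
    rw [MeasureTheory.L2.inner_def]
    apply integral_congr_ae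
    filter_upwards [hf.coeFn_toLp, hg.coeFn_toLp] with x h1 h2
    rw [h1, h2]
    simp [mul_comm]
  rw [e3] at h2
  refine h2.congr_fun fun n => ?_
  rw [e, ← inner_conj_symm, inner_modeLp, inner_modeLp, map_mul, conj_two_pi]
  field_simp

end Basis

/-! ### Fourier coefficients of real functions -/

section RealCoefficients

/-- The reciprocal of the area of the torus. -/
def invArea : ℝ := ((2 * Real.pi) ^ 2)⁻¹

lemma invArea_pos : 0 < invArea := by unfold invArea; positivity

lemma fc_congr_ae {f g : T2 → ℝ} (h : f =ᵐ[volume] g) : fc f = fc g := by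
  funext n
  unfold fc
  congr 1
  apply integral_congr_ae
  filter_upwards [h] with x hx
  rw [hx]

lemma integrable_mul_mode {f : T2 → ℝ} (hf : Integrable f) (n : Fin 2 → ℤ) :
    Integrable (fun x => (f x : ℂ) * mode n x) :=
  hf.ofReal.mul_bdd (c := 1) (continuous_mode n).aestronglyMeasurable
    (Eventually.of_forall fun x => (norm_mode n x).le)

lemma fc_add {f g : T2 → ℝ} (hf : Integrable f) (hg : Integrable g) (n : Fin 2 → ℤ) :
    fc (fun x => f x + g x) n = fc f n + fc g n := by
  unfold fc
  rw [← mul_add, ← integral_add (integrable_mul_mode hf _) (integrable_mul_mode hg _)]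
  simp [add_mul]

lemma fc_sub {f g : T2 → ℝ} (hf : Integrable f) (hg : Integrable g) (n : Fin 2 → ℤ) :
    fc (fun x => f x - g x) n = fc f n - fc g n := by
  unfold fc
  rw [← mul_sub, ← integral_sub (integrable_mul_mode hf _) (integrable_mul_mode hg _)]
  simp [sub_mul]

lemma fc_const_mul (c : ℝ) (f : T2 → ℝ) (n : Fin 2 → ℤ) :
    fc (fun x => c * f x) n = c * fc f n := by
  unfold fc
  rw [mul_left_comm, ← integral_const_mul (c : ℂ)]
  simp [mul_assoc]

lemma fc_neg (f : T2 → ℝ) (n : Fin 2 → ℤ) : fc f (-n) = conj (fc f n) := by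
  unfold fc
  rw [map_mul, ← integral_conj, map_inv₀, map_pow, conj_two_pi]
  simp [mode_neg]

lemma fc_zero (f : T2 → ℝ) : fc f 0 = (mean f : ℂ) := by
  unfold fc mean
  simp only [neg_zero, mode_zero, mul_one, integral_complex_ofReal]
  push_cast
  rfl

lemma mean_eq (f : T2 → ℝ) : mean f = invArea * ∫ x, f x := rfl

lemma norm_fc_le (f : T2 → ℝ) (n : Fin 2 → ℤ) : ‖fc f n‖ ≤ invArea * ∫ x, |f x| := by
  unfold fc invArea
  rw [norm_mul]
  have e : ‖((2 * Real.pi) ^ 2 : ℂ)⁻¹‖ = ((2 * Real.pi) ^ 2)⁻¹ := by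
    simp [Real.pi_pos.le]
  rw [e]
  gcongr
  refine (norm_integral_le_integral_norm _).trans (le_of_eq ?_)
  simp

lemma fc_translate (f : T2 → ℝ) (y : T2) (n : Fin 2 → ℤ) :
    fc (fun x => f (x + y)) n = mode n y * fc f n := by
  unfold fc
  rw [← integral_add_right_eq_self (fun x => (f x : ℂ) * mode (-n) x) y, mul_left_comm,
    ← integral_const_mul (mode n y)]
  congr 2
  funext x
  rw [mode_add_point]
  have : mode n y * mode (-n) y = 1 := by
    rw [← mode_add]; simp
  linear_combination (-(f (x + y)) * mode (-n) x : ℂ) * this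

lemma integrable_L2 (f : L2T) : Integrable (f : T2 → ℝ) :=
  (Lp.memLp f).integrable (by norm_num)

lemma memLp_ofReal {f : T2 → ℝ} (hf : MemLp f 2 volume) :
    MemLp (fun x => (f x : ℂ)) 2 volume := hf.ofReal (K := ℂ)

lemma hasSum_conj_fc_mul_fc {f g : T2 → ℝ} (hf : MemLp f 2 volume) (hg : MemLp g 2 volume) :
    HasSum (fun n => conj (fc f n) * fc g n) ((invArea * ∫ x, f x * g x : ℝ) : ℂ) := by
  have h := hasSum_fcC (memLp_ofReal hf) (memLp_ofReal hg)
  simp only [Complex.conj_ofReal, ← Complex.ofReal_mul, integral_complex_ofReal] at h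
  have e : ((invArea * ∫ x, f x * g x : ℝ) : ℂ)
      = ((2 * Real.pi) ^ 2 : ℂ)⁻¹ * ((∫ x, f x * g x : ℝ) : ℂ) := by
    unfold invArea
    push_cast
    rfl
  rw [e]
  exact h

lemma hasSum_re_conj_fc_mul_fc {f g : T2 → ℝ} (hf : MemLp f 2 volume) (hg : MemLp g 2 volume) :
    HasSum (fun n => (conj (fc f n) * fc g n).re) (invArea * ∫ x, f x * g x) := by
  simpa using Complex.hasSum_re (hasSum_conj_fc_mul_fc hf hg)

lemma hasSum_norm_fc_sq {f : T2 → ℝ} (hf : MemLp f 2 volume) :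
    HasSum (fun n => ‖fc f n‖ ^ 2) (invArea * ∫ x, f x ^ 2) := by
  have := hasSum_re_conj_fc_mul_fc hf hf
  simp only [← pow_two] at this
  convert this using 2 with n
  rw [Complex.conj_mul', ← Complex.ofReal_pow, Complex.ofReal_re]

lemma norm_L2_sq (f : L2T) : ‖f‖ ^ 2 = ∫ x, f x ^ 2 := by
  rw [← real_inner_self_eq_norm_sq, MeasureTheory.L2.inner_def]
  simp [pow_two]

lemma hasSum_norm_fc_L2 (f : L2T) : HasSum (fun n => ‖fc f n‖ ^ 2) (invArea * ‖f‖ ^ 2) := by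
  rw [norm_L2_sq]
  exact hasSum_norm_fc_sq (Lp.memLp f)

/-- The Fourier coefficients of a product. -/
lemma hasSum_fc_mul {f g : T2 → ℝ} (hf : MemLp f 2 volume) (hg : MemLp g 2 volume)
    (n : Fin 2 → ℤ) :
    HasSum (fun m => fc f m * fc g (n - m)) (fc (fun x => f x * g x) n) := by
  have hG : MemLp (fun x => (g x : ℂ) * mode (-n) x) 2 volume := by
    refine (memLp_ofReal hg).of_le ((memLp_ofReal hg).aestronglyMeasurable.mul
      (continuous_mode _).aestronglyMeasurable) (Eventually.of_forall fun x => ?_)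
    rw [norm_mul, norm_mode, mul_one]
  have h := hasSum_fcC (memLp_ofReal hf) hG
  have e1 : ∀ m, fcC (fun x => (g x : ℂ) * mode (-n) x) m = fc g (m + n) := by
    intro m
    unfold fcC fc
    congr 2
    funext x
    rw [neg_add_rev, mode_add]
    ring
  -- Parseval gives the terms `conj (fc f m) * fc g (m + n)`; the reflection `m ↦ -m`, with `f`
  -- real, turns them into a convolution.
  have h' := (Equiv.neg (Fin 2 → ℤ)).hasSum_iff.mpr h
  convert h' using 1
  · funext m
    simp only [Function.comp, Equiv.neg_apply, e1]
    rw [← fc_eq_fcC, fc_neg, Complex.conj_conj, sub_eq_neg_add]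
  · unfold fc
    congr 2
    funext x
    simp
    ring

end RealCoefficients

/-! ### Fourier weights and their summability in dimension two -/

section Weights

lemma freqSq_nonneg (n : Fin 2 → ℤ) : 0 ≤ freqSq n := Finset.sum_nonneg fun _ _ => sq_nonneg _

@[simp] lemma freqSq_zero : freqSq 0 = 0 := by simp [freqSq]

lemma one_le_freqSq {n : Fin 2 → ℤ} (hn : n ≠ 0) : 1 ≤ freqSq n := by
  obtain ⟨i, hi⟩ := Function.ne_iff.mp hn
  have h1 : (1 : ℝ) ≤ (n i : ℝ) ^ 2 := by
    have : (1 : ℤ) ≤ n i ^ 2 := by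
      have := Int.one_le_abs hi
      rw [← sq_abs]; nlinarith
    exact_mod_cast this
  exact h1.trans (Finset.single_le_sum (f := fun j => (n j : ℝ) ^ 2)
    (fun _ _ => sq_nonneg _) (Finset.mem_univ i))

lemma norm_sq_le_freqSq (n : Fin 2 → ℤ) : ‖n‖ ^ 2 ≤ freqSq n := by
  have h : ‖n‖ ≤ √(freqSq n) := by
    refine (pi_norm_le_iff_of_nonneg (Real.sqrt_nonneg _)).mpr fun i => ?_
    apply Real.le_sqrt_of_sq_le
    rw [Int.norm_eq_abs, sq_abs]
    exact Finset.single_le_sum (f := fun j => (n j : ℝ) ^ 2)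
      (fun _ _ => sq_nonneg _) (Finset.mem_univ i)
  calc ‖n‖ ^ 2 ≤ √(freqSq n) ^ 2 := pow_le_pow_left₀ (norm_nonneg _) h 2
    _ = freqSq n := Real.sq_sqrt (freqSq_nonneg n)

/-- The Bessel weight `⟨n⟩⁻¹`. -/
def bessel (n : Fin 2 → ℤ) : ℝ := (√(1 + freqSq n))⁻¹

lemma bessel_pos (n : Fin 2 → ℤ) : 0 < bessel n := by
  have := freqSq_nonneg n
  unfold bessel; positivity

lemma bessel_sq (n : Fin 2 → ℤ) : bessel n ^ 2 = (1 + freqSq n)⁻¹ := by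
  have := freqSq_nonneg n
  rw [bessel, inv_pow, Real.sq_sqrt (by linarith)]

lemma bessel_le_one (n : Fin 2 → ℤ) : bessel n ≤ 1 := by
  unfold bessel
  apply inv_le_one_of_one_le₀
  rw [Real.one_le_sqrt]
  linarith [freqSq_nonneg n]

/-- The exponent 3 exceeds the dimension 2, and `bessel n` is at most the inverse of the sup norm of
`n`. -/
lemma summable_bessel_cube : Summable fun n => bessel n ^ 3 := by
  have h := EisensteinSeries.summable_one_div_norm_rpow (k := 3) (by norm_num)
  refine Summable.of_norm_bounded_eventually h ?_
  -- The comparison fails only at `n = 0`, where the real power `0 ^ (-3)` has the default value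
  -- `0`.
  have : {n : Fin 2 → ℤ | ¬ ‖bessel n ^ 3‖ ≤ ‖n‖ ^ (-3 : ℝ)} ⊆ {0} := by
    intro n hn
    by_contra hne
    apply hn
    have hne' : n ≠ 0 := hne
    have hpos : 0 < ‖n‖ := norm_pos_iff.mpr hne'
    rw [Real.norm_of_nonneg (pow_pos (bessel_pos n) 3).le, Real.rpow_neg hpos.le]
    have : bessel n ≤ ‖n‖⁻¹ := by
      unfold bessel
      apply inv_anti₀ hpos
      apply Real.le_sqrt_of_sq_le
      linarith [norm_sq_le_freqSq n]
    calc bessel n ^ 3 ≤ (‖n‖⁻¹) ^ 3 := pow_le_pow_left₀ (bessel_pos n).le this 3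
      _ = (‖n‖ ^ (3 : ℝ))⁻¹ := by rw [inv_pow]; norm_cast
  exact (Set.finite_singleton _).subset this

/-- The sum of `⟨n⟩⁻³`. -/
def besselSum : ℝ := ∑' n, bessel n ^ 3

lemma besselSum_nonneg : 0 ≤ besselSum := tsum_nonneg fun n => (pow_pos (bessel_pos n) 3).le

/-- `bessel` with values in `[0, ∞]`. -/
def besselE (n : Fin 2 → ℤ) : ℝ≥0∞ := ENNReal.ofReal (bessel n)

lemma tsum_besselE_cube : ∑' n, besselE n ^ 3 = ENNReal.ofReal besselSum := by
  rw [besselSum, ENNReal.ofReal_tsum_of_nonneg (fun n => (pow_pos (bessel_pos n) 3).le)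
    summable_bessel_cube]
  exact tsum_congr fun n => by rw [besselE, ENNReal.ofReal_pow (bessel_pos n).le]

lemma besselE_le_one (n : Fin 2 → ℤ) : besselE n ≤ 1 := by
  rw [besselE, ← ENNReal.ofReal_one]
  exact ENNReal.ofReal_le_ofReal (bessel_le_one n)

end Weights

/-! ### Product estimates as convolution estimates -/

section Convolution

lemma tsum_mul_sq_le {ι : Type*} (a b : ι → ℝ≥0∞) :
    (∑' i, a i * b i) ^ 2 ≤ (∑' i, a i ^ 2) * ∑' i, b i ^ 2 := by
  let _ : MeasurableSpace ι := ⊤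
  have h := ENNReal.lintegral_mul_le_Lp_mul_Lq (Measure.count : Measure ι) Real.HolderConjugate.two_two
    (f := a) (g := b) (Measurable.of_discrete).aemeasurable (Measurable.of_discrete).aemeasurable
  simp only [lintegral_count, Pi.mul_apply] at h
  have h2 := pow_le_pow_left' h 2
  refine h2.trans (le_of_eq ?_)
  rw [mul_pow, ← ENNReal.rpow_natCast, ← ENNReal.rpow_natCast, ← ENNReal.rpow_mul,
    ← ENNReal.rpow_mul]
  norm_num

lemma tsum_tsum_shift (X Y : (Fin 2 → ℤ) → ℝ≥0∞) :
    ∑' n, ∑' m, X m * Y (n - m) = (∑' n, X n) * ∑' n, Y n := by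
  rw [ENNReal.tsum_comm, ← ENNReal.tsum_mul_right]
  refine tsum_congr fun m => ?_
  rw [ENNReal.tsum_mul_left]
  congr 1
  exact (Equiv.subRight m).tsum_eq Y

/-- Both weights are at most 1, so in the product of four factors two can be replaced by 1 and by
the larger weight. This leaves the cube of the larger weight, and the sum of the cubes is
independent of the shift `n`. -/
lemma tsum_besselE_conv_le (n : Fin 2 → ℤ) :
    ∑' m, besselE m ^ 2 * besselE (n - m) ^ 2 ≤ 2 * ENNReal.ofReal besselSum := by
  have h : ∀ m, besselE m ^ 2 * besselE (n - m) ^ 2 ≤ besselE m ^ 3 + besselE (n - m) ^ 3 := by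
    intro m
    rcases le_total (besselE m) (besselE (n - m)) with h | h
    · calc besselE m ^ 2 * besselE (n - m) ^ 2 ≤ 1 * besselE (n - m) * besselE (n - m) ^ 2 := by
            gcongr
            rw [pow_two]
            exact mul_le_mul' (besselE_le_one m) h
        _ ≤ _ := by rw [one_mul, ← pow_succ']; exact le_add_self
    · calc besselE m ^ 2 * besselE (n - m) ^ 2 ≤ besselE m ^ 2 * (1 * besselE m) := by
            gcongr
            rw [pow_two]
            exact mul_le_mul' (besselE_le_one _) h
        _ ≤ _ := by rw [one_mul, ← pow_succ]; exact le_self_add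
  refine (ENNReal.tsum_le_tsum h).trans ?_
  have e : ∑' m, besselE (n - m) ^ 3 = ∑' m, besselE m ^ 3 :=
    (Equiv.subLeft n).tsum_eq (fun m => besselE m ^ 3)
  rw [ENNReal.tsum_add, e, tsum_besselE_cube, two_mul]

/-- The square of the smallest of the three weights is at most the product of the other two. What
remains is a product of two cubes, whose double sum factorises; the right-hand side lists the three
possible pairs. -/
lemma besselE_triple_le (n m : Fin 2 → ℤ) :
    besselE n ^ 2 * (besselE m ^ 2 * besselE (n - m) ^ 2) ≤
      besselE m ^ 3 * besselE (n - m) ^ 3 + besselE n ^ 3 * besselE (n - m) ^ 3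
        + besselE n ^ 3 * besselE m ^ 3 := by
  have key : ∀ a b c : ℝ≥0∞, a ≤ b → a ≤ c → a ^ 2 * (b ^ 2 * c ^ 2) ≤ b ^ 3 * c ^ 3 := by
    intro a b c hb hc
    calc a ^ 2 * (b ^ 2 * c ^ 2) = (a * a) * (b ^ 2 * c ^ 2) := by rw [pow_two a]
      _ ≤ (b * c) * (b ^ 2 * c ^ 2) := by gcongr
      _ = b ^ 3 * c ^ 3 := by ring
  set a := besselE n
  set b := besselE m
  set c := besselE (n - m)
  have h : (a ≤ b ∧ a ≤ c) ∨ (b ≤ a ∧ b ≤ c) ∨ (c ≤ a ∧ c ≤ b) := by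
    rcases le_total a b with h1 | h1
    · rcases le_total a c with h3 | h3
      · exact .inl ⟨h1, h3⟩
      · exact .inr (.inr ⟨h3, h3.trans h1⟩)
    · rcases le_total b c with h2 | h2
      · exact .inr (.inl ⟨h1, h2⟩)
      · exact .inr (.inr ⟨h2.trans h1, h2⟩)
  rcases h with ⟨h1, h2⟩ | ⟨h1, h2⟩ | ⟨h1, h2⟩
  · refine (key a b c h1 h2).trans ?_
    rw [add_assoc]; exact le_self_add
  · calc a ^ 2 * (b ^ 2 * c ^ 2) = b ^ 2 * (a ^ 2 * c ^ 2) := by ring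
      _ ≤ a ^ 3 * c ^ 3 := key b a c h1 h2
      _ ≤ _ := by rw [add_assoc, add_left_comm]; exact le_self_add
  · calc a ^ 2 * (b ^ 2 * c ^ 2) = c ^ 2 * (a ^ 2 * b ^ 2) := by ring
      _ ≤ a ^ 3 * b ^ 3 := key c a b h1 h2
      _ ≤ _ := le_add_self

lemma tsum_besselE_triple_le :
    ∑' n, ∑' m, besselE n ^ 2 * (besselE m ^ 2 * besselE (n - m) ^ 2)
      ≤ 3 * ENNReal.ofReal besselSum ^ 2 := by
  refine (ENNReal.tsum_le_tsum fun n => ENNReal.tsum_le_tsum fun m => besselE_triple_le n m).trans ?_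
  simp only [ENNReal.tsum_add]
  have e1 := tsum_tsum_shift (fun n => besselE n ^ 3) (fun n => besselE n ^ 3)
  have e2 : ∑' n, ∑' m, besselE n ^ 3 * besselE (n - m) ^ 3
      = (∑' n, besselE n ^ 3) * ∑' n, besselE n ^ 3 := by
    rw [← ENNReal.tsum_mul_right]
    refine tsum_congr fun n => ?_
    rw [ENNReal.tsum_mul_left]
    congr 1
    exact (Equiv.subLeft n).tsum_eq (fun m => besselE m ^ 3)
  have e3 : ∑' n, ∑' m, besselE n ^ 3 * besselE m ^ 3
      = (∑' n, besselE n ^ 3) * ∑' n, besselE n ^ 3 := by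
    simp only [ENNReal.tsum_mul_left, ENNReal.tsum_mul_right]
  rw [e1, e2, e3, tsum_besselE_cube]
  exact le_of_eq (by ring)

lemma sobolevSq_one (a : (Fin 2 → ℤ) → ℂ) :
    sobolevSq 1 a = ∑' n, ENNReal.ofReal (1 + freqSq n) * ‖a n‖ₑ ^ 2 := by
  unfold sobolevSq
  refine tsum_congr fun n => ?_
  rw [pow_one, ENNReal.ofReal_mul (by linarith [freqSq_nonneg n]),
    ENNReal.ofReal_pow (norm_nonneg _), ofReal_norm]

/-- The pointwise convolution bound behind the two product estimates. -/
lemma conv_sq_le (a b : (Fin 2 → ℤ) → ℂ) (n : Fin 2 → ℤ) :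
    (∑' m, ‖a m‖ₑ * ‖b (n - m)‖ₑ) ^ 2 ≤
      (∑' m, (ENNReal.ofReal (1 + freqSq m) * ‖a m‖ₑ ^ 2) *
        (ENNReal.ofReal (1 + freqSq (n - m)) * ‖b (n - m)‖ₑ ^ 2)) *
      ∑' m, besselE m ^ 2 * besselE (n - m) ^ 2 := by
  set w : (Fin 2 → ℤ) → ℝ≥0∞ := fun m => ENNReal.ofReal (√(1 + freqSq m)) with hw
  have hw2 : ∀ m, w m ^ 2 = ENNReal.ofReal (1 + freqSq m) := fun m => by
    rw [hw, ← ENNReal.ofReal_pow (Real.sqrt_nonneg _),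
      Real.sq_sqrt (by linarith [freqSq_nonneg m])]
  have hwb : ∀ m, w m * besselE m = 1 := fun m => by
    have h0 : 0 < √(1 + freqSq m) := Real.sqrt_pos.mpr (by linarith [freqSq_nonneg m])
    rw [hw, besselE, bessel, ← ENNReal.ofReal_mul h0.le, mul_inv_cancel₀ h0.ne', ENNReal.ofReal_one]
  have h := tsum_mul_sq_le (fun m => w m * ‖a m‖ₑ * (w (n - m) * ‖b (n - m)‖ₑ))
    (fun m => besselE m * besselE (n - m))
  simp only [mul_pow, hw2] at h
  refine le_trans (le_of_eq ?_) h
  congr 1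
  refine tsum_congr fun m => ?_
  calc ‖a m‖ₑ * ‖b (n - m)‖ₑ = ‖a m‖ₑ * ‖b (n - m)‖ₑ * (w m * besselE m)
        * (w (n - m) * besselE (n - m)) := by rw [hwb, hwb, mul_one, mul_one]
    _ = _ := by ring

/-- `H¹ · H¹ ⊂ L²`, on the Fourier side. -/
lemma tsum_conv_sq_le (a b : (Fin 2 → ℤ) → ℂ) :
    ∑' n, (∑' m, ‖a m‖ₑ * ‖b (n - m)‖ₑ) ^ 2 ≤
      2 * ENNReal.ofReal besselSum * (sobolevSq 1 a * sobolevSq 1 b) := by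
  refine (ENNReal.tsum_le_tsum fun n => (conv_sq_le a b n).trans
    (mul_le_mul_right (tsum_besselE_conv_le n) _)).trans ?_
  rw [ENNReal.tsum_mul_right, tsum_tsum_shift (fun m => ENNReal.ofReal (1 + freqSq m) * ‖a m‖ₑ ^ 2)
    (fun m => ENNReal.ofReal (1 + freqSq m) * ‖b m‖ₑ ^ 2), ← sobolevSq_one, ← sobolevSq_one, mul_comm]

/-- `⟨∇⟩⁻¹(H¹ · H¹)` has summable Fourier coefficients. -/
lemma tsum_besselE_conv_sq_le (a b : (Fin 2 → ℤ) → ℂ) :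
    (∑' n, besselE n * ∑' m, ‖a m‖ₑ * ‖b (n - m)‖ₑ) ^ 2 ≤
      3 * ENNReal.ofReal besselSum ^ 2 * (sobolevSq 1 a * sobolevSq 1 b) := by
  set X : (Fin 2 → ℤ) → ℝ≥0∞ := fun n => ∑' m, (ENNReal.ofReal (1 + freqSq m) * ‖a m‖ₑ ^ 2) *
        (ENNReal.ofReal (1 + freqSq (n - m)) * ‖b (n - m)‖ₑ ^ 2) with hX
  set Y : (Fin 2 → ℤ) → ℝ≥0∞ := fun n => ∑' m, besselE m ^ 2 * besselE (n - m) ^ 2 with hY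
  have hsq : ∀ z : ℝ≥0∞, (z ^ (1 / 2 : ℝ)) ^ 2 = z := fun z => by
    rw [← ENNReal.rpow_natCast, ← ENNReal.rpow_mul]; norm_num
  have h1 : ∀ n, besselE n * ∑' m, ‖a m‖ₑ * ‖b (n - m)‖ₑ
      ≤ X n ^ (1 / 2 : ℝ) * (besselE n * Y n ^ (1 / 2 : ℝ)) := by
    intro n
    have h := conv_sq_le a b n
    have h2 : ∑' m, ‖a m‖ₑ * ‖b (n - m)‖ₑ ≤ (X n) ^ (1 / 2 : ℝ) * (Y n) ^ (1 / 2 : ℝ) := by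
      rw [← ENNReal.mul_rpow_of_nonneg _ _ (by norm_num)]
      refine (ENNReal.pow_le_pow_left_iff (n := 2) (by norm_num)).mp ?_
      rw [hsq]
      exact h
    calc _ ≤ besselE n * ((X n) ^ (1 / 2 : ℝ) * (Y n) ^ (1 / 2 : ℝ)) := by gcongr
      _ = _ := by ring
  -- A second Cauchy–Schwarz, now in `n`, separates `X`, which sums to the product of the `H¹`
  -- norms, from the weights, which form the triple sum.
  refine (pow_le_pow_left' (ENNReal.tsum_le_tsum h1) 2).trans ((tsum_mul_sq_le _ _).trans ?_)
  simp only [mul_pow, hsq]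
  have hXs : ∑' n, X n = sobolevSq 1 a * sobolevSq 1 b := by
    rw [sobolevSq_one, sobolevSq_one]
    exact tsum_tsum_shift (fun m => ENNReal.ofReal (1 + freqSq m) * ‖a m‖ₑ ^ 2)
      (fun m => ENNReal.ofReal (1 + freqSq m) * ‖b m‖ₑ ^ 2)
  have hYs : ∑' n, besselE n ^ 2 * Y n ≤ 3 * ENNReal.ofReal besselSum ^ 2 := by
    refine le_trans (le_of_eq ?_) tsum_besselE_triple_le
    exact tsum_congr fun n => by rw [hY, ENNReal.tsum_mul_left]
  rw [hXs, mul_comm]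
  gcongr

/-- The Fourier coefficients of a product are bounded by the convolution. -/
lemma enorm_fc_mul_le {f g : T2 → ℝ} (hf : MemLp f 2 volume) (hg : MemLp g 2 volume)
    (n : Fin 2 → ℤ) :
    ‖fc (fun x => f x * g x) n‖ₑ ≤ ∑' m, ‖fc f m‖ₑ * ‖fc g (n - m)‖ₑ := by
  rw [← (hasSum_fc_mul hf hg n).tsum_eq]
  simp only [← enorm_mul]
  exact enorm_tsum_le_tsum_enorm

end Convolution

/-! ### Absolutely continuous functions of time and Grönwall's inequality -/

section Primitives

variable {E : Type*} [NormedAddCommGroup E] [NormedSpace ℝ E]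

/-- Domination of increments transfers absolute continuity. It is applied with `G` the indefinite
integral of the norm of a derivative. -/
lemma absolutelyContinuous_of_dist_le {X : Type*} [PseudoMetricSpace X] {f : ℝ → X} {G : ℝ → ℝ}
    {K a b : ℝ} (hG : AbsolutelyContinuousOnInterval G a b)
    (h : ∀ x ∈ uIcc a b, ∀ y ∈ uIcc a b, dist (f x) (f y) ≤ K * dist (G x) (G y)) :
    AbsolutelyContinuousOnInterval f a b := by
  have h0 := (Tendsto.const_mul K hG)
  rw [mul_zero] at h0
  refine squeeze_zero' (Eventually.of_forall fun _ => Finset.sum_nonneg fun i hi ↦ dist_nonneg)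
    ?_ h0
  rw [eventually_inf_principal]
  filter_upwards with ⟨n, I⟩ hnI
  rw [Finset.mul_sum]
  exact Finset.sum_le_sum fun i hi => h _ (hnI.1 i hi).1 _ (hnI.1 i hi).2

/-- `W` is a primitive of the integrable function `w` on `[a, b]`. -/
structure IsPrimitive (W w : ℝ → E) (a b : ℝ) : Prop where
  le : a ≤ b
  integrable : IntervalIntegrable w volume a b
  eq : ∀ t ∈ Icc a b, W t = W a + ∫ s in a..t, w s

namespace IsPrimitive

variable {W w : ℝ → E} {a b : ℝ}

lemma sub_eq (h : IsPrimitive W w a b) {s t : ℝ} (hs : s ∈ Icc a b) (ht : t ∈ Icc a b) :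
    W t - W s = ∫ r in s..t, w r := by
  rw [h.eq t ht, h.eq s hs, add_sub_add_left_eq_sub]
  apply intervalIntegral.integral_interval_sub_left
  · exact h.integrable.mono_set (by rw [uIcc_of_le ht.1, uIcc_of_le h.le]; exact Icc_subset_Icc_right ht.2)
  · exact h.integrable.mono_set (by rw [uIcc_of_le hs.1, uIcc_of_le h.le]; exact Icc_subset_Icc_right hs.2)

lemma mono (h : IsPrimitive W w a b) {c d : ℝ} (hac : a ≤ c) (hcd : c ≤ d) (hdb : d ≤ b) :
    IsPrimitive W w c d where
  le := hcd
  integrable := h.integrable.mono_set (by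
    rw [uIcc_of_le hcd, uIcc_of_le h.le]; exact Icc_subset_Icc hac hdb)
  eq t ht := by
    rw [← h.sub_eq ⟨hac, hcd.trans hdb⟩ ⟨hac.trans ht.1, ht.2.trans hdb⟩]
    abel

lemma dist_le (h : IsPrimitive W w a b) {s t : ℝ} (hs : s ∈ Icc a b) (ht : t ∈ Icc a b) :
    dist (W s) (W t) ≤ dist (∫ r in a..s, ‖w r‖) (∫ r in a..t, ‖w r‖) := by
  rw [dist_comm, dist_eq_norm, h.sub_eq hs ht, dist_comm, Real.dist_eq]
  have hi : ∀ {x}, x ∈ Icc a b → IntervalIntegrable (fun r => ‖w r‖) volume a x := fun {x} hx =>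
    h.integrable.norm.mono_set (by
      rw [uIcc_of_le hx.1, uIcc_of_le h.le]; exact Icc_subset_Icc_right hx.2)
  rw [intervalIntegral.integral_interval_sub_left (hi ht) (hi hs)]
  exact intervalIntegral.norm_integral_le_abs_integral_norm

lemma absolutelyContinuous (h : IsPrimitive W w a b) : AbsolutelyContinuousOnInterval W a b := by
  refine absolutelyContinuous_of_dist_le (K := 1)
    (h.integrable.norm.absolutelyContinuousOnInterval_intervalIntegral left_mem_uIcc) ?_
  rw [uIcc_of_le h.le]
  intro x hx y hy
  rw [one_mul]
  exact h.dist_le hx hy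

lemma continuousOn (h : IsPrimitive W w a b) : ContinuousOn W (Icc a b) := by
  have := h.absolutelyContinuous.continuousOn
  rwa [uIcc_of_le h.le] at this

lemma ae_hasDerivAt [CompleteSpace E] (h : IsPrimitive W w a b) :
    ∀ᵐ t, t ∈ Ioo a b → HasDerivAt W (w t) t := by
  filter_upwards [h.integrable.ae_hasDerivAt_integral] with t ht hmem
  rw [uIcc_of_le h.le] at ht
  have h1 := (ht (Ioo_subset_Icc_self hmem) a (left_mem_Icc.mpr h.le)).const_add (W a)
  refine h1.congr_of_eventuallyEq ?_
  filter_upwards [isOpen_Ioo.mem_nhds hmem] with s hs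
  exact h.eq s (Ioo_subset_Icc_self hs)

end IsPrimitive

lemma ae_Ioo_imp_uIcc {p : ℝ → Prop} {a b : ℝ} (hab : a ≤ b) (h : ∀ᵐ t, t ∈ Ioo a b → p t) :
    ∀ᵐ t, t ∈ uIcc a b → p t := by
  have h₁ : ∀ᵐ x, x ≠ a := by simp [ae_iff, measure_singleton]
  have h₂ : ∀ᵐ x, x ≠ b := by simp [ae_iff, measure_singleton]
  filter_upwards [h, h₁, h₂] with t ht h1 h2 hm
  rw [uIcc_of_le hab] at hm
  exact ht ⟨lt_of_le_of_ne hm.1 h1.symm, lt_of_le_of_ne hm.2 h2⟩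

/-- The difference of `f` and the indefinite integral of `f'` is absolutely continuous with
derivative zero almost everywhere, hence constant. Differentiability is a hypothesis because it is
not automatic in a general Banach space. -/
lemma integral_eq_sub_of_absolutelyContinuous [CompleteSpace E] {f f' : ℝ → E} {a b : ℝ}
    (hab : a ≤ b) (hf : AbsolutelyContinuousOnInterval f a b)
    (hf' : IntervalIntegrable f' volume a b)
    (hd : ∀ᵐ t, t ∈ Ioo a b → HasDerivAt f (f' t) t) :
    ∫ t in a..b, f' t = f b - f a := by
  have hP : IsPrimitive (fun x => ∫ t in a..x, f' t) f' a b :=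
    ⟨hab, hf', fun t _ => by simp⟩
  obtain ⟨C, hC⟩ := (hf.sub hP.absolutelyContinuous).const_of_ae_hasDerivAt_zero (by
    apply ae_Ioo_imp_uIcc hab
    filter_upwards [hd, hP.ae_hasDerivAt] with x h1 h2 hx
    have := (h1 hx).sub (h2 hx)
    rwa [sub_self] at this)
  have h1 := hC a left_mem_uIcc
  have h2 := hC b right_mem_uIcc
  simp only [Pi.sub_apply, intervalIntegral.integral_same, sub_zero] at h1 h2
  rw [h1, ← h2]
  abel

lemma isPrimitive_of_absolutelyContinuous [CompleteSpace E] {f f' : ℝ → E} {a b : ℝ}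
    (hab : a ≤ b) (hf : AbsolutelyContinuousOnInterval f a b)
    (hf' : IntervalIntegrable f' volume a b)
    (hd : ∀ᵐ t, t ∈ Ioo a b → HasDerivAt f (f' t) t) : IsPrimitive f f' a b := by
  refine ⟨hab, hf', fun t ht => ?_⟩
  have hs : uIcc a t ⊆ uIcc a b := by
    rw [uIcc_of_le ht.1, uIcc_of_le hab]; exact Icc_subset_Icc_right ht.2
  rw [integral_eq_sub_of_absolutelyContinuous ht.1 (hf.mono hs) (hf'.mono_set hs)
    (by filter_upwards [hd] with s h1 hs using h1 (Ioo_subset_Ioo_right ht.2 hs))]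
  abel

/-- For real functions the integrability of the derivative need not be assumed: it follows from
absolute continuity. -/
lemma isPrimitive_real_of_absolutelyContinuous {f f' : ℝ → ℝ} {a b : ℝ}
    (hab : a ≤ b) (hf : AbsolutelyContinuousOnInterval f a b)
    (hd : ∀ᵐ t, t ∈ Ioo a b → HasDerivAt f (f' t) t) : IsPrimitive f f' a b := by
  refine isPrimitive_of_absolutelyContinuous hab hf ?_ hd
  refine hf.intervalIntegrable_deriv.congr_ae ?_
  rw [EventuallyEq, ae_restrict_iff' measurableSet_uIoc]
  filter_upwards [ae_Ioo_imp_uIcc hab hd] with t ht hm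
  exact (ht (uIoc_subset_uIcc hm)).deriv

/-- A Lipschitz function of a primitive is a primitive of its derivative. -/
lemma IsPrimitive.comp_lipschitz {W w : ℝ → E} {F F' : ℝ → ℝ} {a b K : ℝ}
    (h : IsPrimitive W w a b)
    (hF : ∀ x ∈ Icc a b, ∀ y ∈ Icc a b, |F x - F y| ≤ K * ‖W x - W y‖)
    (hK : 0 ≤ K)
    (hd : ∀ᵐ t, t ∈ Ioo a b → HasDerivAt F (F' t) t) : IsPrimitive F F' a b := by
  refine isPrimitive_real_of_absolutelyContinuous h.le ?_ hd
  refine absolutelyContinuous_of_dist_le (K := K)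
    (h.integrable.norm.absolutelyContinuousOnInterval_intervalIntegral left_mem_uIcc) ?_
  rw [uIcc_of_le h.le]
  intro x hx y hy
  rw [Real.dist_eq]
  refine (hF x hx y hy).trans ?_
  gcongr
  rw [← dist_eq_norm]
  exact h.dist_le hx hy

/-- Grönwall's inequality for absolutely continuous functions. -/
lemma IsPrimitive.gronwall {F F' k : ℝ → ℝ} {b c : ℝ} (h : IsPrimitive F F' 0 b)
    (hc : 0 ≤ c) (hk : IntervalIntegrable k volume 0 b) (hk0 : ∀ t, 0 ≤ k t)
    (hF : ∀ᵐ t, t ∈ Ioo 0 b → F' t ≤ c * F t + k t) :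
    ∀ t ∈ Icc 0 b, F t ≤ Real.exp (c * t) * (F 0 + ∫ s in 0..t, k s) := by
  intro t ht
  have ht' := h.mono le_rfl ht.1 ht.2
  have hs : uIcc 0 t ⊆ uIcc 0 b := by
    rw [uIcc_of_le ht.1, uIcc_of_le h.le]; exact Icc_subset_Icc_right ht.2
  have hexp : AbsolutelyContinuousOnInterval (fun s => Real.exp (-(c * s))) 0 t := by
    apply ContDiffOn.absolutelyContinuousOnInterval
    fun_prop
  have hP : IsPrimitive (fun s => Real.exp (-(c * s)) * F s)
      (fun s => Real.exp (-(c * s)) * (-c) * F s + Real.exp (-(c * s)) * F' s) 0 t := by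
    refine isPrimitive_real_of_absolutelyContinuous ht.1
      (hexp.mul ht'.absolutelyContinuous) ?_
    filter_upwards [ht'.ae_hasDerivAt] with s hs hm
    have h1 : HasDerivAt (fun s => Real.exp (-(c * s))) (Real.exp (-(c * s)) * (-c)) s := by
      have := ((hasDerivAt_id s).const_mul c).neg.exp
      simpa using this
    exact h1.mul (hs hm)
  have e := hP.eq t (right_mem_Icc.mpr ht.1)
  have hle : ∫ s in 0..t, (Real.exp (-(c * s)) * (-c) * F s + Real.exp (-(c * s)) * F' s)
      ≤ ∫ s in 0..t, k s := by
    apply intervalIntegral.integral_mono_ae_restrict ht.1 hP.integrable (hk.mono_set hs)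
    rw [EventuallyLE, ae_restrict_iff' measurableSet_Icc]
    have := ae_Ioo_imp_uIcc h.le hF
    rw [uIcc_of_le h.le] at this
    filter_upwards [this] with s h1 hm
    have h2 := h1 ⟨hm.1, hm.2.trans ht.2⟩
    have h3 : Real.exp (-(c * s)) ≤ 1 := Real.exp_le_one_iff.mpr (by
      have := mul_nonneg hc hm.1; linarith)
    calc _ = Real.exp (-(c * s)) * (F' s - c * F s) := by ring
      _ ≤ Real.exp (-(c * s)) * k s := by
        apply mul_le_mul_of_nonneg_left _ (Real.exp_pos _).le; linarith
      _ ≤ 1 * k s := by gcongr; exact hk0 s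
      _ = k s := one_mul _
  have h4 : Real.exp (-(c * t)) * F t ≤ F 0 + ∫ s in 0..t, k s := by
    rw [e]; simp only [mul_zero, neg_zero, Real.exp_zero, one_mul]; linarith
  calc F t = Real.exp (c * t) * (Real.exp (-(c * t)) * F t) := by
        rw [← mul_assoc, ← Real.exp_add]; simp
    _ ≤ _ := by gcongr

end Primitives

/-! ### Weak time derivatives and primitives -/

section WeakDerivative

variable {E : Type*} [NormedAddCommGroup E] [NormedSpace ℝ E]

lemma exists_Ioo_of_isCompact {K : Set ℝ} (hK : IsCompact K) {T : ℝ} (hT : 0 < T)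
    (h : K ⊆ Ioo 0 T) : ∃ b ∈ Ioo 0 T, K ⊆ Ioo 0 b := by
  rcases K.eq_empty_or_nonempty with rfl | hne
  · exact ⟨T / 2, ⟨by linarith, by linarith⟩, empty_subset _⟩
  · obtain ⟨m, hm, hmax⟩ := hK.exists_isGreatest hne
    have h1 := h hm
    refine ⟨(m + T) / 2, ⟨by linarith [h1.1], by linarith [h1.2]⟩, fun x hx => ⟨(h hx).1, ?_⟩⟩
    have := hmax hx
    linarith [h1.2]

lemma setIntegral_eq_intervalIntegral_of_zero {F : ℝ → E} {b T : ℝ} (hb : b ∈ Ioo 0 T)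
    (hF : ∀ t, t ∉ Ioo 0 b → F t = 0) : ∫ t in Ioo 0 T, F t = ∫ t in 0..b, F t := by
  rw [intervalIntegral.integral_of_le hb.1.le]
  symm
  rw [← integral_indicator measurableSet_Ioc, ← integral_indicator measurableSet_Ioo]
  congr 1
  funext t
  by_cases ht : t ∈ Ioo 0 b
  · rw [indicator_of_mem (Ioo_subset_Ioc_self ht),
      indicator_of_mem (Ioo_subset_Ioo_right hb.2.le ht)]
  · have : F t = 0 := hF t ht
    simp [indicator, this]

lemma deriv_eq_zero_of_notMem {η : ℝ → ℝ} {s : Set ℝ} (h : tsupport η ⊆ s) {t : ℝ} (ht : t ∉ s) :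
    deriv η t = 0 := by
  by_contra hne
  exact ht (h (support_deriv_subset hne))

/-- The product `η G` is absolutely continuous and vanishes at both ends of an interval `[0, b]`
with `b < T`. Working on `[0, b]` matters because `g` need not be integrable up to `T`. -/
lemma integral_deriv_smul_primitive [CompleteSpace E] {G g : ℝ → E} {T : ℝ} (hT : 0 < T)
    (hG : ∀ b ∈ Ioo 0 T, IsPrimitive G g 0 b) {η : ℝ → ℝ} (hη : ContDiff ℝ (⊤ : ℕ∞) η)
    (hc : HasCompactSupport η) (hs : tsupport η ⊆ Ioo 0 T) :
    ∫ t in Ioo 0 T, deriv η t • G t = -∫ t in Ioo 0 T, η t • g t := by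
  obtain ⟨b, hb, hsb⟩ := exists_Ioo_of_isCompact hc hT hs
  have hz : ∀ t, t ∉ Ioo 0 b → η t = 0 := fun t ht => image_eq_zero_of_notMem_tsupport
    fun h => ht (hsb h)
  have hd := hη.continuous_deriv (by simp)
  rw [setIntegral_eq_intervalIntegral_of_zero hb (F := fun t => deriv η t • G t) fun t ht => by
      rw [deriv_eq_zero_of_notMem hsb ht, zero_smul],
    setIntegral_eq_intervalIntegral_of_zero hb (F := fun t => η t • g t) fun t ht => by
      rw [hz t ht, zero_smul]]
  have hP := hG b hb
  have hηac : AbsolutelyContinuousOnInterval η 0 b :=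
    (hη.of_le (by simp)).contDiffOn.absolutelyContinuousOnInterval
  have i1 : IntervalIntegrable (fun t => deriv η t • G t) volume 0 b := by
    apply ContinuousOn.intervalIntegrable
    rw [uIcc_of_le hb.1.le]
    exact hd.continuousOn.smul hP.continuousOn
  have i2 : IntervalIntegrable (fun t => η t • g t) volume 0 b :=
    hP.integrable.continuousOn_smul hη.continuous.continuousOn
  have key := integral_eq_sub_of_absolutelyContinuous hb.1.le
    (hηac.smul hP.absolutelyContinuous)
    (f' := fun t => η t • g t + deriv η t • G t) (i2.add i1) (by
      filter_upwards [hP.ae_hasDerivAt] with t ht hm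
      exact ((hη.differentiable (by simp)) t).hasDerivAt.smul (ht hm))
  rw [intervalIntegral.integral_add i2 i1] at key
  simp only [Pi.smul_apply', hz 0 (by simp), hz b (by simp), zero_smul, sub_zero] at key
  exact eq_neg_of_add_eq_zero_right key

lemma integrableOn_smul_test {f : ℝ → E} {T : ℝ} (hf : LocallyIntegrableOn f (Ioo 0 T))
    {η : ℝ → ℝ} (hη : Continuous η) (hc : HasCompactSupport η) (hs : tsupport η ⊆ Ioo 0 T) :
    Integrable (fun t => η t • f t) := by
  have h1 := (hf.integrableOn_compact_subset hs hc).continuousOn_smul hη.continuousOn hc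
  rw [integrableOn_iff_integrable_of_support_subset] at h1
  · exact h1
  · intro t ht
    apply subset_tsupport
    intro h0
    exact ht (by simp [h0])

/-- A locally integrable function with vanishing weak derivative is constant. -/
lemma ae_const_of_integral_deriv_smul_eq_zero [CompleteSpace E] {z : ℝ → E} {T : ℝ} (hT : 0 < T)
    (hz : LocallyIntegrableOn z (Ioo 0 T))
    (h : ∀ η : ℝ → ℝ, ContDiff ℝ (⊤ : ℕ∞) η → HasCompactSupport η → tsupport η ⊆ Ioo 0 T →
      ∫ t in Ioo 0 T, deriv η t • z t = 0) :
    ∃ c, ∀ᵐ t, t ∈ Ioo 0 T → z t = c := by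
  obtain ⟨η₀, hs₀, hc₀, hη₀, hr₀, h1₀⟩ := exists_contDiff_tsupport_subset (n := (⊤ : ℕ∞))
    (isOpen_Ioo.mem_nhds (show T / 2 ∈ Ioo 0 T from ⟨by linarith, by linarith⟩))
  set I := ∫ t, η₀ t with hI
  have hIpos : 0 < I := by
    refine hη₀.continuous.integral_pos_of_hasCompactSupport_nonneg_nonzero hc₀
      (fun t => (hr₀ (mem_range_self t)).1) (x := T / 2) (by simp [h1₀])
  refine ⟨I⁻¹ • ∫ t, η₀ t • z t, ?_⟩
  set c := I⁻¹ • ∫ t, η₀ t • z t with hcdef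
  have hloc : LocallyIntegrableOn (fun t => z t - c) (Ioo 0 T) :=
    hz.sub ((locallyIntegrable_const c).locallyIntegrableOn _)
  have hfund := isOpen_Ioo.ae_eq_zero_of_integral_contDiff_smul_eq_zero hloc ?_
  · filter_upwards [hfund] with t ht hm
    exact sub_eq_zero.mp (ht hm)
  intro η hη hc hs
  set J := ∫ t, η t with hJ
  set K := tsupport η ∪ tsupport η₀
  have hK : IsCompact K := hc.isCompact.union hc₀.isCompact
  have hKs : K ⊆ Ioo 0 T := union_subset hs hs₀
  have hKne : K.Nonempty := ⟨T / 2, Or.inr (subset_tsupport _ (by simp [h1₀]))⟩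
  obtain ⟨m, hm, hmin⟩ := hK.exists_isLeast hKne
  obtain ⟨M, hM, hmax⟩ := hK.exists_isGreatest hKne
  -- The classical du Bois-Reymond argument: subtracting a multiple of the fixed bump `η₀` makes the
  -- integral zero, so `ρ` is the derivative of a compactly supported function, which is an
  -- admissible test function.
  set ρ : ℝ → ℝ := fun t => η t - (J / I) * η₀ t with hρ
  have hρs : ContDiff ℝ (⊤ : ℕ∞) ρ := hη.sub (contDiff_const.mul hη₀)
  have hρ0 : ∀ t, t ∉ K → ρ t = 0 := fun t ht => by
    have h1 : η t = 0 := image_eq_zero_of_notMem_tsupport fun h => ht (Or.inl h)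
    have h2 : η₀ t = 0 := image_eq_zero_of_notMem_tsupport fun h => ht (Or.inr h)
    simp [hρ, h1, h2]
  have hρI : ∫ t, ρ t = 0 := by
    rw [hρ, integral_sub (hη.continuous.integrable_of_hasCompactSupport hc)
      ((hη₀.continuous.integrable_of_hasCompactSupport hc₀).const_mul _), integral_const_mul,
      ← hI, ← hJ]
    field_simp
    ring
  have hd : ∀ t, HasDerivAt (fun t => ∫ s in m..t, ρ s) (ρ t) t := fun t =>
    intervalIntegral.integral_hasDerivAt_right (hρs.continuous.intervalIntegrable _ _)
      hρs.continuous.stronglyMeasurable.stronglyMeasurableAtFilter hρs.continuous.continuousAt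
  have hdd : deriv (fun t => ∫ s in m..t, ρ s) = ρ := funext fun t => (hd t).deriv
  have hζ0 : ∀ t, t ∉ Icc m M → ∫ s in m..t, ρ s = 0 := by
    intro t ht
    rw [mem_Icc, not_and_or, not_le, not_le] at ht
    rcases ht with ht | ht
    · apply intervalIntegral.integral_zero_ae
      filter_upwards [(by simp [ae_iff, measure_singleton] : ∀ᵐ x : ℝ, x ≠ m)] with s hsm hst
      rw [uIoc_of_ge ht.le] at hst
      exact hρ0 s fun h => hsm (le_antisymm hst.2 (hmin h))
    · rw [← hρI, intervalIntegral.integral_of_le ((hmin hM).trans ht.le),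
        integral_Icc_eq_integral_Ioc.symm]
      refine setIntegral_eq_integral_of_forall_compl_eq_zero fun s hs => ?_
      exact hρ0 s fun h => hs ⟨hmin h, (hmax h).trans ht.le⟩
  have hsub : tsupport (fun t => ∫ s in m..t, ρ s) ⊆ Icc m M :=
    closure_minimal (fun t ht => by
      by_contra hn
      exact ht (hζ0 t hn)) isClosed_Icc
  have hmain := h _ (contDiff_infty_iff_deriv.mpr ⟨fun t => (hd t).differentiableAt, by
      rw [hdd]; exact hρs⟩) (isCompact_Icc.of_isClosed_subset (isClosed_tsupport _) hsub)
    (hsub.trans (Icc_subset_Ioo (hKs hm).1 (hKs hM).2))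
  rw [hdd, setIntegral_eq_integral_of_forall_compl_eq_zero (fun t ht => by
    rw [hρ0 t fun h => ht (hKs h), zero_smul])] at hmain
  have i1 := integrableOn_smul_test hz hη.continuous hc hs
  have i2 := integrableOn_smul_test hz hη₀.continuous hc₀ hs₀
  have e1 : ∫ t, ρ t • z t = (∫ t, η t • z t) - (J / I) • ∫ t, η₀ t • z t := by
    have i3 : Integrable (fun t => (J / I) • η₀ t • z t) := i2.smul _
    rw [← integral_smul, ← integral_sub i1 i3]
    congr 1
    funext t
    simp only [hρ, sub_smul, mul_smul]
  have e2 : ∫ t, η t • (z t - c) = (∫ t, η t • z t) - J • c := by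
    simp only [smul_sub]
    rw [integral_sub i1 ((hη.continuous.integrable_of_hasCompactSupport hc).smul_const c),
      integral_smul_const]
  rw [e2, hcdef, smul_smul, ← div_eq_mul_inv, ← e1, hmain]

/-- A function with a weak derivative is, up to a constant, a primitive of it. -/
lemma exists_ae_eq_const_add_of_weakDeriv [CompleteSpace E] {f g : ℝ → E} {T : ℝ} (hT : 0 < T)
    (hf : LocallyIntegrableOn f (Ioo 0 T))
    (hg : ∀ b ∈ Ioo 0 T, IntervalIntegrable g volume 0 b)
    (h : ∀ η : ℝ → ℝ, ContDiff ℝ (⊤ : ℕ∞) η → HasCompactSupport η → tsupport η ⊆ Ioo 0 T →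
      ∫ t in Ioo 0 T, deriv η t • f t = -∫ t in Ioo 0 T, η t • g t) :
    ∃ c, ∀ᵐ t, t ∈ Ioo 0 T → f t = c + ∫ s in 0..t, g s := by
  have hP : ∀ b ∈ Ioo 0 T, IsPrimitive (fun t => ∫ s in 0..t, g s) g 0 b := fun b hb =>
    ⟨hb.1.le, hg b hb, fun t _ => by simp⟩
  have hcont : ContinuousOn (fun t => ∫ s in 0..t, g s) (Ioo 0 T) := by
    intro t ht
    have hb : (t + T) / 2 ∈ Ioo 0 T := ⟨by linarith [ht.1, ht.2], by linarith [ht.2]⟩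
    exact ((hP _ hb).continuousOn.continuousAt (Icc_mem_nhds ht.1
      (by linarith [ht.2]))).continuousWithinAt
  have hGloc := hcont.locallyIntegrableOn (μ := volume) measurableSet_Ioo
  obtain ⟨c, hc⟩ := ae_const_of_integral_deriv_smul_eq_zero hT (hf.sub hGloc) (by
    intro η hη hcs hs
    have hd := hη.continuous_deriv (by simp)
    have hds : tsupport (deriv η) ⊆ Ioo 0 T := (tsupport_deriv_subset).trans hs
    simp only [Pi.sub_apply, smul_sub]
    rw [integral_sub (integrableOn_smul_test hf hd hcs.deriv hds).integrableOn
      (integrableOn_smul_test hGloc hd hcs.deriv hds).integrableOn, h η hη hcs hs,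
      integral_deriv_smul_primitive hT hP hη hcs hs, sub_self])
  refine ⟨c, ?_⟩
  filter_upwards [hc] with t ht hm
  rw [← ht hm]
  simp

/-- A continuous function with a weak derivative is a primitive of it. -/
lemma isPrimitive_of_weakDeriv [CompleteSpace E] {f g : ℝ → E} {T : ℝ} (hT : 0 < T)
    (hf : ContinuousOn f (Ico 0 T))
    (hg : ∀ b ∈ Ioo 0 T, IntervalIntegrable g volume 0 b)
    (h : ∀ η : ℝ → ℝ, ContDiff ℝ (⊤ : ℕ∞) η → HasCompactSupport η → tsupport η ⊆ Ioo 0 T →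
      ∫ t in Ioo 0 T, deriv η t • f t = -∫ t in Ioo 0 T, η t • g t) :
    ∀ b ∈ Ioo 0 T, IsPrimitive f g 0 b := by
  obtain ⟨c, hc⟩ := exists_ae_eq_const_add_of_weakDeriv hT
    ((hf.mono Ioo_subset_Ico_self).locallyIntegrableOn measurableSet_Ioo) hg h
  intro b hb
  have hP : IsPrimitive (fun t => ∫ s in 0..t, g s) g 0 b := ⟨hb.1.le, hg b hb, fun t _ => by simp⟩
  have hfb : ContinuousOn f (Icc 0 b) := hf.mono (Icc_subset_Ico_right hb.2)
  have hEq : EqOn f (fun t => c + ∫ s in 0..t, g s) (Icc 0 b) := by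
    apply Measure.eqOn_Icc_of_ae_eq volume hb.1.ne
    · rw [EventuallyEq, ae_restrict_iff' measurableSet_Icc]
      have := ae_Ioo_imp_uIcc hb.1.le (p := fun t => f t = c + ∫ s in 0..t, g s) (by
        filter_upwards [hc] with t ht hm using ht ⟨hm.1, hm.2.trans hb.2⟩)
      rwa [uIcc_of_le hb.1.le] at this
    · exact hfb
    · exact continuousOn_const.add hP.continuousOn
  refine ⟨hb.1.le, hg b hb, fun t ht => ?_⟩
  rw [hEq ht, hEq (left_mem_Icc.mpr hb.1.le)]
  simp

end WeakDerivative

/-! ### Sobolev sums over Fourier coefficients -/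

section Sobolev

lemma weight_nonneg (k : ℕ) (a : (Fin 2 → ℤ) → ℂ) (n : Fin 2 → ℤ) :
    0 ≤ (1 + freqSq n) ^ k * ‖a n‖ ^ 2 := by
  have := freqSq_nonneg n
  positivity

lemma summable_of_sobolevSq_lt_top {k : ℕ} {a : (Fin 2 → ℤ) → ℂ} (h : sobolevSq k a < ∞) :
    Summable fun n => (1 + freqSq n) ^ k * ‖a n‖ ^ 2 := by
  have := ENNReal.summable_toReal h.ne
  simpa only [ENNReal.toReal_ofReal (weight_nonneg k a _)] using this

lemma sobolevSq_eq_ofReal {k : ℕ} {a : (Fin 2 → ℤ) → ℂ}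
    (h : Summable fun n => (1 + freqSq n) ^ k * ‖a n‖ ^ 2) :
    sobolevSq k a = ENNReal.ofReal (∑' n, (1 + freqSq n) ^ k * ‖a n‖ ^ 2) :=
  (ENNReal.ofReal_tsum_of_nonneg (weight_nonneg k a) h).symm

lemma summable_of_tsum_ofReal_le {ι : Type*} {f : ι → ℝ} {K : ℝ} (hf : ∀ i, 0 ≤ f i)
    (h : ∑' i, ENNReal.ofReal (f i) ≤ ENNReal.ofReal K) (hK : 0 ≤ K) :
    Summable f ∧ ∑' i, f i ≤ K := by
  have hs : Summable f := by
    have := ENNReal.summable_toReal (h.trans_lt ENNReal.ofReal_lt_top).ne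
    simpa only [ENNReal.toReal_ofReal (hf _)] using this
  refine ⟨hs, ?_⟩
  rw [← ENNReal.ofReal_tsum_of_nonneg hf hs] at h
  exact (ENNReal.ofReal_le_ofReal_iff hK).mp h

lemma summable_of_tsum_enorm_sq_le {ι : Type*} {f : ι → ℂ} {K : ℝ}
    (h : ∑' i, ‖f i‖ₑ ^ 2 ≤ ENNReal.ofReal K) (hK : 0 ≤ K) :
    Summable (fun i => ‖f i‖ ^ 2) ∧ ∑' i, ‖f i‖ ^ 2 ≤ K := by
  refine summable_of_tsum_ofReal_le (fun i => sq_nonneg _) ?_ hK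
  simpa only [ENNReal.ofReal_pow (norm_nonneg _), ofReal_norm] using h

/-- `f ∈ H²(𝕋²)`, on the Fourier side. -/
def InH2 (a : (Fin 2 → ℤ) → ℂ) : Prop := Summable fun n => (1 + freqSq n) ^ 2 * ‖a n‖ ^ 2

lemma InH2.sub {a b : (Fin 2 → ℤ) → ℂ} (ha : InH2 a) (hb : InH2 b) :
    InH2 (fun n => a n - b n) := by
  refine Summable.of_nonneg_of_le (weight_nonneg 2 fun n => a n - b n) (fun n => ?_)
    ((ha.add hb).mul_left 2)
  have h1 : ‖a n - b n‖ ^ 2 ≤ 2 * (‖a n‖ ^ 2 + ‖b n‖ ^ 2) := by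
    have := norm_sub_le (a n) (b n)
    nlinarith [norm_nonneg (a n - b n), sq_nonneg (‖a n‖ - ‖b n‖)]
  have h2 : 0 ≤ (1 + freqSq n) ^ 2 := sq_nonneg _
  nlinarith [mul_le_mul_of_nonneg_left h1 h2]

lemma InH2.const_mul {a : (Fin 2 → ℤ) → ℂ} (ha : InH2 a) (c : ℂ) : InH2 (fun n => c * a n) := by
  refine (Summable.mul_left (‖c‖ ^ 2) ha).congr fun n => ?_
  rw [norm_mul]; ring

lemma InH2.summable_freqSq_sq {a : (Fin 2 → ℤ) → ℂ} (ha : InH2 a) :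
    Summable fun n => freqSq n ^ 2 * ‖a n‖ ^ 2 := by
  refine Summable.of_nonneg_of_le (fun n => by positivity) (fun n => ?_) ha
  have := freqSq_nonneg n
  gcongr
  linarith

lemma InH2.summable_weight {a : (Fin 2 → ℤ) → ℂ} (ha : InH2 a) :
    Summable fun n => (1 + freqSq n) * ‖a n‖ ^ 2 := by
  refine Summable.of_nonneg_of_le (fun n => by have := freqSq_nonneg n; positivity)
    (fun n => ?_) ha
  have := freqSq_nonneg n
  gcongr
  nlinarith

lemma InH2.summable_freqSq {a : (Fin 2 → ℤ) → ℂ} (ha : InH2 a) :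
    Summable fun n => freqSq n * ‖a n‖ ^ 2 := by
  refine Summable.of_nonneg_of_le (fun n => by have := freqSq_nonneg n; positivity)
    (fun n => ?_) ha.summable_weight
  have := freqSq_nonneg n
  gcongr
  linarith

/-- The pairing of `-Δf` with an `L²` function is absolutely convergent. -/
lemma InH2.summable_pairing {a b : (Fin 2 → ℤ) → ℂ} (ha : InH2 a)
    (hb : Summable fun n => ‖b n‖ ^ 2) : Summable fun n => freqSq n * (‖a n‖ * ‖b n‖) := by
  refine Summable.of_nonneg_of_le (fun n => by have := freqSq_nonneg n; positivity)
    (fun n => ?_) (ha.summable_freqSq_sq.add hb)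
  nlinarith [sq_nonneg (freqSq n * ‖a n‖ - ‖b n‖), sq_nonneg (freqSq n * ‖a n‖), sq_nonneg ‖b n‖]

end Sobolev

/-! ### Fourier multipliers and the operator `(ε + (-Δ)⁻¹)^{1/2}` -/

section EnergyMap

/-- The Hilbert space of Fourier coefficients. -/
abbrev Coeffs : Type := lp (fun _ : Fin 2 → ℤ => ℂ) 2

lemma fc_coeFn_add (f g : L2T) (n : Fin 2 → ℤ) : fc (⇑(f + g)) n = fc f n + fc g n := by
  rw [fc_congr_ae (Lp.coeFn_add f g)]
  exact fc_add (integrable_L2 f) (integrable_L2 g) n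

lemma fc_coeFn_sub (f g : L2T) (n : Fin 2 → ℤ) : fc (⇑(f - g)) n = fc f n - fc g n := by
  rw [fc_congr_ae (Lp.coeFn_sub f g)]
  exact fc_sub (integrable_L2 f) (integrable_L2 g) n

lemma fc_coeFn_smul (c : ℝ) (f : L2T) (n : Fin 2 → ℤ) : fc (⇑(c • f)) n = c * fc f n := by
  rw [fc_congr_ae (Lp.coeFn_smul c f)]
  exact fc_const_mul c f n

/-- A bounded Fourier multiplier, as a map from `L²` to the space of Fourier coefficients. -/
def multiplier (w : (Fin 2 → ℤ) → ℝ) (K : ℝ) (hw : ∀ n, |w n| ≤ K) : L2T →L[ℝ] Coeffs :=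
  have hbound : ∀ f : L2T, ∀ n, ‖(w n : ℂ) * fc f n‖ ^ 2 ≤ K ^ 2 * ‖fc f n‖ ^ 2 := fun f n => by
    rw [norm_mul, mul_pow, Complex.norm_real]
    gcongr
    exact hw n
  have hsum : ∀ f : L2T, Summable fun n => ‖(w n : ℂ) * fc f n‖ ^ 2 := fun f =>
    Summable.of_nonneg_of_le (fun n => sq_nonneg _) (hbound f)
      ((hasSum_norm_fc_L2 f).summable.mul_left _)
  have hmem : ∀ f : L2T, Memℓp (fun n => (w n : ℂ) * fc f n) 2 := fun f => by
    apply memℓp_gen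
    simpa using hsum f
  LinearMap.mkContinuous
    { toFun := fun f => ⟨fun n => (w n : ℂ) * fc f n, hmem f⟩
      map_add' := fun f g => by
        ext n
        change (w n : ℂ) * fc (⇑(f + g)) n = w n * fc f n + w n * fc g n
        rw [fc_coeFn_add, mul_add]
      map_smul' := fun c f => by
        ext n
        simp [fc_coeFn_smul]
        ring }
    (K * √invArea) (fun f => by
      have hK : 0 ≤ K := (abs_nonneg _).trans (hw 0)
      apply le_of_sq_le_sq _ (by positivity)
      have e := lp.norm_rpow_eq_tsum (p := 2) (by norm_num)
        (⟨fun n => (w n : ℂ) * fc f n, hmem f⟩ : Coeffs)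
      simp only [ENNReal.toReal_ofNat, Real.rpow_ofNat] at e
      refine e.le.trans ?_
      refine ((hsum f).tsum_le_tsum (hbound f) ((hasSum_norm_fc_L2 f).summable.mul_left _)).trans ?_
      rw [tsum_mul_left, (hasSum_norm_fc_L2 f).tsum_eq, mul_pow, mul_pow,
        Real.sq_sqrt invArea_pos.le, mul_assoc])

lemma multiplier_apply (w : (Fin 2 → ℤ) → ℝ) (K : ℝ) (hw : ∀ n, |w n| ≤ K) (f : L2T)
    (n : Fin 2 → ℤ) : multiplier w K hw f n = w n * fc f n := rfl

lemma hasSum_inner_multiplier (w : (Fin 2 → ℤ) → ℝ) (K : ℝ) (hw : ∀ n, |w n| ≤ K) (f g : L2T) :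
    HasSum (fun n => w n ^ 2 * (conj (fc f n) * fc g n).re)
      (inner ℝ (multiplier w K hw f) (multiplier w K hw g)) := by
  have h := lp.hasSum_inner (𝕜 := ℝ) (multiplier w K hw f) (multiplier w K hw g)
  refine h.congr_fun fun n => ?_
  rw [multiplier_apply, multiplier_apply, Complex.inner]
  simp
  ring

lemma hasSum_norm_sq_multiplier (w : (Fin 2 → ℤ) → ℝ) (K : ℝ) (hw : ∀ n, |w n| ≤ K) (f : L2T) :
    HasSum (fun n => w n ^ 2 * ‖fc f n‖ ^ 2) (‖multiplier w K hw f‖ ^ 2) := by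
  have h := hasSum_inner_multiplier w K hw f f
  rw [real_inner_self_eq_norm_sq] at h
  refine h.congr_fun fun n => ?_
  rw [Complex.conj_mul', ← Complex.ofReal_pow, Complex.ofReal_re]

/-- The symbol of `ε + (-Δ)⁻¹`. -/
def symb (ε : ℝ) (n : Fin 2 → ℤ) : ℝ := ε + (freqSq n)⁻¹

lemma inv_freqSq_le_one (n : Fin 2 → ℤ) : (freqSq n)⁻¹ ≤ 1 := by
  by_cases hn : n = 0
  · simp [hn]
  · exact inv_le_one_of_one_le₀ (one_le_freqSq hn)

lemma symb_pos {ε : ℝ} (hε : ε ∈ Ioc (0 : ℝ) 1) (n : Fin 2 → ℤ) : 0 < symb ε n :=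
  add_pos_of_pos_of_nonneg hε.1 (inv_nonneg.mpr (freqSq_nonneg n))

lemma symb_le_two {ε : ℝ} (hε : ε ∈ Ioc (0 : ℝ) 1) (n : Fin 2 → ℤ) : symb ε n ≤ 2 := by
  have := inv_freqSq_le_one n
  unfold symb
  linarith [hε.2]

/-- The operator `(ε + (-Δ)⁻¹)^{1/2}`. -/
def energyMap {ε : ℝ} (hε : ε ∈ Ioc (0 : ℝ) 1) : L2T →L[ℝ] Coeffs :=
  multiplier (fun n => √(symb ε n)) 2 (fun n => by
    rw [abs_of_nonneg (Real.sqrt_nonneg _)]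
    refine (Real.sqrt_le_sqrt (symb_le_two hε n)).trans ?_
    rw [Real.sqrt_le_left (by norm_num)]
    norm_num)

lemma hasSum_inner_energyMap {ε : ℝ} (hε : ε ∈ Ioc (0 : ℝ) 1) (f g : L2T) :
    HasSum (fun n => symb ε n * (conj (fc f n) * fc g n).re)
      (inner ℝ (energyMap hε f) (energyMap hε g)) := by
  refine (hasSum_inner_multiplier _ _ _ f g).congr_fun fun n => ?_
  rw [Real.sq_sqrt (symb_pos hε n).le]

lemma hasSum_norm_sq_energyMap {ε : ℝ} (hε : ε ∈ Ioc (0 : ℝ) 1) (f : L2T) :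
    HasSum (fun n => symb ε n * ‖fc f n‖ ^ 2) (‖energyMap hε f‖ ^ 2) := by
  refine (hasSum_norm_sq_multiplier _ _ _ f).congr_fun fun n => ?_
  rw [Real.sq_sqrt (symb_pos hε n).le]

end EnergyMap

/-! ### Monotone functions and the Laplacian -/

section Monotone

lemma mode_single (n : Fin 2 → ℤ) (j : Fin 2) (s : ℝ) :
    mode n (Pi.single j (s : AddCircle (2 * Real.pi))) = Complex.exp (Complex.I * (n j * s : ℝ)) := by
  unfold mode
  rw [Finset.prod_eq_single j]
  · rw [Pi.single_eq_same, fourier_coe_apply]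
    congr 1
    have : (Real.pi : ℂ) ≠ 0 := by exact_mod_cast Real.pi_ne_zero
    push_cast
    field_simp
  · intro i _ hi
    simp [Pi.single_eq_of_ne hi]
  · simp

lemma norm_exp_sub_one_sq (x : ℝ) : ‖Complex.exp (Complex.I * x) - 1‖ ^ 2 = 4 * Real.sin (x / 2) ^ 2 := by
  rw [mul_comm, Complex.exp_mul_I, ← Complex.ofReal_cos, ← Complex.ofReal_sin]
  rw [← Complex.normSq_eq_norm_sq, Complex.normSq_apply]
  simp only [Complex.sub_re, Complex.add_re, Complex.ofReal_re, Complex.mul_re, Complex.I_re,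
    Complex.ofReal_im, Complex.I_im, Complex.one_re, Complex.sub_im, Complex.add_im,
    Complex.mul_im, Complex.one_im]
  have h1 := Real.cos_sq_add_sin_sq x
  have h2 := Real.cos_two_mul (x / 2)
  have h3 := Real.cos_sq_add_sin_sq (x / 2)
  rw [mul_div_cancel₀ _ (two_ne_zero)] at h2
  nlinarith

lemma tendsto_sin_div_sq (c : ℝ) :
    Tendsto (fun s : ℝ => 4 * Real.sin (c * s / 2) ^ 2 / s ^ 2) (𝓝[≠] 0) (𝓝 (c ^ 2)) := by
  have h : HasDerivAt (fun s : ℝ => 2 * Real.sin (c * s / 2)) (2 * (Real.cos (c * 0 / 2) * (c / 2))) 0 := by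
    have h1 : HasDerivAt (fun s : ℝ => c * s / 2) (c / 2) 0 := by
      simpa using ((hasDerivAt_id (0 : ℝ)).const_mul c).div_const 2
    exact (h1.sin).const_mul 2
  have h2 := (hasDerivAt_iff_tendsto_slope.mp h).pow 2
  simp only [mul_zero, zero_div, Real.cos_zero, one_mul] at h2
  rw [mul_div_cancel₀ _ (two_ne_zero)] at h2
  refine h2.congr fun s => ?_
  rw [slope_def_field]
  simp
  rw [div_pow]
  ring

/-- Monotone functions have nonnegative Dirichlet pairing. -/
lemma tsum_freqSq_pairing_nonneg {f : L2T} (hf : InH2 (fc f)) {ψ : ℝ → ℝ} (hψ : Monotone ψ)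
    (hψf : MemLp (fun x => ψ (f x)) 2 volume) :
    0 ≤ ∑' n, freqSq n * (conj (fc f n) * fc (fun x => ψ (f x)) n).re := by
  set b := fc (fun x => ψ (f x)) with hb
  have hbs : Summable fun n => ‖b n‖ ^ 2 := (hasSum_norm_fc_sq hψf).summable
  have hle : ∀ n, |(conj (fc f n) * b n).re| ≤ ‖fc f n‖ * ‖b n‖ := fun n => by
    refine (Complex.abs_re_le_norm _).trans ?_
    rw [norm_mul, RCLike.norm_conj]
  have hj : ∀ j, ∀ n : Fin 2 → ℤ, (n j : ℝ) ^ 2 ≤ freqSq n := fun j n =>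
    Finset.single_le_sum (f := fun j => (n j : ℝ) ^ 2) (fun _ _ => sq_nonneg _) (Finset.mem_univ j)
  have hsum : ∀ j, Summable fun n : Fin 2 → ℤ => (n j : ℝ) ^ 2 * (conj (fc f n) * b n).re := fun j => by
    refine Summable.of_norm_bounded (hf.summable_pairing hbs) fun n => ?_
    rw [Real.norm_eq_abs, abs_mul, abs_of_nonneg (sq_nonneg _)]
    exact mul_le_mul (hj j n) (hle n) (abs_nonneg _) (freqSq_nonneg n)
  -- No chain rule for `ψ(f)` is needed. The increments of `f` and `ψ(f)` under a translation by `s`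
  -- in direction `j` have the same sign; by Parseval their pairing carries the multiplier `4
  -- sin²(nⱼ s / 2)`, which after division by `s²` tends to `nⱼ²`. The multiplier is dominated by
  -- `nⱼ²`.
  have key : ∀ j, 0 ≤ ∑' n : Fin 2 → ℤ, (n j : ℝ) ^ 2 * (conj (fc f n) * b n).re := by
    intro j
    have hlim : Tendsto (fun s : ℝ => ∑' n : Fin 2 → ℤ,
        (4 * Real.sin (n j * s / 2) ^ 2 / s ^ 2) * (conj (fc f n) * b n).re) (𝓝[≠] 0)
        (𝓝 (∑' n : Fin 2 → ℤ, (n j : ℝ) ^ 2 * (conj (fc f n) * b n).re)) := by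
      refine tendsto_tsum_of_dominated_convergence (hf.summable_pairing hbs)
        (fun n => (tendsto_sin_div_sq _).mul_const _) ?_
      filter_upwards [self_mem_nhdsWithin] with s hs n
      have hs' : s ≠ 0 := hs
      rw [Real.norm_eq_abs, abs_mul, abs_of_nonneg (by positivity)]
      refine mul_le_mul ?_ (hle n) (abs_nonneg _) (freqSq_nonneg n)
      refine le_trans ?_ (hj j n)
      rw [div_le_iff₀ (by positivity)]
      have h1 := Real.abs_sin_le_abs (x := n j * s / 2)
      have h2 := pow_le_pow_left₀ (abs_nonneg _) h1 2
      rw [sq_abs, sq_abs] at h2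
      nlinarith
    refine ge_of_tendsto hlim ?_
    filter_upwards [self_mem_nhdsWithin] with s hs
    have hs' : s ≠ 0 := hs
    set y : T2 := Pi.single j (s : AddCircle (2 * Real.pi)) with hy
    have hmp : MeasurePreserving (fun x : T2 => x + y) volume volume :=
      measurePreserving_add_right volume y
    have hf2 := Lp.memLp f
    have hfy : MemLp (fun x => f (x + y)) 2 volume := hf2.comp_measurePreserving hmp
    have hψy : MemLp (fun x => ψ (f (x + y))) 2 volume := hψf.comp_measurePreserving hmp
    have h := hasSum_re_conj_fc_mul_fc (hfy.sub hf2) (hψy.sub hψf)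
    have hpos : 0 ≤ invArea * ∫ x, ((fun x => f (x + y)) - ⇑f) x *
        ((fun x => ψ (f (x + y))) - fun x => ψ (f x)) x := by
      refine mul_nonneg invArea_pos.le (integral_nonneg fun x => ?_)
      simp only [Pi.sub_apply, Pi.zero_apply]
      rcases le_total (f (x + y)) (f x) with h | h
      · exact mul_nonneg_of_nonpos_of_nonpos (sub_nonpos.mpr h) (sub_nonpos.mpr (hψ h))
      · exact mul_nonneg (sub_nonneg.mpr h) (sub_nonneg.mpr (hψ h))
    rw [← h.tsum_eq] at hpos
    have hi1 : Integrable f := integrable_L2 f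
    have e : ∀ n : Fin 2 → ℤ, (conj (fc ((fun x => f (x + y)) - ⇑f) n) *
        fc ((fun x => ψ (f (x + y))) - fun x => ψ (f x)) n).re
        = s ^ 2 * ((4 * Real.sin (n j * s / 2) ^ 2 / s ^ 2) * (conj (fc f n) * b n).re) := by
      intro n
      have e1 : fc ((fun x => f (x + y)) - ⇑f) n = (mode n y - 1) * fc f n := by
        rw [sub_mul, one_mul, ← fc_translate]
        exact fc_sub (hfy.integrable (by norm_num)) hi1 n
      have e2 : fc ((fun x => ψ (f (x + y))) - fun x => ψ (f x)) n = (mode n y - 1) * b n := by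
        rw [sub_mul, one_mul, hb, ← fc_translate]
        exact fc_sub (hψy.integrable (by norm_num)) (hψf.integrable (by norm_num)) n
      have e3 : conj ((mode n y - 1) * fc f n) * ((mode n y - 1) * b n)
          = ((‖mode n y - 1‖ ^ 2 : ℝ) : ℂ) * (conj (fc f n) * b n) := by
        rw [map_mul, Complex.ofReal_pow, ← Complex.conj_mul']
        ring
      rw [e1, e2, e3, Complex.re_ofReal_mul, hy, mode_single, norm_exp_sub_one_sq]
      field_simp
    simp only [e] at hpos
    rw [tsum_mul_left] at hpos
    exact nonneg_of_mul_nonneg_right hpos (by positivity)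
  have e : ∀ n : Fin 2 → ℤ, freqSq n * (conj (fc f n) * b n).re
      = ∑ j, (n j : ℝ) ^ 2 * (conj (fc f n) * b n).re := fun n => by
    rw [freqSq, Finset.sum_mul]
  simp only [e]
  rw [Summable.tsum_finsetSum fun j _ => hsum j]
  exact Finset.sum_nonneg fun j _ => key j

end Monotone

/-- The equation at one instant of time: `f`, `g` and `u` are the values of the solution, of its
time derivative and of the velocity. -/
structure Slice (ε R : ℝ) (φ : ℝ → ℝ) (u : Fin 2 → L2T) (f g : L2T) : Prop where
  mem : InPhaseSpace ε φ f
  vel : ∑ j, sobolevSq 1 (fc (u j)) ≤ ENNReal.ofReal (R ^ 2)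
  eq : ∀ n, (ε : ℂ) * fc g n + ((freqSq n)⁻¹ : ℝ) * (advCoef u f n + fc g n) = rhsCoef φ f n

/-! ### Consequences of `|θ| ≤ 1` -/

section Bounded

variable {ε : ℝ} {φ : ℝ → ℝ} {f : L2T}

lemma InPhaseSpace.inH2 (h : InPhaseSpace ε φ f) : InH2 (fc f) := summable_of_sobolevSq_lt_top h.h2

lemma InPhaseSpace.abs_le_one (h : InPhaseSpace ε φ f) : ∀ᵐ x, |f x| ≤ 1 := by
  filter_upwards [h.interior] with x hx
  exact abs_le.mpr ⟨hx.1.le, hx.2.le⟩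

lemma InPhaseSpace.fc_zero (h : InPhaseSpace ε φ f) : fc f 0 = 0 := by
  rw [CahnHilliard.fc_zero, h.mean_zero, Complex.ofReal_zero]

lemma memLp_mul_of_abs_le_one {v : L2T} (hf : ∀ᵐ x, |f x| ≤ 1) :
    MemLp (fun x => v x * f x) 2 volume := by
  refine (Lp.memLp v).of_le ((Lp.aestronglyMeasurable v).mul (Lp.aestronglyMeasurable f)) ?_
  filter_upwards [hf] with x hx
  rw [norm_mul]
  exact mul_le_of_le_one_right (norm_nonneg _) hx

lemma tsum_norm_fc_mul_sq_le {v : L2T} (hf : ∀ᵐ x, |f x| ≤ 1) :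
    Summable (fun n => ‖fc (fun x => v x * f x) n‖ ^ 2) ∧
      ∑' n, ‖fc (fun x => v x * f x) n‖ ^ 2 ≤ invArea * ‖v‖ ^ 2 := by
  have h := hasSum_norm_fc_sq (memLp_mul_of_abs_le_one (v := v) hf)
  refine ⟨h.summable, ?_⟩
  rw [h.tsum_eq, norm_L2_sq]
  have := invArea_pos
  refine mul_le_mul_of_nonneg_left (integral_mono_ae
    (memLp_mul_of_abs_le_one hf).integrable_sq (Lp.memLp v).integrable_sq ?_) this.le
  filter_upwards [hf] with x hx
  rw [mul_pow]
  refine mul_le_of_le_one_right (sq_nonneg _) ?_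
  rw [← sq_abs]
  exact pow_le_one₀ (abs_nonneg _) hx

lemma norm_sq_le_of_abs_le_one (hf : ∀ᵐ x, |f x| ≤ 1) : invArea * ‖f‖ ^ 2 ≤ 1 := by
  have h1 : ‖f‖ ^ 2 ≤ (2 * Real.pi) ^ 2 := by
    rw [norm_L2_sq]
    have : ∫ x : T2, (1 : ℝ) = (2 * Real.pi) ^ 2 := by
      have h0 := integral_mode 0
      simp only [mode_zero] at h0
      rw [if_true] at h0
      have h2 : ∫ x : T2, ((1 : ℝ) : ℂ) = (2 * Real.pi) ^ 2 := by simpa using h0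
      rw [integral_complex_ofReal] at h2
      exact_mod_cast h2
    rw [← this]
    refine integral_mono_ae (Lp.memLp f).integrable_sq (integrable_const _) ?_
    filter_upwards [hf] with x hx
    rw [← sq_abs]
    exact pow_le_one₀ (abs_nonneg _) hx
  calc invArea * ‖f‖ ^ 2 ≤ invArea * (2 * Real.pi) ^ 2 := by gcongr; exact invArea_pos.le
    _ = 1 := by unfold invArea; rw [inv_mul_cancel₀]; positivity

end Bounded

/-! ### The advection term at the Fourier level -/

section Advection

/-- `|n|⁻¹`, vanishing at `0`. -/
def invFreq (n : Fin 2 → ℤ) : ℝ := √(freqSq n)⁻¹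

lemma invFreq_nonneg (n : Fin 2 → ℤ) : 0 ≤ invFreq n := Real.sqrt_nonneg _

lemma invFreq_sq (n : Fin 2 → ℤ) : invFreq n ^ 2 = (freqSq n)⁻¹ :=
  Real.sq_sqrt (inv_nonneg.mpr (freqSq_nonneg n))

lemma invFreq_le_one (n : Fin 2 → ℤ) : invFreq n ≤ 1 := by
  unfold invFreq
  rw [Real.sqrt_le_one]
  exact inv_freqSq_le_one n

lemma invFreq_le_two_bessel (n : Fin 2 → ℤ) : invFreq n ≤ 2 * bessel n := by
  by_cases hn : n = 0
  · subst hn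
    have := bessel_pos 0
    simp only [invFreq, freqSq_zero, inv_zero, Real.sqrt_zero]
    linarith
  · have h1 := one_le_freqSq hn
    have h2 : invFreq n ^ 2 ≤ (2 * bessel n) ^ 2 := by
      rw [invFreq_sq, mul_pow, bessel_sq]
      have : (freqSq n)⁻¹ = (2 ^ 2 : ℝ) * (4 * freqSq n)⁻¹ := by field_simp; norm_num
      rw [this]
      gcongr
      linarith
    exact le_of_sq_le_sq h2 (by have := bessel_pos n; positivity)

/-- The operator `(-Δ)⁻¹ div` has order `-1`: one factor `|n|⁻¹` compensates the `nⱼ` of the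
divergence and one is left over. -/
lemma norm_inv_freqSq_mul_div_le (P : Fin 2 → ℂ) (n : Fin 2 → ℤ) :
    ‖(((freqSq n)⁻¹ : ℝ) : ℂ) * ∑ j, Complex.I * (n j : ℂ) * P j‖ ≤ invFreq n * ∑ j, ‖P j‖ := by
  rw [norm_mul, Complex.norm_real, Real.norm_of_nonneg (inv_nonneg.mpr (freqSq_nonneg n)),
    ← invFreq_sq, pow_two, mul_assoc]
  refine mul_le_mul_of_nonneg_left ?_ (invFreq_nonneg n)
  have h1 : ∀ j, invFreq n * |(n j : ℝ)| ≤ 1 := fun j => by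
    have : |(n j : ℝ)| ≤ √(freqSq n) := by
      apply Real.abs_le_sqrt
      exact Finset.single_le_sum (f := fun j => (n j : ℝ) ^ 2) (fun _ _ => sq_nonneg _)
        (Finset.mem_univ j)
    refine (mul_le_mul_of_nonneg_left this (invFreq_nonneg n)).trans ?_
    rw [invFreq, Real.sqrt_inv]
    exact inv_mul_le_one
  calc invFreq n * ‖∑ j, Complex.I * (n j : ℂ) * P j‖
      ≤ invFreq n * ∑ j, ‖Complex.I * (n j : ℂ) * P j‖ := by
        gcongr
        · exact invFreq_nonneg n
        · exact norm_sum_le _ _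
    _ = ∑ j, (invFreq n * |(n j : ℝ)|) * ‖P j‖ := by
        rw [Finset.mul_sum]
        refine Finset.sum_congr rfl fun j _ => ?_
        simp
        ring
    _ ≤ ∑ j, 1 * ‖P j‖ := by gcongr with j _; exact h1 j
    _ = _ := by simp

lemma abs_re_conj_mul_le (a b : ℂ) : |(conj a * b).re| ≤ ‖a‖ * ‖b‖ := by
  refine (Complex.abs_re_le_norm _).trans ?_
  rw [norm_mul, RCLike.norm_conj]

/-- The pairing of `(-Δ)⁻¹ div P` with `d`, bounded mode by mode. -/
lemma abs_advection_term_le (P : Fin 2 → ℂ) (d : ℂ) (n : Fin 2 → ℤ) :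
    |(freqSq n)⁻¹ * (conj d * ∑ j, Complex.I * (n j : ℂ) * P j).re| ≤
      ∑ j, invFreq n * ‖d‖ * ‖P j‖ := by
  have e : (freqSq n)⁻¹ * (conj d * ∑ j, Complex.I * (n j : ℂ) * P j).re
      = (conj d * ((((freqSq n)⁻¹ : ℝ) : ℂ) * ∑ j, Complex.I * (n j : ℂ) * P j)).re := by
    rw [mul_left_comm, Complex.re_ofReal_mul]
  rw [e]
  refine (abs_re_conj_mul_le _ _).trans ((mul_le_mul_of_nonneg_left
    (norm_inv_freqSq_mul_div_le P n) (norm_nonneg _)).trans (le_of_eq ?_))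
  rw [Finset.mul_sum, Finset.mul_sum]
  exact Finset.sum_congr rfl fun j _ => by ring

lemma summable_invFreq_mul {a b : (Fin 2 → ℤ) → ℂ} (ha : Summable fun n => ‖a n‖ ^ 2)
    (hb : Summable fun n => ‖b n‖ ^ 2) : Summable fun n => invFreq n * ‖a n‖ * ‖b n‖ := by
  refine Summable.of_nonneg_of_le (fun n => mul_nonneg (mul_nonneg (invFreq_nonneg n)
    (norm_nonneg _)) (norm_nonneg _)) (fun n => ?_) (ha.add hb)
  have h1 : invFreq n * ‖a n‖ ≤ ‖a n‖ := mul_le_of_le_one_left (norm_nonneg _) (invFreq_le_one n)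
  have h2 := mul_le_mul_of_nonneg_right h1 (norm_nonneg (b n))
  nlinarith [sq_nonneg (‖a n‖ - ‖b n‖), sq_nonneg (‖a n‖), sq_nonneg (‖b n‖)]

end Advection

/-! ### The equation tested with an `L²` function -/

namespace Slice

variable {ε R : ℝ} {φ : ℝ → ℝ} {u : Fin 2 → L2T} {f g : L2T}

lemma sobolevSq_le (h : Slice ε R φ u f g) (j : Fin 2) :
    sobolevSq 1 (fc (u j)) ≤ ENNReal.ofReal (R ^ 2) :=
  (Finset.single_le_sum (f := fun j => sobolevSq 1 (fc (u j))) (fun _ _ => zero_le)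
    (Finset.mem_univ j)).trans h.vel

lemma invArea_norm_vel_le (h : Slice ε R φ u f g) (j : Fin 2) : invArea * ‖u j‖ ^ 2 ≤ R ^ 2 := by
  rw [← (hasSum_norm_fc_L2 (u j)).tsum_eq]
  refine (summable_of_tsum_enorm_sq_le ?_ (sq_nonneg R)).2
  refine le_trans ?_ (h.sobolevSq_le j)
  rw [sobolevSq_one]
  refine ENNReal.tsum_le_tsum fun n => ?_
  refine le_mul_of_one_le_left (zero_le) ?_
  rw [← ENNReal.ofReal_one]
  exact ENNReal.ofReal_le_ofReal (by linarith [freqSq_nonneg n])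

/-- The Fourier coefficients of the flux `u f`. -/
def flux (u : Fin 2 → L2T) (f : L2T) (j : Fin 2) (n : Fin 2 → ℤ) : ℂ := fc (fun x => u j x * f x) n

lemma advCoef_eq (u : Fin 2 → L2T) (f : L2T) (n : Fin 2 → ℤ) :
    advCoef u f n = ∑ j, Complex.I * (n j : ℂ) * flux u f j n := rfl

lemma summable_flux (h : Slice ε R φ u f g) (j : Fin 2) :
    Summable fun n => ‖flux u f j n‖ ^ 2 := (tsum_norm_fc_mul_sq_le h.mem.abs_le_one).1

lemma tsum_flux_le (h : Slice ε R φ u f g) (j : Fin 2) :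
    ∑' n, ‖flux u f j n‖ ^ 2 ≤ R ^ 2 :=
  (tsum_norm_fc_mul_sq_le h.mem.abs_le_one).2.trans (h.invArea_norm_vel_le j)

/-- The advection term of the equation, paired with `ψ`. -/
def advTerm (u : Fin 2 → L2T) (f ψ : L2T) (n : Fin 2 → ℤ) : ℝ :=
  (freqSq n)⁻¹ * (conj (fc ψ n) * advCoef u f n).re

lemma abs_advTerm_le (u : Fin 2 → L2T) (f ψ : L2T) (n : Fin 2 → ℤ) :
    |advTerm u f ψ n| ≤ ∑ j, invFreq n * ‖fc ψ n‖ * ‖flux u f j n‖ :=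
  abs_advection_term_le _ _ n

lemma summable_advTerm (h : Slice ε R φ u f g) (ψ : L2T) : Summable (advTerm u f ψ) := by
  refine Summable.of_norm_bounded (summable_sum fun j _ =>
    summable_invFreq_mul (hasSum_norm_fc_L2 ψ).summable (h.summable_flux j)) fun n =>
    abs_advTerm_le u f ψ n

lemma summable_laplace (h : InPhaseSpace ε φ f) {b : (Fin 2 → ℤ) → ℂ}
    (hb : Summable fun n => ‖b n‖ ^ 2) : Summable fun n => freqSq n * (conj (fc f n) * b n).re := by
  refine Summable.of_norm_bounded (h.inH2.summable_pairing hb) fun n => ?_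
  rw [Real.norm_eq_abs, abs_mul, abs_of_nonneg (freqSq_nonneg n)]
  exact mul_le_mul_of_nonneg_left (abs_re_conj_mul_le _ _) (freqSq_nonneg n)

/-- The equation tested with an `L²` function. -/
lemma tested (hε : ε ∈ Ioc (0 : ℝ) 1) (h : Slice ε R φ u f g) (ψ : L2T) :
    inner ℝ (energyMap hε ψ) (energyMap hε g) + ∑' n, freqSq n * (conj (fc f n) * fc ψ n).re
      + invArea * ∫ x, φ (f x) * ψ x = mean (fun x => φ (f x)) * mean ψ - ∑' n, advTerm u f ψ n := by
  have h1 := hasSum_inner_energyMap hε ψ g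
  have h2 := (summable_laplace h.mem (hasSum_norm_fc_L2 ψ).summable).hasSum
  have h3 := hasSum_re_conj_fc_mul_fc h.mem.phi_l2 (Lp.memLp ψ)
  have h4 := (h.summable_advTerm ψ).hasSum
  have h5 := hasSum_ite_eq (0 : Fin 2 → ℤ) (mean (fun x => φ (f x)) * mean ψ)
  -- Both sides are sums of one series, whose terms are the equation multiplied by `conj (fc ψ n)`.
  -- The single term supplied by `h5` accounts for `m(φ(f))`, which lives on the zero mode.
  refine ((h1.add h2).add h3).unique ((h5.sub h4).congr_fun fun n => ?_)
  have e := h.eq n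
  have e' : ((symb ε n : ℝ) : ℂ) * fc g n = rhsCoef φ f n - ((freqSq n)⁻¹ : ℝ) * advCoef u f n := by
    rw [← e, symb]; push_cast; ring
  have e1 : symb ε n * (conj (fc ψ n) * fc g n).re
      = (conj (fc ψ n) * (((symb ε n : ℝ) : ℂ) * fc g n)).re := by
    rw [mul_left_comm, Complex.re_ofReal_mul]
  rw [e1, e', advTerm]
  have e2 : (conj (fc ψ n) * (rhsCoef φ f n - ((freqSq n)⁻¹ : ℝ) * advCoef u f n)).re
      = (conj (fc ψ n) * rhsCoef φ f n).re
        - (freqSq n)⁻¹ * (conj (fc ψ n) * advCoef u f n).re := by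
    rw [mul_sub, Complex.sub_re, mul_left_comm, Complex.re_ofReal_mul]
  have e3 : (conj (fc ψ n) * rhsCoef φ f n).re
      = -(freqSq n * (conj (fc f n) * fc ψ n).re)
        - (conj (fc (fun x => φ (f x)) n) * fc ψ n).re
        + if n = 0 then mean (fun x => φ (f x)) * mean ψ else 0 := by
    unfold rhsCoef
    by_cases hn : n = 0
    · subst hn
      rw [if_pos rfl, if_pos rfl, CahnHilliard.fc_zero, CahnHilliard.fc_zero, CahnHilliard.fc_zero]
      simp
    · rw [if_neg hn, if_neg hn]
      simp
      ring
  rw [e2, e3]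
  ring

end Slice

/-! ### The Dirichlet integral and products of `H¹` functions -/

section Products

lemma integrable_mul_L2 (v w : L2T) : Integrable (fun x => v x * w x) :=
  (Lp.memLp v).integrable_mul (Lp.memLp w)

/-- The `H¹ · H¹ ⊂ L²` estimate in terms of real sums. -/
lemma tsum_norm_fc_mul_sq_le_sobolev {v w : L2T} {A B : ℝ} (hA : 0 ≤ A) (hB : 0 ≤ B)
    (hv : sobolevSq 1 (fc v) ≤ ENNReal.ofReal A) (hw : sobolevSq 1 (fc w) ≤ ENNReal.ofReal B) :
    Summable (fun n => ‖fc (fun x => v x * w x) n‖ ^ 2) ∧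
      ∑' n, ‖fc (fun x => v x * w x) n‖ ^ 2 ≤ 2 * besselSum * (A * B) := by
  have hb := besselSum_nonneg
  refine summable_of_tsum_enorm_sq_le ?_ (by positivity)
  calc ∑' n, ‖fc (fun x => v x * w x) n‖ₑ ^ 2
      ≤ ∑' n, (∑' m, ‖fc v m‖ₑ * ‖fc w (n - m)‖ₑ) ^ 2 := ENNReal.tsum_le_tsum fun n =>
        pow_le_pow_left' (enorm_fc_mul_le (Lp.memLp v) (Lp.memLp w) n) 2
    _ ≤ _ := tsum_conv_sq_le _ _
    _ ≤ 2 * ENNReal.ofReal besselSum * (ENNReal.ofReal A * ENNReal.ofReal B) := by gcongr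
    _ = _ := by
      rw [ENNReal.ofReal_mul (by positivity), ENNReal.ofReal_mul (by positivity),
        ENNReal.ofReal_mul hA, ENNReal.ofReal_ofNat]

/-- The Dirichlet integral, on the Fourier side. -/
def dirichlet (f : L2T) : ℝ := ∑' n, freqSq n * ‖fc f n‖ ^ 2

lemma dirichlet_nonneg (f : L2T) : 0 ≤ dirichlet f :=
  tsum_nonneg fun n => mul_nonneg (freqSq_nonneg n) (sq_nonneg _)

lemma norm_fc_sq_le_freqSq_mul {f : L2T} (h0 : fc f 0 = 0) (n : Fin 2 → ℤ) :
    ‖fc f n‖ ^ 2 ≤ freqSq n * ‖fc f n‖ ^ 2 := by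
  by_cases hn : n = 0
  · simp [hn, h0]
  · exact le_mul_of_one_le_left (sq_nonneg _) (one_le_freqSq hn)

/-- Poincaré's inequality: without zero mode, `1 ≤ |n|²` on all frequencies that contribute. -/
lemma sobolevSq_one_le_dirichlet {f : L2T} (h : InH2 (fc f)) (h0 : fc f 0 = 0) :
    sobolevSq 1 (fc f) ≤ ENNReal.ofReal (2 * dirichlet f) := by
  have hs : Summable fun n => (1 + freqSq n) ^ 1 * ‖fc f n‖ ^ 2 := by
    simpa only [pow_one] using h.summable_weight
  rw [sobolevSq_eq_ofReal hs]
  apply ENNReal.ofReal_le_ofReal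
  rw [dirichlet, ← tsum_mul_left]
  refine hs.tsum_le_tsum (fun n => ?_) (h.summable_freqSq.mul_left 2)
  have := norm_fc_sq_le_freqSq_mul h0 n
  rw [pow_one]
  linarith

lemma invArea_norm_sq_le_dirichlet {f : L2T} (h : InH2 (fc f)) (h0 : fc f 0 = 0) :
    invArea * ‖f‖ ^ 2 ≤ dirichlet f := by
  rw [← (hasSum_norm_fc_L2 f).tsum_eq]
  exact (hasSum_norm_fc_L2 f).summable.tsum_le_tsum (norm_fc_sq_le_freqSq_mul h0) h.summable_freqSq

end Products

/-- One-sided Lipschitz bound from below. -/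
def OneSided (α : ℝ) (φ : ℝ → ℝ) : Prop :=
  ∀ s ∈ Ioo (-1 : ℝ) 1, ∀ r ∈ Ioo (-1 : ℝ) 1, -α * (s - r) ^ 2 ≤ (φ s - φ r) * (s - r)

/-! ### The energy inequality for difference quotients -/

namespace Slice

variable {ε R α : ℝ} {φ : ℝ → ℝ} {u u' : Fin 2 → L2T} {f g f' g' : L2T}

/-- The constant in the energy inequality. -/
def energyConst (α R : ℝ) : ℝ := α ^ 2 + 2 * (1 + 8 * besselSum * R ^ 2)

/-- The pairing of `(-Δ)⁻¹ div` of the difference quotient of the flux with `d`. -/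
def diffAdvTerm (ud u : Fin 2 → L2T) (f' d : L2T) (n : Fin 2 → ℤ) : ℝ :=
  (freqSq n)⁻¹ * (conj (fc d n) * ∑ j, Complex.I * (n j : ℂ) *
    (fc (fun x => ud j x * f' x) n + fc (fun x => u j x * d x) n)).re

/-- Young's inequality, mode by mode. The destabilising `α |d|²` is interpolated between `|n|² |d|²`
and `|n|⁻² |d|²`, since `(|n|²/2 - α)² ≥ 0`; the flux is paired with `|n|⁻¹ d` with a free parameter
`δ`. -/
lemma diffAdvTerm_le {ud u : Fin 2 → L2T} {f' d : L2T} {δ : ℝ} (hδ : 0 < δ) (hd : fc d 0 = 0)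
    (n : Fin 2 → ℤ) :
    α * ‖fc d n‖ ^ 2 - diffAdvTerm ud u f' d n ≤
      1 / 4 * (freqSq n * ‖fc d n‖ ^ 2) + (α ^ 2 + 1 / (2 * δ)) * ((freqSq n)⁻¹ * ‖fc d n‖ ^ 2)
      + 2 * δ * ∑ j, (‖fc (fun x => ud j x * f' x) n‖ ^ 2 + ‖fc (fun x => u j x * d x) n‖ ^ 2) := by
  have h1 := abs_advection_term_le
    (fun j => fc (fun x => ud j x * f' x) n + fc (fun x => u j x * d x) n) (fc d n) n
  have h2 : -diffAdvTerm ud u f' d n ≤ ∑ j, invFreq n * ‖fc d n‖ *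
      ‖fc (fun x => ud j x * f' x) n + fc (fun x => u j x * d x) n‖ := (neg_le_abs _).trans h1
  have h3 : ∀ j, invFreq n * ‖fc d n‖ *
      ‖fc (fun x => ud j x * f' x) n + fc (fun x => u j x * d x) n‖
      ≤ 1 / (4 * δ) * ((freqSq n)⁻¹ * ‖fc d n‖ ^ 2) + 2 * δ *
        (‖fc (fun x => ud j x * f' x) n‖ ^ 2 + ‖fc (fun x => u j x * d x) n‖ ^ 2) := by
    intro j
    set X := fc (fun x => ud j x * f' x) n
    set Y := fc (fun x => u j x * d x) n
    have hXY : ‖X + Y‖ ^ 2 ≤ 2 * (‖X‖ ^ 2 + ‖Y‖ ^ 2) := by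
      have := norm_add_le X Y
      nlinarith [norm_nonneg (X + Y), sq_nonneg (‖X‖ - ‖Y‖)]
    have hy : invFreq n * ‖fc d n‖ * ‖X + Y‖ ≤
        1 / (4 * δ) * (invFreq n * ‖fc d n‖) ^ 2 + δ * ‖X + Y‖ ^ 2 := by
      have h := mul_nonneg (by positivity : 0 ≤ 1 / (4 * δ))
        (sq_nonneg (invFreq n * ‖fc d n‖ - 2 * δ * ‖X + Y‖))
      have e : 1 / (4 * δ) * (invFreq n * ‖fc d n‖ - 2 * δ * ‖X + Y‖) ^ 2
          = 1 / (4 * δ) * (invFreq n * ‖fc d n‖) ^ 2 + δ * ‖X + Y‖ ^ 2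
            - invFreq n * ‖fc d n‖ * ‖X + Y‖ := by
        field_simp; ring
      linarith
    rw [mul_pow, invFreq_sq] at hy
    nlinarith
  have h4 : α * ‖fc d n‖ ^ 2 ≤ 1 / 4 * (freqSq n * ‖fc d n‖ ^ 2)
      + α ^ 2 * ((freqSq n)⁻¹ * ‖fc d n‖ ^ 2) := by
    by_cases hn : n = 0
    · simp [hn, hd]
    · have hf : 0 < freqSq n := lt_of_lt_of_le one_pos (one_le_freqSq hn)
      have : α ≤ 1 / 4 * freqSq n + α ^ 2 * (freqSq n)⁻¹ := by
        have h := mul_nonneg (inv_pos.mpr hf).le (sq_nonneg (freqSq n / 2 - α))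
        have e : (freqSq n)⁻¹ * (freqSq n / 2 - α) ^ 2
            = 1 / 4 * freqSq n + α ^ 2 * (freqSq n)⁻¹ - α := by field_simp; ring
        linarith
      nlinarith [sq_nonneg ‖fc d n‖]
  have h5 := Finset.sum_le_sum fun j (_ : j ∈ Finset.univ) => h3 j
  rw [Finset.sum_add_distrib, ← Finset.mul_sum _ _ (2 * δ), Finset.sum_const, Finset.card_univ,
    Fintype.card_fin] at h5
  have e : (2 : ℕ) • (1 / (4 * δ) * ((freqSq n)⁻¹ * ‖fc d n‖ ^ 2))
      = 1 / (2 * δ) * ((freqSq n)⁻¹ * ‖fc d n‖ ^ 2) := by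
    rw [nsmul_eq_mul]; field_simp; norm_num; ring
  rw [e] at h5
  linarith

/-- The two parts of the flux are treated differently: `f'` is bounded by 1, so `ud f'` costs only
the `L²` norm of `ud`, while `u d` is a product of two `H¹` functions and costs a multiple of the
Dirichlet integral of `d`, made small by `δ`. -/
lemma tsum_diffAdvTerm_le {ud u : Fin 2 → L2T} {f' d : L2T} (hd0 : fc d 0 = 0) (hd : InH2 (fc d))
    (hu : ∑ j, sobolevSq 1 (fc (u j)) ≤ ENNReal.ofReal (R ^ 2)) (hf' : ∀ᵐ x, |f' x| ≤ 1)
    (hε : ε ∈ Ioc (0 : ℝ) 1) (hs : Summable (diffAdvTerm ud u f' d)) :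
    α * (invArea * ‖d‖ ^ 2) - ∑' n, diffAdvTerm ud u f' d n ≤
      1 / 2 * dirichlet d + energyConst α R * ‖energyMap hε d‖ ^ 2
        + invArea * ∑ j, ‖ud j‖ ^ 2 := by
  have hb := besselSum_nonneg
  -- Chosen so that `2δ ≤ 1` and `2δ · 4 besselSum R² ≤ 1/4`; with the `1/4` from interpolation,
  -- half of the Dirichlet integral is spent. The resulting `α² + 1/(2δ)` is `energyConst α R`.
  set δ : ℝ := 1 / (4 * (1 + 8 * besselSum * R ^ 2)) with hδdef
  have hδ : 0 < δ := by positivity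
  have hX : ∀ j, _ := fun j => tsum_norm_fc_mul_sq_le (v := ud j) hf'
  have hD := dirichlet_nonneg d
  have hd1 := sobolevSq_one_le_dirichlet hd hd0
  have hut : (∑ j, sobolevSq 1 (fc (u j))) ≠ ∞ := (hu.trans_lt ENNReal.ofReal_lt_top).ne
  have huj : ∀ j, sobolevSq 1 (fc (u j)) ≠ ∞ := fun j =>
    (ENNReal.sum_ne_top.mp hut) j (Finset.mem_univ j)
  have husum : ∑ j, (sobolevSq 1 (fc (u j))).toReal ≤ R ^ 2 := by
    rw [← ENNReal.toReal_sum fun j _ => huj j]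
    exact ENNReal.toReal_le_of_le_ofReal (sq_nonneg R) hu
  have hY : ∀ j, _ := fun j => tsum_norm_fc_mul_sq_le_sobolev
    (v := u j) (w := d) (A := (sobolevSq 1 (fc (u j))).toReal) (B := 2 * dirichlet d)
    ENNReal.toReal_nonneg (by positivity) (ENNReal.ofReal_toReal (huj j)).ge hd1
  have hinv : Summable fun n => (freqSq n)⁻¹ * ‖fc d n‖ ^ 2 := by
    refine Summable.of_nonneg_of_le (fun n => mul_nonneg (inv_nonneg.mpr (freqSq_nonneg n))
      (sq_nonneg _)) (fun n => ?_) (hasSum_norm_fc_L2 d).summable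
    exact mul_le_of_le_one_left (sq_nonneg _) (inv_freqSq_le_one n)
  have hinvle : ∑' n, (freqSq n)⁻¹ * ‖fc d n‖ ^ 2 ≤ ‖energyMap hε d‖ ^ 2 := by
    rw [← (hasSum_norm_sq_energyMap hε d).tsum_eq]
    refine hinv.tsum_le_tsum (fun n => ?_) (hasSum_norm_sq_energyMap hε d).summable
    gcongr
    unfold symb
    linarith [hε.1]
  have hL := ((hasSum_norm_fc_L2 d).mul_left α).sub hs.hasSum
  have hRt := ((hd.summable_freqSq.hasSum.mul_left (1 / 4)).add
    (hinv.hasSum.mul_left (α ^ 2 + 1 / (2 * δ)))).add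
    ((hasSum_sum fun j (_ : j ∈ Finset.univ) =>
      (hX j).1.hasSum.add (hY j).1.hasSum).mul_left (2 * δ))
  have hmain := hasSum_le (fun n => diffAdvTerm_le (α := α) (ud := ud) (u := u) (f' := f') hδ hd0 n) hL hRt
  have hXs : ∑ j, ∑' n, ‖fc (fun x => ud j x * f' x) n‖ ^ 2 ≤ invArea * ∑ j, ‖ud j‖ ^ 2 := by
    rw [Finset.mul_sum]
    exact Finset.sum_le_sum fun j _ => (hX j).2
  have hYs : ∑ j, ∑' n, ‖fc (fun x => u j x * d x) n‖ ^ 2 ≤ 4 * besselSum * R ^ 2 * dirichlet d := by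
    refine (Finset.sum_le_sum fun j _ => (hY j).2).trans ?_
    rw [← Finset.mul_sum, ← Finset.sum_mul]
    calc _ ≤ 2 * besselSum * (R ^ 2 * (2 * dirichlet d)) := by gcongr
      _ = _ := by ring
  rw [Finset.sum_add_distrib] at hmain
  have hX0 : 0 ≤ ∑ j, ∑' n, ‖fc (fun x => ud j x * f' x) n‖ ^ 2 :=
    Finset.sum_nonneg fun j _ => tsum_nonneg fun n => sq_nonneg _
  have hδ1 : 2 * δ ≤ 1 := by
    rw [hδdef]
    have : 4 * (1 + 8 * besselSum * R ^ 2) ≥ 4 := by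
      have : 0 ≤ 8 * besselSum * R ^ 2 := by positivity
      linarith
    have h4 : 1 / (4 * (1 + 8 * besselSum * R ^ 2)) ≤ 1 / 4 := by
      apply one_div_le_one_div_of_le <;> linarith
    linarith
  have hδ2 : 2 * δ * (4 * besselSum * R ^ 2 * dirichlet d) ≤ 1 / 4 * dirichlet d := by
    have : 2 * δ * (4 * besselSum * R ^ 2) ≤ 1 / 4 := by
      rw [hδdef]
      have hpos : 0 ≤ 8 * besselSum * R ^ 2 := by positivity
      rw [← sub_nonneg]
      have e : 1 / 4 - 2 * (1 / (4 * (1 + 8 * besselSum * R ^ 2))) * (4 * besselSum * R ^ 2)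
          = 1 / (4 * (1 + 8 * besselSum * R ^ 2)) := by field_simp; ring
      rw [e]; positivity
    calc _ = (2 * δ * (4 * besselSum * R ^ 2)) * dirichlet d := by ring
      _ ≤ _ := by gcongr
  have hC : α ^ 2 + 1 / (2 * δ) = energyConst α R := by
    rw [energyConst, hδdef]; field_simp; ring
  rw [hC] at hmain
  have hC0 : 0 ≤ energyConst α R := by unfold energyConst; positivity
  have p1 := mul_le_mul_of_nonneg_left hYs (by positivity : 0 ≤ 2 * δ)
  have p2 := mul_le_mul_of_nonneg_left hinvle hC0
  have p3 : 2 * δ * ∑ j, ∑' n, ‖fc (fun x => ud j x * f' x) n‖ ^ 2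
      ≤ ∑ j, ∑' n, ‖fc (fun x => ud j x * f' x) n‖ ^ 2 := mul_le_of_le_one_left hX0 hδ1
  change _ ≤ 1 / 4 * dirichlet d + _ + _ at hmain
  rw [mul_add] at hmain
  linarith

/-- The energy inequality for difference quotients. -/
lemma energy_inequality (hα : OneSided α φ) (hε : ε ∈ Ioc (0 : ℝ) 1)
    (h : Slice ε R φ u f g) (h' : Slice ε R φ u' f' g') {τ : ℝ} (hτ : 0 < τ) :
    2 * inner ℝ (energyMap hε (τ⁻¹ • (f' - f))) (energyMap hε (τ⁻¹ • (g' - g)))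
        + dirichlet (τ⁻¹ • (f' - f))
      ≤ 2 * energyConst α R * ‖energyMap hε (τ⁻¹ • (f' - f))‖ ^ 2
        + 2 * invArea * ∑ j, ‖τ⁻¹ • (u' j - u j)‖ ^ 2 := by
  set d := τ⁻¹ • (f' - f) with hd
  set ud : Fin 2 → L2T := fun j => τ⁻¹ • (u' j - u j) with hud
  have hdn : ∀ n, fc d n = (τ⁻¹ : ℝ) * (fc f' n - fc f n) := fun n => by
    rw [hd, fc_coeFn_smul, fc_coeFn_sub]
  have hd0 : fc d 0 = 0 := by rw [hdn, h.mem.fc_zero, h'.mem.fc_zero]; simp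
  have hdH : InH2 (fc d) := by
    have := (h'.mem.inH2.sub h.mem.inH2).const_mul ((τ⁻¹ : ℝ) : ℂ)
    rwa [← funext hdn] at this
  have hdx : d =ᵐ[volume] fun x => τ⁻¹ * (f' x - f x) := by
    filter_upwards [Lp.coeFn_smul τ⁻¹ (f' - f), Lp.coeFn_sub f' f] with x h1 h2
    rw [hd, h1, Pi.smul_apply, h2, Pi.sub_apply, smul_eq_mul]
  -- The equations at the two times are both tested with the quotient `d` and subtracted. Since `d`
  -- has mean zero, `m(φ)` drops out.
  have T' := h'.tested hε d
  have T := h.tested hε d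
  have hmean : mean d = 0 := by
    have := fc_zero d
    rw [hd0] at this
    exact_mod_cast this.symm
  rw [hmean, mul_zero, zero_sub] at T T'
  have e1 : inner ℝ (energyMap hε d) (energyMap hε g') - inner ℝ (energyMap hε d) (energyMap hε g)
      = τ * inner ℝ (energyMap hε d) (energyMap hε (τ⁻¹ • (g' - g))) := by
    rw [map_smul (energyMap hε) τ⁻¹ (g' - g), inner_smul_right, map_sub (energyMap hε) g' g, inner_sub_right, mul_inv_cancel_left₀ hτ.ne']
  have hL2d := (hasSum_norm_fc_L2 d).summable
  have e2 : ∑' n, freqSq n * (conj (fc f' n) * fc d n).re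
      - ∑' n, freqSq n * (conj (fc f n) * fc d n).re = τ * dirichlet d := by
    rw [← (summable_laplace h'.mem hL2d).tsum_sub (summable_laplace h.mem hL2d), dirichlet,
      ← tsum_mul_left]
    refine tsum_congr fun n => ?_
    have : fc f' n = fc f n + τ * fc d n := by
      rw [hdn]
      have : (τ : ℂ) ≠ 0 := by exact_mod_cast hτ.ne'
      push_cast
      field_simp
      ring
    rw [this, ← mul_sub, ← Complex.sub_re, ← sub_mul, ← map_sub, add_sub_cancel_left, map_mul,
      Complex.conj_ofReal, mul_assoc, Complex.re_ofReal_mul, Complex.conj_mul', ← Complex.ofReal_pow,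
      Complex.ofReal_re]
    ring
  have e3 : -α * (invArea * ‖d‖ ^ 2) * τ ≤ invArea * (∫ x, φ (f' x) * d x)
      - invArea * ∫ x, φ (f x) * d x := by
    have i1 : Integrable (fun x => φ (f' x) * d x) := h'.mem.phi_l2.integrable_mul (Lp.memLp d)
    have i2 : Integrable (fun x => φ (f x) * d x) := h.mem.phi_l2.integrable_mul (Lp.memLp d)
    have e : -α * (invArea * ‖d‖ ^ 2) * τ = invArea * ∫ x, -α * τ * d x ^ 2 := by
      rw [integral_const_mul, norm_L2_sq]; ring
    rw [e, ← mul_sub, ← integral_sub i1 i2]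
    refine mul_le_mul_of_nonneg_left (integral_mono_ae
      ((Lp.memLp d).integrable_sq.const_mul _) (i1.sub i2) ?_) invArea_pos.le
    filter_upwards [h.mem.interior, h'.mem.interior, hdx] with x h1 h2 h3
    have := hα _ h2 _ h1
    have hd' : f' x - f x = τ * d x := by rw [h3, mul_inv_cancel_left₀ hτ.ne']
    rw [hd'] at this
    have h4 := mul_le_mul_of_nonneg_left this (inv_pos.mpr hτ).le
    have e5 : τ⁻¹ * (-α * (τ * d x) ^ 2) = -α * τ * d x ^ 2 := by field_simp
    have e6 : τ⁻¹ * ((φ (f' x) - φ (f x)) * (τ * d x)) = φ (f' x) * d x - φ (f x) * d x := by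
      field_simp
    rw [e5, e6] at h4
    exact h4
  -- Leibniz rule for differences: `u' f' - u f = (u' - u) f' + u (f' - f)`.
  have hfl : ∀ j n, Slice.flux u' f' j n - Slice.flux u f j n
      = τ * (fc (fun x => ud j x * f' x) n + fc (fun x => u j x * d x) n) := by
    intro j n
    have hux : ud j =ᵐ[volume] fun x => τ⁻¹ * (u' j x - u j x) := by
      filter_upwards [Lp.coeFn_smul τ⁻¹ (u' j - u j), Lp.coeFn_sub (u' j) (u j)] with x h1 h2
      rw [hud, h1, Pi.smul_apply, h2, Pi.sub_apply, smul_eq_mul]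
    rw [Slice.flux, Slice.flux, ← fc_sub (integrable_mul_L2 _ _) (integrable_mul_L2 _ _),
      ← fc_add (integrable_mul_L2 _ _) (integrable_mul_L2 _ _), ← fc_const_mul]
    refine congrFun (fc_congr_ae ?_) n
    filter_upwards [hdx, hux] with x h1 h2
    rw [h1, h2]
    field_simp
    ring
  have hterm : ∀ n, advTerm u' f' d n - advTerm u f d n = τ * diffAdvTerm ud u f' d n := by
    intro n
    have e : advCoef u' f' n - advCoef u f n = (τ : ℂ) * ∑ j, Complex.I * (n j : ℂ) *
        (fc (fun x => ud j x * f' x) n + fc (fun x => u j x * d x) n) := by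
      rw [advCoef_eq, advCoef_eq, ← Finset.sum_sub_distrib, Finset.mul_sum]
      refine Finset.sum_congr rfl fun j _ => ?_
      rw [← mul_sub, hfl]
      ring
    rw [advTerm, advTerm, diffAdvTerm, ← mul_sub, ← Complex.sub_re, ← mul_sub, e,
      mul_left_comm (conj _), Complex.re_ofReal_mul]
    ring
  have hs : Summable (diffAdvTerm ud u f' d) := by
    have := ((h'.summable_advTerm d).sub (h.summable_advTerm d)).mul_left τ⁻¹
    refine this.congr fun n => ?_
    rw [hterm, inv_mul_cancel_left₀ hτ.ne']
  have e4 : ∑' n, advTerm u' f' d n - ∑' n, advTerm u f d n = τ * ∑' n, diffAdvTerm ud u f' d n := by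
    rw [← (h'.summable_advTerm d).tsum_sub (h.summable_advTerm d), ← tsum_mul_left]
    exact tsum_congr hterm
  have hB := tsum_diffAdvTerm_le (α := α) hd0 hdH h.vel h'.mem.abs_le_one hε hs
  have key : τ * (inner ℝ (energyMap hε d) (energyMap hε (τ⁻¹ • (g' - g))))
      ≤ τ * (-(1 / 2 * dirichlet d) + energyConst α R * ‖energyMap hε d‖ ^ 2
        + invArea * ∑ j, ‖ud j‖ ^ 2) := by
    have hB' := mul_le_mul_of_nonneg_left hB hτ.le
    rw [mul_sub] at hB'
    have hc : -α * (invArea * ‖d‖ ^ 2) * τ = -(τ * (α * (invArea * ‖d‖ ^ 2))) := by ring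
    rw [hc] at e3
    have hr : τ * (-(1 / 2 * dirichlet d) + energyConst α R * ‖energyMap hε d‖ ^ 2
        + invArea * ∑ j, ‖ud j‖ ^ 2) = τ * (1 / 2 * dirichlet d + energyConst α R *
        ‖energyMap hε d‖ ^ 2 + invArea * ∑ j, ‖ud j‖ ^ 2) - τ * dirichlet d := by ring
    rw [hr]
    linarith
  have := le_of_mul_le_mul_left key hτ
  linarith

end Slice

/-- Coercivity of a singular potential. -/
def Coercive (c₀ : ℝ) (φ : ℝ → ℝ) : Prop :=
  ∀ s ∈ Ioo (-1 : ℝ) 1, |φ s| ≤ 2 * (φ s * s + c₀)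

lemma abs_mean_le (f : T2 → ℝ) : |mean f| ≤ invArea * ∫ x, |f x| := by
  rw [mean_eq, abs_mul, abs_of_pos invArea_pos]
  exact mul_le_mul_of_nonneg_left abs_integral_le_integral_abs invArea_pos.le

lemma integral_const_invArea (c : ℝ) : invArea * ∫ _x : T2, c = c := by
  have h := fc_zero (fun _ => c)
  have h0 := integral_mode 0
  simp only [mode_zero, if_true] at h0
  have h2 : ∫ x : T2, ((1 : ℝ) : ℂ) = (2 * Real.pi) ^ 2 := by simpa using h0
  rw [integral_complex_ofReal] at h2
  have h3 : ∫ x : T2, (1 : ℝ) = (2 * Real.pi) ^ 2 := by exact_mod_cast h2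
  have h4 : ∫ _x : T2, c = c * ∫ _x : T2, (1 : ℝ) := by
    rw [← integral_const_mul]; simp
  rw [h4, h3, invArea]
  have := Real.pi_pos
  field_simp

lemma ofReal_sqrt_sq {X : ℝ} (hX : 0 ≤ X) : ENNReal.ofReal (√X) ^ 2 = ENNReal.ofReal X := by
  rw [← ENNReal.ofReal_pow (Real.sqrt_nonneg _), Real.sq_sqrt hX]

lemma le_ofReal_sqrt_of_sq_le {x : ℝ≥0∞} {X : ℝ} (hX : 0 ≤ X) (h : x ^ 2 ≤ ENNReal.ofReal X) :
    x ≤ ENNReal.ofReal (√X) := by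
  rw [← ofReal_sqrt_sq hX] at h
  exact (ENNReal.pow_le_pow_left_iff (by norm_num)).mp h

/-! ### Bounds at a fixed time: the time derivative, elliptic quantities and the source -/

namespace Slice

variable {ε R : ℝ} {φ : ℝ → ℝ} {u : Fin 2 → L2T} {f g : L2T}

/-- The squared norm of `φ(f)` with weight `ε + (-Δ)⁻¹`. -/
def weightedSq (ε : ℝ) (a : (Fin 2 → ℤ) → ℂ) : ℝ≥0∞ :=
  ENNReal.ofReal ε * sobolevSq 0 a + homNegSq a

lemma weightedSq_eq (hε : 0 ≤ ε) (a : (Fin 2 → ℤ) → ℂ) :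
    weightedSq ε a = ∑' n, ENNReal.ofReal (symb ε n * ‖a n‖ ^ 2) := by
  rw [weightedSq, sobolevSq, homNegSq, ← ENNReal.tsum_mul_left, ← ENNReal.tsum_add]
  refine tsum_congr fun n => ?_
  rw [← ENNReal.ofReal_mul hε, ← ENNReal.ofReal_add (by positivity)
    (mul_nonneg (inv_nonneg.mpr (freqSq_nonneg n)) (sq_nonneg _)), symb]
  congr 1
  ring

/-- The time derivative is controlled by the phase space norm. -/
lemma norm_energyMap_deriv_sq_le (hε : ε ∈ Ioc (0 : ℝ) 1) (h : Slice ε R φ u f g) {V : ℝ}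
    (hV : 0 ≤ V) (hle : weightedSq ε (varphiCoef ε φ f) ≤ ENNReal.ofReal V) :
    ‖energyMap hε g‖ ^ 2 ≤ 2 * V + 8 * R ^ 2 := by
  rw [weightedSq_eq hε.1.le] at hle
  have hv := summable_of_tsum_ofReal_le
    (fun n => mul_nonneg (symb_pos hε n).le (sq_nonneg _)) hle hV
  have hterm : ∀ n, symb ε n * ‖fc g n‖ ^ 2 ≤ 2 * (symb ε n * ‖varphiCoef ε φ f n‖ ^ 2)
      + 4 * ∑ j, ‖flux u f j n‖ ^ 2 := by
    intro n
    have hs := symb_pos hε n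
    have hsC : ((symb ε n : ℝ) : ℂ) ≠ 0 := by exact_mod_cast hs.ne'
    set A := (((freqSq n)⁻¹ : ℝ) : ℂ) * advCoef u f n with hA
    have e : fc g n = varphiCoef ε φ f n - ((symb ε n)⁻¹ : ℝ) * A := by
      have e' : ((symb ε n : ℝ) : ℂ) * fc g n = rhsCoef φ f n - A := by
        rw [← h.eq n, hA, symb]; push_cast; ring
      have hvp : varphiCoef ε φ f n = ((symb ε n)⁻¹ : ℝ) * rhsCoef φ f n := rfl
      rw [hvp, ← mul_sub, ← e']
      push_cast
      field_simp
    have hAle : ‖A‖ ≤ invFreq n * ∑ j, ‖flux u f j n‖ := norm_inv_freqSq_mul_div_le _ n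
    have h1 : ‖fc g n‖ ≤ ‖varphiCoef ε φ f n‖ + (symb ε n)⁻¹ * ‖A‖ := by
      rw [e]
      refine (norm_sub_le _ _).trans (le_of_eq ?_)
      rw [norm_mul, Complex.norm_real, Real.norm_of_nonneg (inv_pos.mpr hs).le]
    have h2 : ‖fc g n‖ ^ 2 ≤ 2 * ‖varphiCoef ε φ f n‖ ^ 2 + 2 * ((symb ε n)⁻¹ * ‖A‖) ^ 2 := by
      have h0 := norm_nonneg (fc g n)
      nlinarith [sq_nonneg (‖varphiCoef ε φ f n‖ - (symb ε n)⁻¹ * ‖A‖)]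
    -- The estimate is uniform in `ε` because `|n|⁻² ≤ symb ε n`: the gain of `|n|⁻²` in `‖A‖²` pays
    -- for the factor `(symb ε n)⁻¹`.
    have h3 : symb ε n * ((symb ε n)⁻¹ * ‖A‖) ^ 2 ≤ 2 * ∑ j, ‖flux u f j n‖ ^ 2 := by
      have e1 : symb ε n * ((symb ε n)⁻¹ * ‖A‖) ^ 2 = (symb ε n)⁻¹ * ‖A‖ ^ 2 := by field_simp
      have h4 : ‖A‖ ^ 2 ≤ (freqSq n)⁻¹ * (2 * ∑ j, ‖flux u f j n‖ ^ 2) := by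
        have := pow_le_pow_left₀ (norm_nonneg A) hAle 2
        rw [mul_pow, invFreq_sq] at this
        refine this.trans (mul_le_mul_of_nonneg_left ?_ (inv_nonneg.mpr (freqSq_nonneg n)))
        have := sq_sum_le_card_mul_sum_sq (s := Finset.univ) (f := fun j => ‖flux u f j n‖)
        simpa using this
      have h5 : (symb ε n)⁻¹ * (freqSq n)⁻¹ ≤ 1 := by
        rw [inv_mul_le_iff₀ hs, mul_one, symb]
        linarith [hε.1]
      have h6 : 0 ≤ 2 * ∑ j, ‖flux u f j n‖ ^ 2 := by positivity
      rw [e1]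
      calc (symb ε n)⁻¹ * ‖A‖ ^ 2 ≤ (symb ε n)⁻¹ * ((freqSq n)⁻¹ * (2 * ∑ j, ‖flux u f j n‖ ^ 2)) :=
            mul_le_mul_of_nonneg_left h4 (inv_pos.mpr hs).le
        _ = ((symb ε n)⁻¹ * (freqSq n)⁻¹) * (2 * ∑ j, ‖flux u f j n‖ ^ 2) := by ring
        _ ≤ 1 * _ := mul_le_mul_of_nonneg_right h5 h6
        _ = _ := one_mul _
    have h7 := mul_le_mul_of_nonneg_left h2 hs.le
    linarith
  have hmain := hasSum_le hterm (hasSum_norm_sq_energyMap hε g)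
    ((hv.1.hasSum.mul_left 2).add ((hasSum_sum fun j (_ : j ∈ Finset.univ) =>
      (h.summable_flux j).hasSum).mul_left 4))
  refine hmain.trans ?_
  have := Finset.sum_le_sum fun j (_ : j ∈ Finset.univ) => h.tsum_flux_le j
  simp only [Finset.sum_const, Finset.card_univ, Fintype.card_fin, nsmul_eq_mul] at this
  push_cast at this
  linarith [hv.2]

/-- The bound for the elliptic quantities. -/
def ellipticConst (c₀ R G : ℝ) : ℝ := 2 + G / 2 + R ^ 2 + c₀

/-- The equation is tested with `f` itself, whose mean zero removes `m(φ(f))`. Coercivity turns `∫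
φ(f) f` into the `L¹` norm of `φ(f)`, and the time derivative enters only through its energy `G`.
The `L¹` bound is what controls `m(φ(f))` later. -/
lemma elliptic_bound (hε : ε ∈ Ioc (0 : ℝ) 1) (h : Slice ε R φ u f g) {c₀ G : ℝ}
    (hc : Coercive c₀ φ) (hG : ‖energyMap hε g‖ ^ 2 ≤ G) :
    dirichlet f + 1 / 2 * (invArea * ∫ x, |φ (f x)|) ≤ ellipticConst c₀ R G := by
  have T := h.tested hε f
  rw [h.mem.mean_zero, mul_zero, zero_sub] at T
  have e1 : ∑' n, freqSq n * (conj (fc f n) * fc f n).re = dirichlet f := by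
    unfold dirichlet
    refine tsum_congr fun n => ?_
    rw [Complex.conj_mul', ← Complex.ofReal_pow, Complex.ofReal_re]
  rw [e1] at T
  have hf1 := norm_sq_le_of_abs_le_one h.mem.abs_le_one
  have hS : ‖energyMap hε f‖ ^ 2 ≤ 2 := by
    have := hasSum_le (fun n => mul_le_mul_of_nonneg_right (symb_le_two hε n)
      (sq_nonneg ‖fc f n‖)) (hasSum_norm_sq_energyMap hε f) ((hasSum_norm_fc_L2 f).mul_left 2)
    linarith
  have hin : -inner ℝ (energyMap hε f) (energyMap hε g) ≤ 1 + G / 2 := by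
    have h1 := (neg_le_abs _).trans (abs_real_inner_le_norm (energyMap hε f) (energyMap hε g))
    nlinarith [sq_nonneg (‖energyMap hε f‖ - ‖energyMap hε g‖)]
  have hadv : -∑' n, advTerm u f f n ≤ 1 + R ^ 2 := by
    have hterm : ∀ n, -advTerm u f f n ≤ ‖fc f n‖ ^ 2 + 1 / 2 * ∑ j, ‖flux u f j n‖ ^ 2 := by
      intro n
      refine (neg_le_abs _).trans ((abs_advTerm_le u f f n).trans ?_)
      have : ∀ j, invFreq n * ‖fc f n‖ * ‖flux u f j n‖
          ≤ 1 / 2 * ‖fc f n‖ ^ 2 + 1 / 2 * ‖flux u f j n‖ ^ 2 := fun j => by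
        have h1 : invFreq n * ‖fc f n‖ ≤ ‖fc f n‖ :=
          mul_le_of_le_one_left (norm_nonneg _) (invFreq_le_one n)
        have h2 := mul_le_mul_of_nonneg_right h1 (norm_nonneg (flux u f j n))
        nlinarith [sq_nonneg (‖fc f n‖ - ‖flux u f j n‖)]
      refine (Finset.sum_le_sum fun j _ => this j).trans (le_of_eq ?_)
      simp only [Fin.sum_univ_two]
      ring
    have hm := hasSum_le hterm (h.summable_advTerm f).hasSum.neg
      ((hasSum_norm_fc_L2 f).add ((hasSum_sum fun j (_ : j ∈ Finset.univ) =>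
        (h.summable_flux j).hasSum).mul_left (1 / 2)))
    have := Finset.sum_le_sum fun j (_ : j ∈ Finset.univ) => h.tsum_flux_le j
    simp only [Finset.sum_const, Finset.card_univ, Fintype.card_fin, nsmul_eq_mul] at this
    push_cast at this
    linarith
  have hφ : 1 / 2 * (invArea * ∫ x, |φ (f x)|) - c₀ ≤ invArea * ∫ x, φ (f x) * f x := by
    have i1 : Integrable (fun x => φ (f x)) := h.mem.phi_l2.integrable (by norm_num)
    have i2 : Integrable (fun x => φ (f x) * f x) := h.mem.phi_l2.integrable_mul (Lp.memLp f)
    have hm : ∫ x, |φ (f x)| ≤ ∫ x, 2 * (φ (f x) * f x + c₀) := by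
      refine integral_mono_ae i1.abs ((i2.add (integrable_const c₀)).const_mul 2) ?_
      filter_upwards [h.mem.interior] with x hx
      exact hc _ hx
    rw [integral_const_mul, integral_add i2 (integrable_const c₀)] at hm
    have h1 := mul_le_mul_of_nonneg_left hm invArea_pos.le
    have h2 := integral_const_invArea c₀
    have e : invArea * (2 * ((∫ x, φ (f x) * f x) + ∫ _x : T2, c₀))
        = 2 * (invArea * ∫ x, φ (f x) * f x) + 2 * (invArea * ∫ _x : T2, c₀) := by ring
    rw [e, h2] at h1
    linarith
  unfold ellipticConst
  linarith

/-- The size of the right-hand side of `ε ∂ₜθ - Δθ + φ(θ) = …`. -/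
def sourceBound (c₀ R G : ℝ) (g : L2T) : ℝ :=
  2 * ellipticConst c₀ R G + 4 * √(3 * besselSum ^ 2 * (R ^ 2 * (2 * ellipticConst c₀ R G)))
    + 4 * (√(besselSum * invArea) * ‖g‖)

/-- Both `u j` and `f` lie in `H¹`, so the product estimate in the Wiener algebra applies. It yields
the `L^∞` bound of `(-Δ)⁻¹ div(uf)`. -/
lemma tsum_bessel_flux_le (h : Slice ε R φ u f g) {K : ℝ} (hK : dirichlet f ≤ K) (j : Fin 2) :
    Summable (fun n => bessel n * ‖flux u f j n‖) ∧
      ∑' n, bessel n * ‖flux u f j n‖ ≤ √(3 * besselSum ^ 2 * (R ^ 2 * (2 * K))) := by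
  have hK0 : 0 ≤ K := (dirichlet_nonneg f).trans hK
  refine summable_of_tsum_ofReal_le (fun n => mul_nonneg (bessel_pos n).le (norm_nonneg _)) ?_
    (Real.sqrt_nonneg _)
  refine le_ofReal_sqrt_of_sq_le (by positivity) ?_
  have e : ∀ n, ENNReal.ofReal (bessel n * ‖flux u f j n‖) = besselE n * ‖flux u f j n‖ₑ :=
    fun n => by rw [ENNReal.ofReal_mul (bessel_pos n).le, ofReal_norm, besselE]
  simp only [e]
  calc (∑' n, besselE n * ‖flux u f j n‖ₑ) ^ 2
      ≤ (∑' n, besselE n * ∑' m, ‖fc (u j) m‖ₑ * ‖fc f (n - m)‖ₑ) ^ 2 := by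
        refine pow_le_pow_left' (ENNReal.tsum_le_tsum fun n => ?_) 2
        exact mul_le_mul_right (enorm_fc_mul_le (Lp.memLp _) (Lp.memLp _) n) _
    _ ≤ 3 * ENNReal.ofReal besselSum ^ 2 * (sobolevSq 1 (fc (u j)) * sobolevSq 1 (fc f)) :=
        tsum_besselE_conv_sq_le _ _
    _ ≤ 3 * ENNReal.ofReal besselSum ^ 2 * (ENNReal.ofReal (R ^ 2) * ENNReal.ofReal (2 * K)) := by
        gcongr
        · exact h.sobolevSq_le j
        · exact (sobolevSq_one_le_dirichlet h.mem.inH2 h.mem.fc_zero).trans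
            (ENNReal.ofReal_le_ofReal (by linarith))
    _ = _ := by
        have e3 : ENNReal.ofReal (3 * besselSum ^ 2) = 3 * ENNReal.ofReal besselSum ^ 2 := by
          rw [ENNReal.ofReal_mul (by norm_num), ENNReal.ofReal_pow besselSum_nonneg,
            ENNReal.ofReal_ofNat]
        rw [ENNReal.ofReal_mul (by positivity : 0 ≤ 3 * besselSum ^ 2), e3,
          ENNReal.ofReal_mul (sq_nonneg R)]

/-- Cauchy–Schwarz with `∑ ⟨n⟩⁻⁴ ≤ ∑ ⟨n⟩⁻³`. This is the two-dimensional embedding of `H²` into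
`L^∞`, applied to `(-Δ)⁻¹ g`. -/
lemma tsum_bessel_sq_fc_le (g : L2T) : Summable (fun n => bessel n ^ 2 * ‖fc g n‖) ∧
      ∑' n, bessel n ^ 2 * ‖fc g n‖ ≤ √(besselSum * invArea) * ‖g‖ := by
  have e0 : √(besselSum * invArea) * ‖g‖ = √(besselSum * (invArea * ‖g‖ ^ 2)) := by
    rw [← mul_assoc, Real.sqrt_mul' _ (sq_nonneg _), Real.sqrt_sq (norm_nonneg _)]
  rw [e0]
  have hb := besselSum_nonneg
  have ha := invArea_pos
  refine summable_of_tsum_ofReal_le (fun n => by have := bessel_pos n; positivity) ?_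
    (Real.sqrt_nonneg _)
  refine le_ofReal_sqrt_of_sq_le (by positivity) ?_
  have e : ∀ n, ENNReal.ofReal (bessel n ^ 2 * ‖fc g n‖) = besselE n ^ 2 * ‖fc g n‖ₑ :=
    fun n => by
      rw [ENNReal.ofReal_mul (sq_nonneg _), ofReal_norm, besselE,
        ENNReal.ofReal_pow (bessel_pos n).le]
  simp only [e]
  refine (tsum_mul_sq_le _ _).trans ?_
  rw [ENNReal.ofReal_mul hb]
  refine mul_le_mul' ?_ (le_of_eq ?_)
  · rw [← tsum_besselE_cube]
    refine ENNReal.tsum_le_tsum fun n => ?_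
    rw [← pow_mul]
    exact pow_le_pow_right_of_le_one' (besselE_le_one n) (by norm_num)
  · rw [← (hasSum_norm_fc_L2 g).tsum_eq, ENNReal.ofReal_tsum_of_nonneg (fun n => sq_nonneg _)
      (hasSum_norm_fc_L2 g).summable]
    exact tsum_congr fun n => by rw [ENNReal.ofReal_pow (norm_nonneg _), ofReal_norm]

/-- The equation `ε ∂ₜθ - Δθ + φ(θ) = F` with `|F| ≤ sourceBound`, in weak form. -/
lemma abs_tested_le (hε : ε ∈ Ioc (0 : ℝ) 1) (h : Slice ε R φ u f g) {c₀ G : ℝ}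
    (hc : Coercive c₀ φ) (hG : ‖energyMap hε g‖ ^ 2 ≤ G) (ψ : L2T) :
    |ε * (invArea * ∫ x, ψ x * g x) + ∑' n, freqSq n * (conj (fc f n) * fc ψ n).re
      + invArea * ∫ x, φ (f x) * ψ x| ≤ sourceBound c₀ R G g * (invArea * ∫ x, |ψ x|) := by
  set N := invArea * ∫ x, |ψ x| with hN
  have hN0 : 0 ≤ N := mul_nonneg invArea_pos.le (integral_nonneg fun x => abs_nonneg _)
  -- Duality with `L¹`: every Fourier coefficient of `ψ` is at most the mean of `|ψ|`. Absolutely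
  -- summable coefficients of the source therefore bound it in `L^∞`, without constructing it as a
  -- function.
  have hψN : ∀ n, ‖fc ψ n‖ ≤ N := norm_fc_le ψ
  set K := ellipticConst c₀ R G with hK
  have hell := h.elliptic_bound hε hc hG
  have hint0 : 0 ≤ invArea * ∫ x, |φ (f x)| :=
    mul_nonneg invArea_pos.le (integral_nonneg fun x => abs_nonneg _)
  have hdK : dirichlet f ≤ K := by linarith
  have hmK : |mean (fun x => φ (f x))| ≤ 2 * K := by
    have := abs_mean_le (fun x => φ (f x))
    have := dirichlet_nonneg f
    linarith
  have T := h.tested hε ψ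
  have hP := hasSum_re_conj_fc_mul_fc (Lp.memLp ψ) (Lp.memLp g)
  have hg := tsum_bessel_sq_fc_le g
  have hterm : ∀ n, ‖(freqSq n)⁻¹ * (conj (fc ψ n) * fc g n).re‖ ≤ 4 * N * (bessel n ^ 2 * ‖fc g n‖) := by
    intro n
    rw [Real.norm_eq_abs, abs_mul, abs_of_nonneg (inv_nonneg.mpr (freqSq_nonneg n))]
    have h1 : (freqSq n)⁻¹ ≤ 4 * bessel n ^ 2 := by
      rw [← invFreq_sq]
      have := pow_le_pow_left₀ (invFreq_nonneg n) (invFreq_le_two_bessel n) 2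
      linarith
    calc (freqSq n)⁻¹ * |(conj (fc ψ n) * fc g n).re|
        ≤ (4 * bessel n ^ 2) * (‖fc ψ n‖ * ‖fc g n‖) :=
          mul_le_mul h1 (abs_re_conj_mul_le _ _) (abs_nonneg _) (by positivity)
      _ ≤ (4 * bessel n ^ 2) * (N * ‖fc g n‖) := by gcongr; exact hψN n
      _ = _ := by ring
  have hsum2 : Summable fun n => (freqSq n)⁻¹ * (conj (fc ψ n) * fc g n).re :=
    Summable.of_norm_bounded (hg.1.mul_left _) hterm
  have hin : inner ℝ (energyMap hε ψ) (energyMap hε g) = ε * (invArea * ∫ x, ψ x * g x)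
      + ∑' n, (freqSq n)⁻¹ * (conj (fc ψ n) * fc g n).re := by
    refine (hasSum_inner_energyMap hε ψ g).unique ?_
    refine ((hP.mul_left ε).add hsum2.hasSum).congr_fun fun n => ?_
    rw [symb, add_mul]
  have hb2 : |∑' n, (freqSq n)⁻¹ * (conj (fc ψ n) * fc g n).re|
      ≤ 4 * N * (√(besselSum * invArea) * ‖g‖) := by
    have := tsum_of_norm_bounded (hg.1.hasSum.mul_left (4 * N)) hterm
    rw [Real.norm_eq_abs] at this
    exact this.trans (mul_le_mul_of_nonneg_left hg.2 (by positivity))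
  have hfl : ∀ j, _ := fun j => h.tsum_bessel_flux_le hdK j
  have hterm1 : ∀ n, ‖advTerm u f ψ n‖ ≤ 2 * N * ∑ j, bessel n * ‖flux u f j n‖ := by
    intro n
    rw [Real.norm_eq_abs]
    refine (abs_advTerm_le u f ψ n).trans ?_
    rw [Finset.mul_sum]
    refine Finset.sum_le_sum fun j _ => ?_
    calc invFreq n * ‖fc ψ n‖ * ‖flux u f j n‖ ≤ (2 * bessel n) * N * ‖flux u f j n‖ := by
          have := bessel_pos n
          gcongr
          · exact invFreq_le_two_bessel n
          · exact hψN n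
      _ = _ := by ring
  have hb1 : |∑' n, advTerm u f ψ n| ≤ 4 * N * √(3 * besselSum ^ 2 * (R ^ 2 * (2 * K))) := by
    have := tsum_of_norm_bounded ((hasSum_sum fun j (_ : j ∈ Finset.univ) =>
      (hfl j).1.hasSum).mul_left (2 * N)) hterm1
    rw [Real.norm_eq_abs] at this
    refine this.trans ?_
    have h2 := Finset.sum_le_sum fun j (_ : j ∈ Finset.univ) => (hfl j).2
    simp only [Finset.sum_const, Finset.card_univ, Fintype.card_fin, nsmul_eq_mul] at h2
    push_cast at h2
    have := mul_le_mul_of_nonneg_left h2 (by positivity : 0 ≤ 2 * N)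
    linarith
  have hb0 : |mean (fun x => φ (f x)) * mean ψ| ≤ 2 * K * N := by
    rw [abs_mul]
    exact mul_le_mul hmK (abs_mean_le _) (abs_nonneg _) ((abs_nonneg _).trans hmK)
  have e : ε * (invArea * ∫ x, ψ x * g x) + ∑' n, freqSq n * (conj (fc f n) * fc ψ n).re
      + invArea * ∫ x, φ (f x) * ψ x = mean (fun x => φ (f x)) * mean ψ - ∑' n, advTerm u f ψ n
        - ∑' n, (freqSq n)⁻¹ * (conj (fc ψ n) * fc g n).re := by
    rw [hin] at T
    linarith
  rw [e, sourceBound]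
  rw [abs_le] at *
  constructor <;> nlinarith [hb0.1, hb0.2, hb1.1, hb1.2, hb2.1, hb2.2]

end Slice

/-! ### Weak solutions and velocities as primitives in time -/

section Regularity

lemma enorm_sq_le_sobolevSq (k : ℕ) (f : L2T) :
    ENNReal.ofReal invArea * ‖f‖ₑ ^ 2 ≤ sobolevSq k (fc f) := by
  have e : ENNReal.ofReal invArea * ‖f‖ₑ ^ 2 = ENNReal.ofReal (invArea * ‖f‖ ^ 2) := by
    rw [ENNReal.ofReal_mul invArea_pos.le, ENNReal.ofReal_pow (norm_nonneg _), ofReal_norm]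
  rw [e, ← (hasSum_norm_fc_L2 f).tsum_eq, ENNReal.ofReal_tsum_of_nonneg (fun n => sq_nonneg _)
    (hasSum_norm_fc_L2 f).summable]
  refine ENNReal.tsum_le_tsum fun n => ENNReal.ofReal_le_ofReal ?_
  refine le_mul_of_one_le_left (sq_nonneg _) (one_le_pow₀ ?_)
  linarith [freqSq_nonneg n]

lemma integrableOn_of_lintegral_sq {E : Type*} [NormedAddCommGroup E] {f : ℝ → E} {μ : Measure ℝ}
    [IsFiniteMeasure μ] (hf : AEStronglyMeasurable f μ) (h : ∫⁻ t, ‖f t‖ₑ ^ 2 ∂μ < ∞) :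
    Integrable f μ := by
  refine ⟨hf, ?_⟩
  rw [HasFiniteIntegral]
  calc ∫⁻ t, ‖f t‖ₑ ∂μ ≤ ∫⁻ t, (1 + ‖f t‖ₑ ^ 2) ∂μ := by
        refine lintegral_mono fun t => ?_
        rcases le_total ‖f t‖ₑ 1 with h1 | h1
        · exact h1.trans le_self_add
        · exact (le_self_pow h1 (by norm_num)).trans le_add_self
    _ = μ univ + ∫⁻ t, ‖f t‖ₑ ^ 2 ∂μ := by
        rw [lintegral_add_left measurable_const]; simp
    _ < ∞ := ENNReal.add_lt_top.mpr ⟨measure_lt_top _ _, h⟩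

lemma integrable_norm_sq_of_lintegral {E : Type*} [NormedAddCommGroup E] {f : ℝ → E} {μ : Measure ℝ}
    (hf : AEStronglyMeasurable f μ) (h : ∫⁻ t, ‖f t‖ₑ ^ 2 ∂μ < ∞) :
    Integrable (fun t => ‖f t‖ ^ 2) μ := by
  refine ⟨hf.norm.pow 2, ?_⟩
  rw [HasFiniteIntegral]
  simpa [enorm_pow] using h

lemma intervalIntegrable_of_integrable_Ioo {E : Type*} [NormedAddCommGroup E] {f : ℝ → E} {a b : ℝ}
    (hab : a ≤ b) (h : Integrable f (volume.restrict (Ioo a b))) : IntervalIntegrable f volume a b := by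
  rw [intervalIntegrable_iff_integrableOn_Ioo_of_le hab]
  exact h

variable {ε T R : ℝ} {φ : ℝ → ℝ} {u : ℝ → Fin 2 → L2T} {θ₀ : L2T} {θ : ℝ → L2T}

/-- The `H²` part of the phase space metric dominates the `L²` distance. -/
lemma IsWeakSolution.continuousOn (h : IsWeakSolution ε T φ u θ₀ θ) : ContinuousOn θ (Ico 0 T) := by
  intro t ht
  have h0 := h.continuous t ht
  have hle : ∀ s, ENNReal.ofReal invArea * ‖θ s - θ t‖ₑ ^ 2 ≤ phaseDistSq ε φ (θ s) (θ t) := by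
    intro s
    refine (enorm_sq_le_sobolevSq 2 (θ s - θ t)).trans ?_
    rw [funext (fc_coeFn_sub (θ s) (θ t)), phaseDistSq, add_assoc, add_assoc]
    exact le_self_add
  have h1 : Tendsto (fun s => ENNReal.ofReal invArea * ‖θ s - θ t‖ₑ ^ 2) (𝓝[Ico 0 T] t) (𝓝 0) :=
    tendsto_of_tendsto_of_tendsto_of_le_of_le tendsto_const_nhds h0 (fun _ => zero_le) hle
  have h2 : Tendsto (fun s => invArea * ‖θ s - θ t‖ ^ 2) (𝓝[Ico 0 T] t) (𝓝 0) := by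
    have := (ENNReal.tendsto_toReal ENNReal.zero_ne_top).comp h1
    simpa [Function.comp_def, invArea_pos.le] using this
  have h3 : Tendsto (fun s => ‖θ s - θ t‖) (𝓝[Ico 0 T] t) (𝓝 0) := by
    have h4 := (h2.const_mul invArea⁻¹).sqrt
    have hi := invArea_pos.ne'
    simpa [inv_mul_cancel_left₀ hi, Real.sqrt_sq (norm_nonneg _)] using h4
  exact tendsto_iff_norm_sub_tendsto_zero.mpr h3

/-- The time derivative of a weak solution together with the facts used about it. -/
structure Evolution (ε T R : ℝ) (φ : ℝ → ℝ) (u : ℝ → Fin 2 → L2T) (θ g : ℝ → L2T) : Prop where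
  measurable : AEStronglyMeasurable g (volume.restrict (Ioo 0 T))
  primitive : ∀ b ∈ Ioo 0 T, IsPrimitive θ g 0 b
  slice : ∀ᵐ t, t ∈ Ioo 0 T → Slice ε R φ (u t) (θ t) (g t)

/-- The local `L²(H¹)` bound on `∂ₜθ` gives integrability in `L²(𝕋²)` on `(0, b)` for each `b < T`;
continuity of `θ` then identifies it with a primitive at every time, including `t = 0`. -/
lemma IsWeakSolution.exists_evolution (hT : 0 < T) (hu : IsVelocity T R u)
    (h : IsWeakSolution ε T φ u θ₀ θ) : ∃ g, Evolution ε T R φ u θ g := by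
  obtain ⟨g, hgm, hgi, hgd, hge⟩ := h.equation
  refine ⟨g, hgm, ?_, ?_⟩
  · refine isPrimitive_of_weakDeriv hT h.continuousOn ?_ hgd
    intro b hb
    apply intervalIntegrable_of_integrable_Ioo hb.1.le
    refine integrableOn_of_lintegral_sq
      (hgm.mono_measure (Measure.restrict_mono (Ioo_subset_Ioo_right hb.2.le) le_rfl)) ?_
    have h1 : ENNReal.ofReal invArea * ∫⁻ t in Ioo 0 b, ‖g t‖ₑ ^ 2
        ≤ ∫⁻ s in Ioo 0 b, sobolevSq 1 (fc (g s)) := by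
      rw [← lintegral_const_mul' _ _ ENNReal.ofReal_ne_top]
      exact lintegral_mono fun t => enorm_sq_le_sobolevSq 1 (g t)
    have h2 := h1.trans_lt (hgi b hb)
    by_contra hn
    rw [not_lt, top_le_iff] at hn
    rw [hn, ENNReal.mul_top (by simpa using invArea_pos)] at h2
    exact lt_irrefl _ h2
  · have h1 := (ae_restrict_iff' measurableSet_Ioo).mp hge
    have h2 := (ae_restrict_iff' measurableSet_Ioo).mp hu.linfty_h1
    filter_upwards [h1, h2] with t e1 e2 ht
    exact ⟨h.mem t ⟨ht.1.le, ht.2⟩, e2 ht, e1 ht⟩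

/-- The velocity is almost everywhere a primitive of its time derivative. -/
lemma IsVelocity.exists_primitive (hT : 0 < T) (hu : IsVelocity T R u) :
    ∃ U v : ℝ → Fin 2 → L2T, (∀ j, IsPrimitive (fun t => U t j) (fun t => v t j) 0 T) ∧
      (∀ᵐ t, t ∈ Ioo 0 T → u t = U t) ∧
      (∀ j, IntervalIntegrable (fun t => ‖v t j‖ ^ 2) volume 0 T) ∧
      ∑ j, ∫ t in 0..T, ‖v t j‖ ^ 2 ≤ R ^ 2 := by
  obtain ⟨v, hvm, hvd, hvi⟩ := hu.time_deriv
  have hsum : ∑ j, ∫⁻ t in Ioo 0 T, ‖v t j‖ₑ ^ 2 ≤ ENNReal.ofReal (R ^ 2) := by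
    rw [lintegral_finsetSum' _ fun j _ => ((hvm j).enorm.pow_const 2)] at hvi
    exact hvi
  have hvj : ∀ j, ∫⁻ t in Ioo 0 T, ‖v t j‖ₑ ^ 2 < ∞ := fun j =>
    ((Finset.single_le_sum (f := fun j => ∫⁻ t in Ioo 0 T, ‖v t j‖ₑ ^ 2) (fun _ _ => zero_le)
      (Finset.mem_univ j)).trans hsum).trans_lt ENNReal.ofReal_lt_top
  have hvI : ∀ j, IntervalIntegrable (fun t => v t j) volume 0 T := fun j =>
    intervalIntegrable_of_integrable_Ioo hT.le (integrableOn_of_lintegral_sq (hvm j) (hvj j))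
  have huI : ∀ j, IntegrableOn (fun t => u t j) (Ioo 0 T) := fun j => by
    refine integrableOn_of_lintegral_sq (hu.measurable j) ?_
    have h1 : ∀ᵐ t ∂volume.restrict (Ioo 0 T), ‖u t j‖ₑ ^ 2
        ≤ (ENNReal.ofReal invArea)⁻¹ * ENNReal.ofReal (R ^ 2) := by
      filter_upwards [hu.linfty_h1] with t ht
      have h2 := (enorm_sq_le_sobolevSq 1 (u t j)).trans ((Finset.single_le_sum
        (f := fun j => sobolevSq 1 (fc (u t j))) (fun _ _ => zero_le) (Finset.mem_univ j)).trans ht)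
      have h3 : ENNReal.ofReal invArea ≠ 0 := by simpa using invArea_pos
      calc ‖u t j‖ₑ ^ 2 = (ENNReal.ofReal invArea)⁻¹ * (ENNReal.ofReal invArea * ‖u t j‖ₑ ^ 2) := by
            rw [← mul_assoc, ENNReal.inv_mul_cancel h3 ENNReal.ofReal_ne_top, one_mul]
        _ ≤ _ := by gcongr
    refine (lintegral_mono_ae h1).trans_lt ?_
    rw [lintegral_const]
    have h3 : ENNReal.ofReal invArea ≠ 0 := by simpa using invArea_pos
    refine ENNReal.mul_lt_top (ENNReal.mul_lt_top (ENNReal.inv_lt_top.mpr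
      (pos_iff_ne_zero.mpr h3)) ENNReal.ofReal_lt_top) (measure_lt_top _ _)
  have hex : ∀ j, ∃ c : L2T, ∀ᵐ t, t ∈ Ioo 0 T → u t j = c + ∫ s in 0..t, v s j := fun j =>
    exists_ae_eq_const_add_of_weakDeriv hT (huI j).locallyIntegrableOn
      (fun b hb => (hvI j).mono_set (by
        rw [uIcc_of_le hb.1.le, uIcc_of_le hT.le]; exact Icc_subset_Icc_right hb.2.le)) (hvd j)
  choose c hc using hex
  -- The velocity is not assumed continuous in time, so its increments are those of the absolutely
  -- continuous representative `U`, equal to `u` for almost every `t`.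
  refine ⟨fun t j => c j + ∫ s in 0..t, v s j, v, fun j => ⟨hT.le, hvI j, fun t _ => by simp⟩, ?_,
    fun j => intervalIntegrable_of_integrable_Ioo hT.le
      (integrable_norm_sq_of_lintegral (hvm j) (hvj j)), ?_⟩
  · filter_upwards [ae_all_iff.mpr hc] with t ht hm
    funext j
    exact ht j hm
  · have e : ∀ j, ∫ t in 0..T, ‖v t j‖ ^ 2 = (∫⁻ t in Ioo 0 T, ‖v t j‖ₑ ^ 2).toReal := fun j => by
      rw [intervalIntegral.integral_of_le hT.le, integral_Ioc_eq_integral_Ioo,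
        integral_eq_lintegral_of_nonneg_ae (Eventually.of_forall fun t => sq_nonneg _)
          ((hvm j).norm.pow 2)]
      congr 2
      funext t
      rw [ENNReal.ofReal_pow (norm_nonneg _), ofReal_norm]
    simp only [e]
    rw [← ENNReal.toReal_sum fun j _ => (hvj j).ne]
    exact ENNReal.toReal_le_of_le_ofReal (sq_nonneg R) hsum

end Regularity

/-! ### Difference quotients and time averages -/

section Steklov

variable {E : Type*} [NormedAddCommGroup E] [NormedSpace ℝ E]

/-- Jensen's inequality for difference quotients. -/
lemma IsPrimitive.norm_sub_sq_le {W w : ℝ → E} {a b : ℝ} (h : IsPrimitive W w a b)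
    (hw : IntervalIntegrable (fun t => ‖w t‖ ^ 2) volume a b) {t τ : ℝ} (ht : a ≤ t) (hτ : 0 < τ)
    (hb : t + τ ≤ b) : ‖τ⁻¹ • (W (t + τ) - W t)‖ ^ 2 ≤ τ⁻¹ * ∫ s in t..(t + τ), ‖w s‖ ^ 2 := by
  have hle : t ≤ t + τ := by linarith
  have hsub : uIcc t (t + τ) ⊆ uIcc a b := by
    rw [uIcc_of_le hle, uIcc_of_le h.le]; exact Icc_subset_Icc ht hb
  rw [h.sub_eq ⟨ht, hle.trans hb⟩ ⟨ht.trans hle, hb⟩]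
  set m := τ⁻¹ * ∫ s in t..(t + τ), ‖w s‖ with hm
  have i1 : IntervalIntegrable (fun s => ‖w s‖) volume t (t + τ) := (h.integrable.mono_set hsub).norm
  have i2 := hw.mono_set hsub
  have h1 : ‖τ⁻¹ • ∫ s in t..(t + τ), w s‖ ≤ m := by
    rw [norm_smul, Real.norm_of_nonneg (inv_pos.mpr hτ).le, hm]
    exact mul_le_mul_of_nonneg_left (intervalIntegral.norm_integral_le_integral_norm hle)
      (inv_pos.mpr hτ).le
  -- Jensen's inequality obtained from the nonnegativity of the variance of `‖w‖` about its mean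
  -- `m`.
  have h2 : 0 ≤ ∫ s in t..(t + τ), (‖w s‖ - m) ^ 2 :=
    intervalIntegral.integral_nonneg hle fun s _ => sq_nonneg _
  have h3 : ∫ s in t..(t + τ), (‖w s‖ - m) ^ 2
      = (∫ s in t..(t + τ), ‖w s‖ ^ 2) - τ * m ^ 2 := by
    have e : ∀ s, (‖w s‖ - m) ^ 2 = (‖w s‖ ^ 2 - 2 * m * ‖w s‖) + m ^ 2 := fun s => by ring
    simp only [e]
    rw [intervalIntegral.integral_add (i2.sub (i1.const_mul _)) intervalIntegrable_const,
      intervalIntegral.integral_sub i2 (i1.const_mul _), intervalIntegral.integral_const_mul,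
      intervalIntegral.integral_const]
    have : ∫ s in t..(t + τ), ‖w s‖ = τ * m := by rw [hm, mul_inv_cancel_left₀ hτ.ne']
    rw [this, smul_eq_mul]
    ring
  rw [h3] at h2
  calc _ ≤ m ^ 2 := pow_le_pow_left₀ (norm_nonneg _) h1 2
    _ = τ⁻¹ * (τ * m ^ 2) := by rw [inv_mul_cancel_left₀ hτ.ne']
    _ ≤ _ := mul_le_mul_of_nonneg_left (by linarith) (inv_pos.mpr hτ).le

/-- Averaging does not increase the integral of a nonnegative function. -/
lemma integral_average_le {w : ℝ → ℝ} {T τ b : ℝ} (hw : IntervalIntegrable w volume 0 T)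
    (hw0 : ∀ t, 0 ≤ w t) (hτ : 0 < τ) (hb : 0 ≤ b) (hbT : b + τ ≤ T) :
    ContinuousOn (fun t => τ⁻¹ * ∫ s in t..(t + τ), w s) (Icc 0 b) ∧
      ∫ t in 0..b, τ⁻¹ * ∫ s in t..(t + τ), w s ≤ ∫ t in 0..T, w t := by
  have hT : 0 ≤ T := by linarith
  have hP : IsPrimitive (fun t => ∫ s in 0..t, w s) w 0 T := ⟨hT, hw, fun t _ => by simp⟩
  have hc := hP.continuousOn
  have e : ∀ t ∈ Icc 0 b, ∫ s in t..(t + τ), w s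
      = (∫ s in 0..(t + τ), w s) - ∫ s in 0..t, w s := fun t ht =>
    (hP.sub_eq ⟨ht.1, by linarith [ht.2]⟩ ⟨by linarith [ht.1], by linarith [ht.2]⟩).symm
  have c1 : ContinuousOn (fun t => ∫ s in 0..t, w s) (Icc 0 b) :=
    hc.mono (Icc_subset_Icc_right (by linarith))
  have c2 : ContinuousOn (fun t => ∫ s in 0..(t + τ), w s) (Icc 0 b) :=
    hc.comp (f := fun t => t + τ) (by fun_prop) fun t ht => ⟨by linarith [ht.1], by linarith [ht.2]⟩
  refine ⟨(continuousOn_const.mul (c2.sub c1)).congr fun t ht => by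
    rw [e t ht]; rfl, ?_⟩
  have hmono : ∀ {x y}, x ∈ Icc 0 T → y ∈ Icc 0 T → x ≤ y →
      (∫ s in 0..x, w s) ≤ ∫ s in 0..y, w s := fun {x y} hx hy hxy => by
    rw [← sub_nonneg, hP.sub_eq hx hy]
    exact intervalIntegral.integral_nonneg hxy fun s _ => hw0 s
  have ii : ∀ {x y}, x ∈ Icc 0 T → y ∈ Icc 0 T →
      IntervalIntegrable (fun t => ∫ s in 0..t, w s) volume x y := fun {x y} hx hy =>
    (hc.mono (uIcc_subset_Icc hx hy)).intervalIntegrable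
  have h0 : ∫ t in 0..b, τ⁻¹ * ∫ s in t..(t + τ), w s
      = τ⁻¹ * ((∫ t in 0..b, ∫ s in 0..(t + τ), w s) - ∫ t in 0..b, ∫ s in 0..t, w s) := by
    rw [intervalIntegral.integral_const_mul, ← intervalIntegral.integral_sub]
    · congr 1
      refine intervalIntegral.integral_congr fun t ht => ?_
      rw [uIcc_of_le hb] at ht
      exact e t ht
    · exact (c2.mono (by rw [uIcc_of_le hb])).intervalIntegrable
    · exact (c1.mono (by rw [uIcc_of_le hb])).intervalIntegrable
  have h1 := intervalIntegral.integral_comp_add_right (a := 0) (b := b)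
    (fun t => ∫ s in 0..t, w s) τ
  have m0 : (0 : ℝ) ∈ Icc 0 T := ⟨le_rfl, hT⟩
  have mτ : τ ∈ Icc 0 T := ⟨hτ.le, by linarith⟩
  have mb : b ∈ Icc 0 T := ⟨hb, by linarith⟩
  have mbτ : b + τ ∈ Icc 0 T := ⟨by linarith, hbT⟩
  -- Shifting the interval by `τ` changes the integral of the primitive only by its two end pieces;
  -- the left one is nonnegative and the right one is at most `τ` times the total integral.
  have h2 : (∫ t in τ..(b + τ), ∫ s in 0..t, w s) - ∫ t in 0..b, ∫ s in 0..t, w s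
      = (∫ t in b..(b + τ), ∫ s in 0..t, w s) - ∫ t in 0..τ, ∫ s in 0..t, w s := by
    have a1 := intervalIntegral.integral_add_adjacent_intervals (ii m0 mτ) (ii mτ mbτ)
    have a2 := intervalIntegral.integral_add_adjacent_intervals (ii m0 mb) (ii mb mbτ)
    linarith
  have h3 : ∫ t in b..(b + τ), ∫ s in 0..t, w s ≤ τ * ∫ t in 0..T, w t := by
    have := intervalIntegral.integral_mono_on (by linarith : b ≤ b + τ) (ii mb mbτ)
      (intervalIntegrable_const (c := ∫ t in 0..T, w t)) fun t ht =>
      hmono ⟨by linarith [ht.1], by linarith [ht.2]⟩ ⟨hT, le_rfl⟩ (by linarith [ht.2])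
    simpa using this
  have h4 : 0 ≤ ∫ t in 0..τ, ∫ s in 0..t, w s :=
    intervalIntegral.integral_nonneg hτ.le fun t ht =>
      intervalIntegral.integral_nonneg ht.1 fun s _ => hw0 s
  rw [h0, h1, zero_add, h2, inv_mul_le_iff₀ hτ]
  linarith

end Steklov

/-! ### Primitives of difference quotients and of squared norms -/

section Primitives

variable {E : Type*} [NormedAddCommGroup E] [NormedSpace ℝ E] {W w : ℝ → E} {b τ : ℝ}

lemma IsPrimitive.differenceQuotient (h : IsPrimitive W w 0 (b + τ)) (hb : 0 ≤ b) (hτ : 0 < τ) :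
    IsPrimitive (fun t => τ⁻¹ • (W (t + τ) - W t)) (fun t => τ⁻¹ • (w (t + τ) - w t)) 0 b := by
  have i1 : IntervalIntegrable (fun t => w (t + τ)) volume 0 b := by
    have := (h.mono hτ.le (by linarith) le_rfl).integrable.comp_add_right τ
    simpa using this
  have i2 : IntervalIntegrable w volume 0 b := (h.mono le_rfl hb (by linarith)).integrable
  refine ⟨hb, (i1.sub i2).smul _, fun t ht => ?_⟩
  have hs : uIcc 0 t ⊆ uIcc 0 b := by
    rw [uIcc_of_le ht.1, uIcc_of_le hb]; exact Icc_subset_Icc_right ht.2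
  rw [intervalIntegral.integral_smul,
    intervalIntegral.integral_sub (i1.mono_set hs) (i2.mono_set hs),
    intervalIntegral.integral_comp_add_right w τ,
    ← h.sub_eq ⟨by linarith, by linarith⟩ ⟨by linarith [ht.1], by linarith [ht.2]⟩,
    ← h.sub_eq ⟨le_rfl, by linarith⟩ ⟨ht.1, by linarith [ht.2]⟩, ← smul_add]
  congr 1
  abel

/-- The squared norm is Lipschitz on bounded sets, and `W` is bounded on `[0, b]` by continuity. -/
lemma IsPrimitive.norm_sq_clm {F : Type*} [NormedAddCommGroup F] [InnerProductSpace ℝ F]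
    [CompleteSpace E] (h : IsPrimitive W w 0 b) (S : E →L[ℝ] F) :
    IsPrimitive (fun t => ‖S (W t)‖ ^ 2) (fun t => 2 * inner ℝ (S (W t)) (S (w t))) 0 b := by
  obtain ⟨B, hB⟩ := isCompact_Icc.exists_bound_of_continuousOn h.continuousOn
  have hB0 : 0 ≤ B := (norm_nonneg _).trans (hB 0 ⟨le_rfl, h.le⟩)
  refine h.comp_lipschitz (K := ‖S‖ * (2 * (‖S‖ * B))) (fun x hx y hy => ?_) (by positivity) ?_
  · have e : ‖S (W x)‖ ^ 2 - ‖S (W y)‖ ^ 2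
        = (‖S (W x)‖ - ‖S (W y)‖) * (‖S (W x)‖ + ‖S (W y)‖) := by ring
    have h1 : |‖S (W x)‖ - ‖S (W y)‖| ≤ ‖S‖ * ‖W x - W y‖ := by
      refine (abs_norm_sub_norm_le _ _).trans ?_
      rw [← map_sub]
      exact S.le_opNorm _
    have h2 : ∀ z ∈ Icc 0 b, ‖S (W z)‖ ≤ ‖S‖ * B := fun z hz =>
      (S.le_opNorm _).trans (mul_le_mul_of_nonneg_left (hB z hz) (norm_nonneg _))
    rw [e, abs_mul, abs_of_nonneg (add_nonneg (norm_nonneg (S (W x))) (norm_nonneg (S (W y))))]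
    calc _ ≤ (‖S‖ * ‖W x - W y‖) * (2 * (‖S‖ * B)) := by
          gcongr
          linarith [h2 x hx, h2 y hy]
      _ = _ := by ring
  · filter_upwards [h.ae_hasDerivAt] with t ht hm
    exact ((S.hasFDerivAt.comp_hasDerivAt t (ht hm))).norm_sq

lemma ae_shift {p : ℝ → Prop} (h : ∀ᵐ t, p t) (τ : ℝ) : ∀ᵐ t, p (t + τ) :=
  (measurePreserving_add_right volume τ).quasiMeasurePreserving.ae h

end Primitives

/-! ### Uniform energy bounds for the time derivative -/

section Energy

variable {ε T R α : ℝ} {φ : ℝ → ℝ} {u : ℝ → Fin 2 → L2T} {θ₀ : L2T} {θ g : ℝ → L2T}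

lemma Slice.energyConst_nonneg (α R : ℝ) : 0 ≤ Slice.energyConst α R := by
  have := besselSum_nonneg
  unfold Slice.energyConst
  positivity

lemma Slice.norm_quotient_le_dirichlet {u u' : Fin 2 → L2T} {f g f' g' : L2T}
    (h : Slice ε R φ u f g) (h' : Slice ε R φ u' f' g') (τ : ℝ) :
    invArea * ‖τ⁻¹ • (f' - f)‖ ^ 2 ≤ dirichlet (τ⁻¹ • (f' - f)) := by
  set d := τ⁻¹ • (f' - f) with hd
  have hdn : ∀ n, fc d n = (τ⁻¹ : ℝ) * (fc f' n - fc f n) := fun n => by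
    rw [hd, fc_coeFn_smul, fc_coeFn_sub]
  have hd0 : fc d 0 = 0 := by rw [hdn, h.mem.fc_zero, h'.mem.fc_zero]; simp
  have hdH : InH2 (fc d) := by
    have := (h'.mem.inH2.sub h.mem.inH2).const_mul ((τ⁻¹ : ℝ) : ℂ)
    rwa [← funext hdn] at this
  exact invArea_norm_sq_le_dirichlet hdH hd0

/-- Grönwall's inequality for the difference quotients of a solution. -/
lemma Evolution.differenceQuotient_le (hε : ε ∈ Ioc (0 : ℝ) 1) (hα : OneSided α φ) (hT : 0 < T)
    (hu : IsVelocity T R u) (h : Evolution ε T R φ u θ g) {τ b A : ℝ} (hτ : 0 < τ) (hb : 0 ≤ b)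
    (hbT : b + τ < T) (hA : ‖energyMap hε (τ⁻¹ • (θ (0 + τ) - θ 0))‖ ^ 2 ≤ A) :
    (∀ t ∈ Icc 0 b, ‖energyMap hε (τ⁻¹ • (θ (t + τ) - θ t))‖ ^ 2
      ≤ Real.exp (2 * Slice.energyConst α R * T) * (A + 2 * invArea * R ^ 2)) ∧
    ∫ t in 0..b, invArea * ‖τ⁻¹ • (θ (t + τ) - θ t)‖ ^ 2
      ≤ A + 2 * invArea * R ^ 2 + T * (2 * Slice.energyConst α R
        * (Real.exp (2 * Slice.energyConst α R * T) * (A + 2 * invArea * R ^ 2))) := by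
  obtain ⟨U, v, hUv, huU, hv2, hvR⟩ := hu.exists_primitive hT
  have hP := (h.primitive (b + τ) ⟨by linarith, hbT⟩).differenceQuotient hb hτ
  have hF := hP.norm_sq_clm (energyMap hε)
  have hc0 : 0 ≤ 2 * Slice.energyConst α R := mul_nonneg zero_le_two (Slice.energyConst_nonneg α R)
  have hA0 : 0 ≤ A := (sq_nonneg _).trans hA
  have hi0 := invArea_pos.le
  set c := 2 * Slice.energyConst α R with hc
  -- By Jensen, `k` dominates the velocity term of the energy inequality, and its integral is
  -- bounded by `R` alone, uniformly in `τ`.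
  set k : ℝ → ℝ := fun t => 2 * invArea * ∑ j, τ⁻¹ * ∫ s in t..(t + τ), ‖v s j‖ ^ 2 with hk
  have hav := fun j => integral_average_le (hv2 j) (fun t => sq_nonneg ‖v t j‖) hτ hb hbT.le
  have hkI0 : ∀ j, IntervalIntegrable (fun t => τ⁻¹ * ∫ s in t..(t + τ), ‖v s j‖ ^ 2) volume 0 b :=
    fun j => ((hav j).1.mono (by rw [uIcc_of_le hb])).intervalIntegrable
  have hkI : IntervalIntegrable k volume 0 b := by
    have := (IntervalIntegrable.sum Finset.univ fun j _ => hkI0 j).const_mul (2 * invArea)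
    simpa only [Finset.sum_apply] using this
  have hk0 : ∀ t, 0 ≤ k t := fun t => by
    refine mul_nonneg (by positivity) (Finset.sum_nonneg fun j _ => ?_)
    refine mul_nonneg (inv_pos.mpr hτ).le (intervalIntegral.integral_nonneg (by linarith) ?_)
    exact fun s _ => sq_nonneg _
  have hkle : ∫ t in 0..b, k t ≤ 2 * invArea * R ^ 2 := by
    rw [hk, intervalIntegral.integral_const_mul,
      intervalIntegral.integral_finsetSum fun j _ => hkI0 j]
    refine mul_le_mul_of_nonneg_left ((Finset.sum_le_sum fun j _ => (hav j).2).trans hvR)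
      (by positivity)
  have hineq : ∀ᵐ t, t ∈ Ioo 0 b →
      2 * inner ℝ (energyMap hε (τ⁻¹ • (θ (t + τ) - θ t))) (energyMap hε (τ⁻¹ • (g (t + τ) - g t)))
        + invArea * ‖τ⁻¹ • (θ (t + τ) - θ t)‖ ^ 2
      ≤ c * ‖energyMap hε (τ⁻¹ • (θ (t + τ) - θ t))‖ ^ 2 + k t := by
    filter_upwards [h.slice, ae_shift h.slice τ, huU, ae_shift huU τ] with t s1 s2 e1 e2 hm
    have m1 : t ∈ Ioo 0 T := ⟨hm.1, by linarith [hm.2]⟩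
    have m2 : t + τ ∈ Ioo 0 T := ⟨by linarith [hm.1], by linarith [hm.2]⟩
    have q1 := s1 m1
    have q2 := s2 m2
    have hen := Slice.energy_inequality hα hε q1 q2 hτ
    rw [e1 m1, e2 m2] at hen
    have hJ : 2 * invArea * ∑ j, ‖τ⁻¹ • (U (t + τ) j - U t j)‖ ^ 2 ≤ k t :=
      mul_le_mul_of_nonneg_left (Finset.sum_le_sum fun j _ =>
        (hUv j).norm_sub_sq_le (hv2 j) m1.1.le hτ (by linarith [hm.2])) (by positivity)
    have := q1.norm_quotient_le_dirichlet q2 τ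
    linarith
  have hgr := hF.gronwall hc0 hkI hk0 (by
    filter_upwards [hineq] with t ht hm
    have := ht hm
    have h0 : 0 ≤ invArea * ‖τ⁻¹ • (θ (t + τ) - θ t)‖ ^ 2 := by positivity
    linarith)
  have hbd : ∀ t ∈ Icc 0 b, ‖energyMap hε (τ⁻¹ • (θ (t + τ) - θ t))‖ ^ 2
      ≤ Real.exp (c * T) * (A + 2 * invArea * R ^ 2) := fun t ht => by
    refine (hgr t ht).trans ?_
    have hkt : ∫ s in 0..t, k s ≤ ∫ s in 0..b, k s :=
      intervalIntegral.integral_mono_interval le_rfl ht.1 ht.2 (Eventually.of_forall hk0) hkI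
    have h1 : c * t ≤ c * T := mul_le_mul_of_nonneg_left (by linarith [ht.2]) hc0
    refine mul_le_mul (Real.exp_le_exp.mpr h1) (by linarith) ?_ (Real.exp_pos _).le
    exact add_nonneg (sq_nonneg _) (intervalIntegral.integral_nonneg ht.1 fun s _ => hk0 s)
  refine ⟨hbd, ?_⟩
  set CF := Real.exp (c * T) * (A + 2 * invArea * R ^ 2) with hCF
  have hCF0 : 0 ≤ CF := by positivity
  have hWc : ContinuousOn (fun t => invArea * ‖τ⁻¹ • (θ (t + τ) - θ t)‖ ^ 2) (uIcc 0 b) := by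
    rw [uIcc_of_le hb]
    exact continuousOn_const.mul (hP.continuousOn.norm.pow 2)
  -- The energy inequality is integrated once more, now keeping the dissipation. The total
  -- derivative integrates to the difference of the energies at the two ends, and the one at `b` is
  -- dropped.
  have hint : ∫ t in 0..b, invArea * ‖τ⁻¹ • (θ (t + τ) - θ t)‖ ^ 2
      ≤ ∫ t in 0..b, (c * CF + k t - 2 * inner ℝ (energyMap hε (τ⁻¹ • (θ (t + τ) - θ t)))
        (energyMap hε (τ⁻¹ • (g (t + τ) - g t)))) := by
    apply intervalIntegral.integral_mono_ae_restrict hb hWc.intervalIntegrable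
      ((intervalIntegrable_const.add hkI).sub hF.integrable)
    rw [EventuallyLE, ae_restrict_iff' measurableSet_Icc]
    have := ae_Ioo_imp_uIcc hb hineq
    rw [uIcc_of_le hb] at this
    filter_upwards [this] with t h1 hm
    have h2 := h1 hm
    have h3 := mul_le_mul_of_nonneg_left (hbd t hm) hc0
    change invArea * _ ≤ c * CF + k t - 2 * _
    linarith
  refine hint.trans ?_
  rw [intervalIntegral.integral_sub (intervalIntegrable_const.add hkI) hF.integrable,
    intervalIntegral.integral_add intervalIntegrable_const hkI,
    ← hF.sub_eq (left_mem_Icc.mpr hb) (right_mem_Icc.mpr hb), intervalIntegral.integral_const,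
    smul_eq_mul, sub_zero]
  have h1 : b * (c * CF) ≤ T * (c * CF) :=
    mul_le_mul_of_nonneg_right (by linarith) (mul_nonneg hc0 hCF0)
  have h2 : 0 ≤ ‖energyMap hε (τ⁻¹ • (θ (b + τ) - θ b))‖ ^ 2 := sq_nonneg _
  linarith

/-- The initial size of the time derivative. -/
def initialBound (M R : ℝ) : ℝ := 2 * (2 * (1 + M ^ 2)) + 8 * R ^ 2

/-- A parallelogram-type bound near the initial datum. The factor `2 (1 + M²)` depends on neither
`ε` nor the solution. -/
lemma weightedSq_le_of_phaseDist (hε : ε ∈ Ioc (0 : ℝ) 1) {M : ℝ} {f f' : L2T}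
    (h0 : phaseNormSq ε φ f ≤ ENNReal.ofReal (M ^ 2)) (h1 : phaseDistSq ε φ f' f ≤ 1) :
    Slice.weightedSq ε (varphiCoef ε φ f') ≤ ENNReal.ofReal (2 * (1 + M ^ 2)) := by
  have a1 : Slice.weightedSq ε (fun n => varphiCoef ε φ f' n - varphiCoef ε φ f n) ≤ 1 := by
    refine le_trans ?_ h1
    rw [phaseDistSq, Slice.weightedSq, add_assoc]
    exact le_add_self
  have a0 : Slice.weightedSq ε (varphiCoef ε φ f) ≤ ENNReal.ofReal (M ^ 2) := by
    refine le_trans ?_ h0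
    rw [phaseNormSq, Slice.weightedSq, add_assoc]
    exact le_add_self
  have e : ENNReal.ofReal (2 * (1 + M ^ 2)) = 2 * (1 + ENNReal.ofReal (M ^ 2)) := by
    rw [ENNReal.ofReal_mul zero_le_two, ENNReal.ofReal_add zero_le_one (sq_nonneg _)]
    simp
  rw [e]
  refine le_trans ?_ (mul_le_mul_right (add_le_add a1 a0) 2)
  simp only [Slice.weightedSq_eq hε.1.le]
  rw [← ENNReal.tsum_add, ← ENNReal.tsum_mul_left]
  refine ENNReal.tsum_le_tsum fun n => ?_
  have hs := (symb_pos hε n).le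
  have e2 : ∀ x : ℝ, 2 * ENNReal.ofReal x = ENNReal.ofReal (2 * x) := fun x => by
    rw [ENNReal.ofReal_mul zero_le_two]; simp
  rw [← ENNReal.ofReal_add (by positivity) (by positivity), e2]
  apply ENNReal.ofReal_le_ofReal
  have h2 : ‖varphiCoef ε φ f' n‖ ^ 2 ≤ 2 * (‖varphiCoef ε φ f' n - varphiCoef ε φ f n‖ ^ 2
      + ‖varphiCoef ε φ f n‖ ^ 2) := by
    have := norm_add_le (varphiCoef ε φ f' n - varphiCoef ε φ f n) (varphiCoef ε φ f n)
    rw [sub_add_cancel] at this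
    nlinarith [norm_nonneg (varphiCoef ε φ f' n),
      sq_nonneg (‖varphiCoef ε φ f' n - varphiCoef ε φ f n‖ - ‖varphiCoef ε φ f n‖)]
  nlinarith [mul_le_mul_of_nonneg_left h2 hs]

/-- Continuity in the phase space keeps `varphiCoef` bounded on a short time interval, and there the
equation bounds the energy of `∂ₜθ` for almost every time. The difference quotient at `0` is an
average of `∂ₜθ`. The length `h₀` may depend on the solution; the bound does not. -/
lemma Evolution.initial_le (hε : ε ∈ Ioc (0 : ℝ) 1) (hT : 0 < T) {M : ℝ}
    (hw : IsWeakSolution ε T φ u θ₀ θ) (h0 : phaseNormSq ε φ θ₀ ≤ ENNReal.ofReal (M ^ 2))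
    (h : Evolution ε T R φ u θ g) :
    ∃ h₀ > 0, ∀ τ ∈ Ioo 0 h₀, ‖energyMap hε (τ⁻¹ • (θ (0 + τ) - θ 0))‖ ^ 2 ≤ initialBound M R := by
  have hB0 : 0 ≤ initialBound M R := by unfold initialBound; positivity
  have hc := hw.continuous 0 ⟨le_rfl, hT⟩
  have hev : ∀ᶠ s in 𝓝[Ico 0 T] 0, phaseDistSq ε φ (θ s) (θ 0) ≤ 1 :=
    (hc.eventually (gt_mem_nhds one_pos)).mono fun s hs => hs.le
  rw [nhdsWithin, eventually_inf_principal, Metric.eventually_nhds_iff] at hev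
  obtain ⟨r, hr, hev⟩ := hev
  refine ⟨min r T, lt_min hr hT, fun τ hτ => ?_⟩
  have hτr : τ < r := hτ.2.trans_le (min_le_left _ _)
  have hτT : τ < T := hτ.2.trans_le (min_le_right _ _)
  have hP := h.primitive τ ⟨hτ.1, hτT⟩
  rw [zero_add, hP.sub_eq (left_mem_Icc.mpr hτ.1.le) (right_mem_Icc.mpr hτ.1.le), map_smul,
    ← (energyMap hε).intervalIntegral_comp_comm hP.integrable, norm_smul, mul_pow]
  have hle : ‖∫ s in 0..τ, energyMap hε (g s)‖ ≤ √(initialBound M R) * |τ - 0| := by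
    apply intervalIntegral.norm_integral_le_of_norm_le_const_ae
    filter_upwards [ae_Ioo_imp_uIcc hτ.1.le (p := fun s => ‖energyMap hε (g s)‖
      ≤ √(initialBound M R)) (by
        filter_upwards [h.slice] with s hs hm
        have q := hs ⟨hm.1, hm.2.trans hτT⟩
        have d := hev (y := s) (by
          rw [Real.dist_eq, sub_zero, abs_of_pos hm.1]; exact hm.2.trans hτr)
          ⟨hm.1.le, hm.2.trans hτT⟩
        rw [hw.initial] at d
        exact Real.le_sqrt_of_sq_le (Slice.norm_energyMap_deriv_sq_le hε q (by positivity)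
          (weightedSq_le_of_phaseDist hε h0 d)))] with s hs hm
    exact hs (uIoc_subset_uIcc hm)
  rw [sub_zero, abs_of_pos hτ.1] at hle
  calc ‖τ⁻¹‖ ^ 2 * ‖∫ s in 0..τ, energyMap hε (g s)‖ ^ 2
      ≤ ‖τ⁻¹‖ ^ 2 * (√(initialBound M R) * τ) ^ 2 := by gcongr
    _ = initialBound M R := by
      rw [mul_pow, Real.sq_sqrt hB0, Real.norm_of_nonneg (inv_pos.mpr hτ.1).le]
      have := hτ.1.ne'
      field_simp

/-- A bound for the energy of the time derivative. -/
def derivBound (α T M R : ℝ) : ℝ :=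
  Real.exp (2 * Slice.energyConst α R * T) * (initialBound M R + 2 * invArea * R ^ 2)

/-- A bound for the dissipation of the time derivative. -/
def dissipationBound (α T M R : ℝ) : ℝ :=
  initialBound M R + 2 * invArea * R ^ 2 + T * (2 * Slice.energyConst α R * derivBound α T M R)

/-- Let `τ → 0` in the quotient estimates. As a primitive, `θ` is differentiable almost everywhere
with derivative `g`, so the pointwise bound passes to the limit and the integral bound follows from
Fatou's lemma. -/
lemma Evolution.energy_le (hε : ε ∈ Ioc (0 : ℝ) 1) (hα : OneSided α φ) (hT : 0 < T) {M : ℝ}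
    (hu : IsVelocity T R u) (hw : IsWeakSolution ε T φ u θ₀ θ)
    (h0 : phaseNormSq ε φ θ₀ ≤ ENNReal.ofReal (M ^ 2)) (h : Evolution ε T R φ u θ g) :
    (∀ᵐ t, t ∈ Ioo 0 T → ‖energyMap hε (g t)‖ ^ 2 ≤ derivBound α T M R) ∧
    ∀ b ∈ Ioo 0 T, ∫⁻ t in Ioo 0 b, ENNReal.ofReal (invArea * ‖g t‖ ^ 2)
      ≤ ENNReal.ofReal (dissipationBound α T M R) := by
  obtain ⟨h₀, hh0, hinit⟩ := h.initial_le hε hT hw h0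
  have hquot := fun (b : ℝ) (hb : b ∈ Ioo 0 T) (τ : ℝ) (hτ : τ ∈ Ioo 0 (min h₀ (T - b))) =>
    h.differenceQuotient_le hε hα hT hu hτ.1 hb.1.le
      (by linarith [hτ.2.trans_le (min_le_right _ _)])
      (hinit τ ⟨hτ.1, hτ.2.trans_le (min_le_left _ _)⟩)
  have hder : ∀ b ∈ Ioo 0 T, ∀ᵐ t, t ∈ Ioo 0 b → HasDerivAt θ (g t) t := fun b hb =>
    (h.primitive b hb).ae_hasDerivAt
  have hsmall : ∀ b ∈ Ioo 0 T, Ioo 0 (min h₀ (T - b)) ∈ 𝓝[>] (0 : ℝ) := fun b hb =>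
    Ioo_mem_nhdsGT (lt_min hh0 (by linarith [hb.2]))
  constructor
  -- The quotient at `t` needs room up to `T`, so the bound is proved on countably many intervals
  -- exhausting `(0, T)`; countability preserves "almost everywhere".
  · have hall : ∀ k : ℕ, ∀ᵐ t, t ∈ Ioo 0 (T - T / (k + 2)) →
        ‖energyMap hε (g t)‖ ^ 2 ≤ derivBound α T M R := fun k => by
      have hk : (0 : ℝ) < k + 2 := by positivity
      have hb : T - T / (k + 2) ∈ Ioo 0 T := by
        have h1 : T / (k + 2) < T := by
          rw [div_lt_iff₀ hk]
          nlinarith [(Nat.cast_nonneg k : (0 : ℝ) ≤ k)]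
        have h2 : 0 < T / (k + 2) := by positivity
        exact ⟨by linarith, by linarith⟩
      filter_upwards [hder _ hb] with t ht hm
      have hlim := (ht hm).tendsto_slope_zero_right
      have hlim2 := (((energyMap hε).continuous.tendsto _).comp hlim).norm.pow 2
      refine le_of_tendsto hlim2 ?_
      filter_upwards [hsmall _ hb] with τ hτ
      exact (hquot _ hb τ hτ).1 t ⟨hm.1.le, hm.2.le⟩
    filter_upwards [ae_all_iff.mpr hall] with t ht hm
    obtain ⟨k, hk⟩ := exists_nat_gt (T / (T - t))
    have hTt : 0 < T - t := sub_pos.mpr hm.2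
    refine ht k ⟨hm.1, ?_⟩
    rw [div_lt_iff₀ hTt] at hk
    have : T / (k + 2) < T - t := by
      rw [div_lt_iff₀ (by positivity)]
      nlinarith
    linarith
  · intro b hb
    have hlimτ : Tendsto (fun k : ℕ => (1 : ℝ) / ((k : ℝ) + 1)) atTop (𝓝[>] 0) := by
      refine tendsto_nhdsWithin_iff.mpr ⟨tendsto_one_div_add_atTop_nhds_zero_nat, ?_⟩
      exact Eventually.of_forall fun k => by simp only [mem_Ioi]; positivity
    obtain ⟨N, hN⟩ := eventually_atTop.mp (hlimτ.eventually (hsmall b hb))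
    set τ : ℕ → ℝ := fun k => 1 / (((k + N : ℕ) : ℝ) + 1) with hτdef
    have hτ : ∀ k, τ k ∈ Ioo 0 (min h₀ (T - b)) := fun k => hN (k + N) (by omega)
    have hτ0 : Tendsto τ atTop (𝓝[>] 0) := hlimτ.comp (tendsto_add_atTop_nat N)
    have hcont : ∀ k, ContinuousOn
        (fun t => invArea * ‖(τ k)⁻¹ • (θ (t + τ k) - θ t)‖ ^ 2) (Icc 0 b) := fun k => by
      have hk := hτ k
      have := ((h.primitive (b + τ k) ⟨by linarith [hk.1, hb.1],
        by linarith [hk.2.trans_le (min_le_right _ _)]⟩).differenceQuotient hb.1.le hk.1).continuousOn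
      exact continuousOn_const.mul (this.norm.pow 2)
    have hfat : ∫⁻ t in Ioo 0 b, ENNReal.ofReal (invArea * ‖g t‖ ^ 2)
        ≤ ∫⁻ t in Ioo 0 b, liminf (fun k => ENNReal.ofReal
          (invArea * ‖(τ k)⁻¹ • (θ (t + τ k) - θ t)‖ ^ 2)) atTop := by
      refine lintegral_mono_ae ?_
      rw [ae_restrict_iff' measurableSet_Ioo]
      filter_upwards [hder b hb] with t ht hm
      have hlim := (((ht hm).tendsto_slope_zero_right.comp hτ0).norm.pow 2).const_mul invArea
      exact ((ENNReal.continuous_ofReal.tendsto _).comp hlim).liminf_eq.ge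
    refine hfat.trans ((lintegral_liminf_le' fun k => ?_).trans ?_)
    · exact (((hcont k).mono Ioo_subset_Icc_self).aestronglyMeasurable
        measurableSet_Ioo).aemeasurable.ennreal_ofReal
    · refine liminf_le_of_le (by isBoundedDefault) fun a ha => ?_
      obtain ⟨k, hk⟩ := ha.exists
      refine hk.trans ?_
      have hI : IntegrableOn (fun t => invArea * ‖(τ k)⁻¹ • (θ (t + τ k) - θ t)‖ ^ 2) (Ioo 0 b) :=
        ((hcont k).integrableOn_compact isCompact_Icc).mono_set Ioo_subset_Icc_self
      rw [← ofReal_integral_eq_lintegral_ofReal hI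
        (Eventually.of_forall fun t => mul_nonneg invArea_pos.le (sq_nonneg _))]
      apply ENNReal.ofReal_le_ofReal
      have := (hquot b hb (τ k) (hτ k)).2
      rw [intervalIntegral.integral_of_le hb.1.le, integral_Ioc_eq_integral_Ioo] at this
      exact this

end Energy

/-! ### The squared norm of the positive part -/

section PosPart

/-- The function `x ↦ x₊²` has a 2-Lipschitz derivative, so its Taylor remainder is quadratic. A
remainder of this form can be integrated over the torus. -/
lemma abs_posPart_sq_sub_le (x h : ℝ) :
    |max (x + h) 0 ^ 2 - max x 0 ^ 2 - 2 * (max x 0 * h)| ≤ h ^ 2 := by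
  rw [abs_le]
  rcases le_total x 0 with hx | hx <;> rcases le_total (x + h) 0 with hy | hy <;>
    simp only [max_eq_left, max_eq_right, hx, hy] <;> constructor <;> nlinarith

lemma hasDerivAt_posPart_sq (x : ℝ) :
    HasDerivAt (fun x : ℝ => max x 0 ^ 2) (2 * max x 0) x := by
  rw [hasDerivAt_iff_isLittleO_nhds_zero]
  have h1 : (fun h : ℝ => max (x + h) 0 ^ 2 - max x 0 ^ 2 - h • (2 * max x 0))
      =O[𝓝 0] fun h : ℝ => h ^ 2 := by
    refine Asymptotics.IsBigO.of_bound 1 (Eventually.of_forall fun h => ?_)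
    rw [Real.norm_eq_abs, Real.norm_eq_abs, abs_of_nonneg (sq_nonneg h), one_mul, smul_eq_mul]
    have := abs_posPart_sq_sub_le x h
    rwa [show h * (2 * max x 0) = 2 * (max x 0 * h) by ring]
  exact h1.trans_isLittleO (Asymptotics.isLittleO_pow_id one_lt_two)

lemma norm_posPart_sq (f : L2T) : ‖Lp.posPart f‖ ^ 2 = ∫ x, max (f x) 0 ^ 2 := by
  rw [norm_L2_sq]
  refine integral_congr_ae ?_
  filter_upwards [Lp.coeFn_posPart f] with x hx
  rw [hx]

lemma abs_norm_posPart_sq_sub_le (f h : L2T) :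
    |‖Lp.posPart (f + h)‖ ^ 2 - ‖Lp.posPart f‖ ^ 2 - 2 * inner ℝ (Lp.posPart f) h| ≤ ‖h‖ ^ 2 := by
  have i1 := (Lp.memLp (Lp.posPart (f + h))).integrable_sq
  have i2 := (Lp.memLp (Lp.posPart f)).integrable_sq
  have i3 := (L2.integrable_inner (𝕜 := ℝ) (Lp.posPart f) h).const_mul 2
  have i12 : Integrable (fun x => Lp.posPart (f + h) x ^ 2 - Lp.posPart f x ^ 2) := i1.sub i2
  have e : ‖Lp.posPart (f + h)‖ ^ 2 - ‖Lp.posPart f‖ ^ 2 - 2 * inner ℝ (Lp.posPart f) h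
      = ∫ x, (Lp.posPart (f + h) x ^ 2 - Lp.posPart f x ^ 2
        - 2 * inner ℝ (Lp.posPart f x) (h x)) := by
    rw [integral_sub i12 i3, integral_sub i1 i2, integral_const_mul, norm_L2_sq,
      norm_L2_sq, L2.inner_def]
  rw [e, norm_L2_sq h]
  refine (abs_integral_le_integral_abs).trans (integral_mono_ae (i12.sub i3).abs
    (Lp.memLp h).integrable_sq ?_)
  filter_upwards [Lp.coeFn_posPart f, Lp.coeFn_posPart (f + h), Lp.coeFn_add f h] with x h1 h2 h3
  have := abs_posPart_sq_sub_le (f x) (h x)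
  rw [h1, h2, h3, Pi.add_apply]
  simpa [mul_comm] using this

/-- Integrating the pointwise quadratic remainder gives Fréchet differentiability directly on `L²`,
although `f ↦ f₊` itself is only Lipschitz there. -/
lemma hasFDerivAt_norm_posPart_sq (f : L2T) :
    HasFDerivAt (fun f : L2T => ‖Lp.posPart f‖ ^ 2) ((2 : ℝ) • innerSL ℝ (Lp.posPart f)) f := by
  rw [hasFDerivAt_iff_isLittleO_nhds_zero]
  have h1 : (fun h : L2T => ‖Lp.posPart (f + h)‖ ^ 2 - ‖Lp.posPart f‖ ^ 2
      - ((2 : ℝ) • innerSL ℝ (Lp.posPart f)) h) =O[𝓝 0] fun h : L2T => ‖h‖ ^ 2 := by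
    refine Asymptotics.IsBigO.of_bound 1 (Eventually.of_forall fun h => ?_)
    rw [Real.norm_eq_abs, Real.norm_eq_abs, abs_of_nonneg (sq_nonneg ‖h‖), one_mul]
    exact abs_norm_posPart_sq_sub_le f h
  refine h1.trans_isLittleO ?_
  exact Asymptotics.isLittleO_norm_pow_id one_lt_two

lemma dist_posPart_le (f g : L2T) : ‖Lp.posPart f - Lp.posPart g‖ ≤ ‖f - g‖ := by
  refine Lp.norm_le_norm_of_ae_le ?_
  filter_upwards [Lp.coeFn_posPart f, Lp.coeFn_posPart g, Lp.coeFn_sub f g,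
    Lp.coeFn_sub (Lp.posPart f) (Lp.posPart g)] with x h1 h2 h3 h4
  rw [h4, h3, Pi.sub_apply, Pi.sub_apply, h1, h2]
  exact abs_max_sub_max_le_abs _ _ _

variable {b : ℝ}

lemma IsPrimitive.norm_posPart_sq {W w : ℝ → L2T} (h : IsPrimitive W w 0 b) :
    IsPrimitive (fun t => ‖Lp.posPart (W t)‖ ^ 2) (fun t => 2 * inner ℝ (Lp.posPart (W t)) (w t))
      0 b := by
  obtain ⟨B, hB⟩ := isCompact_Icc.exists_bound_of_continuousOn h.continuousOn
  have hB0 : 0 ≤ B := (norm_nonneg _).trans (hB 0 ⟨le_rfl, h.le⟩)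
  have hpos : ∀ f : L2T, ‖Lp.posPart f‖ ≤ ‖f‖ := fun f => by
    refine Lp.norm_le_norm_of_ae_le ?_
    filter_upwards [Lp.coeFn_posPart f] with x hx
    rw [hx, Real.norm_of_nonneg (le_max_right _ _)]
    exact max_le (le_abs_self _) (abs_nonneg _)
  refine h.comp_lipschitz (K := 2 * B) (fun x hx y hy => ?_) (by positivity) ?_
  · have e : ‖Lp.posPart (W x)‖ ^ 2 - ‖Lp.posPart (W y)‖ ^ 2
        = (‖Lp.posPart (W x)‖ - ‖Lp.posPart (W y)‖)
          * (‖Lp.posPart (W x)‖ + ‖Lp.posPart (W y)‖) := by ring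
    rw [e, abs_mul, abs_of_nonneg (add_nonneg (norm_nonneg (Lp.posPart (W x)))
      (norm_nonneg (Lp.posPart (W y)))), mul_comm]
    gcongr
    · linarith [(hpos (W x)).trans (hB x hx), (hpos (W y)).trans (hB y hy)]
    · exact (abs_norm_sub_norm_le _ _).trans (dist_posPart_le _ _)
  · filter_upwards [h.ae_hasDerivAt] with t ht hm
    exact (hasFDerivAt_norm_posPart_sq (W t)).comp_hasDerivAt t (ht hm)

lemma IsPrimitive.posPart_sq {W w : ℝ → ℝ} (h : IsPrimitive W w 0 b) :
    IsPrimitive (fun t => max (W t) 0 ^ 2) (fun t => 2 * max (W t) 0 * w t) 0 b := by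
  obtain ⟨B, hB⟩ := isCompact_Icc.exists_bound_of_continuousOn h.continuousOn
  have hB0 : 0 ≤ B := (norm_nonneg _).trans (hB 0 ⟨le_rfl, h.le⟩)
  have hpos : ∀ x ∈ Icc 0 b, max (W x) 0 ≤ B := fun x hx =>
    max_le ((le_abs_self _).trans (hB x hx)) hB0
  refine h.comp_lipschitz (K := 2 * B) (fun x hx y hy => ?_) (by positivity) ?_
  · have e : max (W x) 0 ^ 2 - max (W y) 0 ^ 2
        = (max (W x) 0 - max (W y) 0) * (max (W x) 0 + max (W y) 0) := by ring
    rw [e, abs_mul, abs_of_nonneg (add_nonneg (le_max_right (W x) 0) (le_max_right (W y) 0)),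
      mul_comm]
    gcongr
    · linarith [hpos x hx, hpos y hy]
    · exact abs_max_sub_max_le_abs _ _ _
  · filter_upwards [h.ae_hasDerivAt] with t ht hm
    exact (hasDerivAt_posPart_sq (W t)).comp t (ht hm)

end PosPart

/-! ### The ordinary differential equation of the barrier -/

section Barrier

variable {ε T a b y₀ : ℝ} {φ H : ℝ → ℝ}

/-- A primitive cannot cross a level above which its derivative is nonpositive. -/
lemma IsPrimitive.le_of_deriv_nonpos {y w : ℝ → ℝ} {T c : ℝ} (h : IsPrimitive y w 0 T)
    (h0 : y 0 ≤ c) (hw : ∀ t ∈ Icc 0 T, c < y t → w t ≤ 0) : ∀ t ∈ Icc 0 T, y t ≤ c := by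
  have hP : IsPrimitive (fun t => y t - c) w 0 T :=
    ⟨h.le, h.integrable, fun t ht => by rw [h.eq t ht]; ring⟩
  intro t ht
  -- The square of `(y - c)₊` starts at zero and has nonpositive derivative, so Grönwall with zero
  -- constants applies.
  have hg := hP.posPart_sq.gronwall (c := 0) (k := fun _ => 0) le_rfl intervalIntegrable_const
    (fun _ => le_rfl) (Eventually.of_forall fun s hs => by
      rw [zero_mul, zero_add]
      rcases le_or_gt (y s) c with h1 | h1
      · rw [max_eq_right (by linarith)]; simp
      · exact mul_nonpos_of_nonneg_of_nonpos (mul_nonneg zero_le_two (le_max_right _ _))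
          (hw s (Ioo_subset_Icc_self hs) h1)) t ht
  rw [max_eq_right (by linarith : y 0 - c ≤ 0)] at hg
  have h2 : max (y t - c) 0 ^ 2 ≤ 0 := by simpa using hg
  have h3 : max (y t - c) 0 = 0 := by
    exact pow_eq_zero_iff two_ne_zero |>.mp (le_antisymm h2 (sq_nonneg _))
  linarith [le_max_left (y t - c) 0]

lemma IsPrimitive.neg {E : Type*} [NormedAddCommGroup E] [NormedSpace ℝ E] {W w : ℝ → E} {a b : ℝ}
    (h : IsPrimitive W w a b) : IsPrimitive (fun t => -W t) (fun t => -w t) a b :=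
  ⟨h.le, h.integrable.neg, fun t ht => by rw [h.eq t ht, intervalIntegral.integral_neg, neg_add]⟩

/-- The solution of `ε y' + φ(y) = H`. -/
lemma exists_barrier (hε : 0 < ε) (hT : 0 ≤ T) (hab : a ≤ b) {K : NNReal}
    (hφ : LipschitzOnWith K φ (Icc a b)) (hH : IntervalIntegrable H volume 0 T)
    (ha : ∀ t, φ a ≤ H t) (hb : ∀ t, H t ≤ φ b) (hy : y₀ ∈ Icc a b) :
    ∃ y : ℝ → ℝ, IsPrimitive y (fun t => ε⁻¹ * (H t - φ (y t))) 0 T ∧ y 0 = y₀ ∧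
      ∀ t ∈ Icc 0 T, y t ∈ Icc a b := by
  -- Freezing `φ` outside `[a, b]` makes it globally Lipschitz and bounded, so the solution exists
  -- on all of `[0, T]`.
  set G : ℝ → ℝ := fun x => φ (projIcc a b hab x) with hG
  have hGL : LipschitzWith K G := by
    have h1 : LipschitzWith K ((Icc a b).domRestrict φ) := hφ.to_restrict
    have := h1.comp (LipschitzWith.projIcc hab)
    rw [mul_one] at this
    exact this
  obtain ⟨B, hB⟩ := isCompact_Icc.exists_bound_of_continuousOn hφ.continuousOn
  have hGB : ∀ x, |G x| ≤ B := fun x => hB _ (projIcc a b hab x).2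
  have hB0 : 0 ≤ B := (abs_nonneg _).trans (hGB 0)
  have hPH : IsPrimitive (fun t => ∫ s in 0..t, ε⁻¹ * H s) (fun s => ε⁻¹ * H s) 0 T :=
    ⟨hT, hH.const_mul _, fun t _ => by simp⟩
  set P : ℝ → ℝ := fun t => ∫ s in 0..t, ε⁻¹ * H s with hPdef
  -- `H` is only integrable in time. Subtracting its primitive, `z = y - P`, leaves a vector field
  -- continuous in `t`, as Picard–Lindelöf requires.
  set f : ℝ → ℝ → ℝ := fun t z => -(ε⁻¹ * G (z + P t)) with hf
  have hei : 0 ≤ ε⁻¹ := (inv_pos.mpr hε).le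
  let L : NNReal := ⟨ε⁻¹ * B, mul_nonneg hei hB0⟩
  let A : NNReal := ⟨ε⁻¹ * B * T, mul_nonneg (mul_nonneg hei hB0) hT⟩
  let ei : NNReal := ⟨ε⁻¹, hei⟩
  have hpic : IsPicardLindelof f (⟨0, le_rfl, hT⟩ : Icc (0 : ℝ) T) y₀ A 0 L (ei * K) := by
    refine ⟨fun t ht => ?_, fun x _ => ?_, fun t ht x _ => ?_, ?_⟩
    · refine LipschitzWith.lipschitzOnWith (LipschitzWith.of_dist_le_mul fun x y => ?_)
      have h1 := hGL.dist_le_mul (x + P t) (y + P t)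
      rw [dist_add_right] at h1
      rw [hf, dist_neg_neg, Real.dist_eq, ← mul_sub, abs_mul, abs_of_nonneg hei,
        NNReal.coe_mul, mul_assoc]
      exact mul_le_mul_of_nonneg_left h1 hei
    · exact ((hGL.continuous.comp_continuousOn
        (continuousOn_const.add hPH.continuousOn)).const_smul ε⁻¹).neg
    · rw [hf, norm_neg, Real.norm_eq_abs, abs_mul, abs_of_nonneg hei]
      exact mul_le_mul_of_nonneg_left (hGB _) hei
    · simp only [sub_zero, sub_self, NNReal.coe_zero]
      rw [max_eq_left hT]
      exact le_rfl
  obtain ⟨z, hz0, hz⟩ := hpic.exists_eq_forall_mem_Icc_hasDerivWithinAt₀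
  simp only [hf] at hz hz0
  have hzc : ContinuousOn z (Icc 0 T) := fun t ht => (hz t ht).continuousWithinAt
  have hGc : ContinuousOn (fun t => ε⁻¹ * G (z t + P t)) (Icc 0 T) :=
    (hGL.continuous.comp_continuousOn (hzc.add hPH.continuousOn)).const_smul ε⁻¹
  have hGi : IntervalIntegrable (fun t => ε⁻¹ * G (z t + P t)) volume 0 T :=
    (hGc.mono (by rw [uIcc_of_le hT])).intervalIntegrable
  set y : ℝ → ℝ := fun t => z t + P t with hydef
  have hP0 : P 0 = 0 := by simp [hPdef]
  have hy0 : y 0 = y₀ := by rw [hydef]; simp only [hP0, hz0, add_zero]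
  have hyP : IsPrimitive y (fun t => ε⁻¹ * (H t - G (y t))) 0 T := by
    refine ⟨hT, ((hH.const_mul ε⁻¹).sub hGi).congr (fun t _ => by ring), fun t ht => ?_⟩
    have hs : uIcc 0 t ⊆ uIcc 0 T := by
      rw [uIcc_of_le ht.1, uIcc_of_le hT]; exact Icc_subset_Icc_right ht.2
    rw [hy0]
    simp only [mul_sub]
    rw [intervalIntegral.integral_sub ((hH.const_mul ε⁻¹).mono_set hs) (hGi.mono_set hs)]
    change z t + P t = _
    have hI := intervalIntegral.integral_eq_sub_of_hasDerivAt_of_le ht.1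
      (hzc.mono (Icc_subset_Icc_right ht.2)) (fun s hs => (hz s ⟨hs.1.le, hs.2.le.trans ht.2⟩).hasDerivAt
        (Icc_mem_nhds hs.1 (hs.2.trans_le ht.2))) (hGi.mono_set hs).neg
    rw [intervalIntegral.integral_neg, hz0] at hI
    change z t + P t = _ + (P t - _)
    linarith
  -- Above `b` the frozen nonlinearity equals `φ b ≥ H`, so `y` cannot increase there; likewise
  -- below `a`. Hence `y` stays in `[a, b]`, where the truncation is inactive.
  have hle : ∀ t ∈ Icc 0 T, y t ≤ b := hyP.le_of_deriv_nonpos (hy0.trans_le hy.2)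
    fun t _ hb' => by
      refine mul_nonpos_of_nonneg_of_nonpos hei (sub_nonpos.mpr ?_)
      rw [hG]
      simp only [projIcc_of_right_le hab hb'.le]
      exact hb t
  have hge : ∀ t ∈ Icc 0 T, -y t ≤ -a := hyP.neg.le_of_deriv_nonpos
    (neg_le_neg (hy.1.trans hy0.ge)) fun t _ hb' => by
      rw [neg_nonpos]
      refine mul_nonneg hei (sub_nonneg.mpr ?_)
      rw [hG]
      simp only [projIcc_of_le_left hab (neg_lt_neg_iff.mp hb').le]
      exact ha t
  have hmem : ∀ t ∈ Icc 0 T, y t ∈ Icc a b := fun t ht => ⟨neg_le_neg_iff.mp (hge t ht), hle t ht⟩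
  have hGe : ∀ t ∈ Icc 0 T, G (y t) = φ (y t) := fun t ht => by
    rw [hG]; simp only [projIcc_of_mem hab (hmem t ht)]
  refine ⟨y, ⟨hT, hyP.integrable.congr fun t ht => ?_, fun t ht => ?_⟩, hy0, hmem⟩
  · rw [uIoc_of_le hT] at ht
    simp only [hGe t (Ioc_subset_Icc_self ht)]
  · rw [hyP.eq t ht]
    congr 1
    refine intervalIntegral.integral_congr fun s hs => ?_
    rw [uIcc_of_le ht.1] at hs
    simp only [hGe s ⟨hs.1, hs.2.trans ht.2⟩]

end Barrier

/-! ### Comparison with functions of time -/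

section Comparison

variable {ε T α a b : ℝ} {φ H : ℝ → ℝ}

lemma IsPrimitive.sub {E : Type*} [NormedAddCommGroup E] [NormedSpace ℝ E] {W w V v : ℝ → E}
    (h : IsPrimitive W w a b) (h' : IsPrimitive V v a b) :
    IsPrimitive (fun t => W t - V t) (fun t => w t - v t) a b := by
  refine ⟨h.le, h.integrable.sub h'.integrable, fun t ht => ?_⟩
  have hs : uIcc a t ⊆ uIcc a b := by
    rw [uIcc_of_le ht.1, uIcc_of_le h.le]; exact Icc_subset_Icc_right ht.2
  rw [h.eq t ht, h'.eq t ht, intervalIntegral.integral_sub (h.integrable.mono_set hs)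
    (h'.integrable.mono_set hs)]
  abel

lemma IsPrimitive.clm {E F : Type*} [NormedAddCommGroup E] [NormedSpace ℝ E]
    [NormedAddCommGroup F] [NormedSpace ℝ F] [CompleteSpace E] [CompleteSpace F] {W w : ℝ → E}
    (h : IsPrimitive W w a b) (S : E →L[ℝ] F) :
    IsPrimitive (fun t => S (W t)) (fun t => S (w t)) a b := by
  refine ⟨h.le, ⟨S.integrable_comp h.integrable.1, S.integrable_comp h.integrable.2⟩,
    fun t ht => ?_⟩
  have hs : uIcc a t ⊆ uIcc a b := by
    rw [uIcc_of_le ht.1, uIcc_of_le h.le]; exact Icc_subset_Icc_right ht.2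
  rw [h.eq t ht, map_add, S.intervalIntegral_comp_comm (h.integrable.mono_set hs)]

/-- One time slice of the inequality `ε ∂ₜf - Δf + φ(f) ≤ H`. -/
structure SubSlice (ε H : ℝ) (φ : ℝ → ℝ) (f g : L2T) : Prop where
  inH2 : InH2 (fc f)
  interior : ∀ᵐ x, f x ∈ Ioo (-1 : ℝ) 1
  memLp : MemLp (fun x => φ (f x)) 2 volume
  le : ∀ ψ : L2T, (∀ᵐ x, 0 ≤ ψ x) →
    ε * (invArea * ∫ x, ψ x * g x) + ∑' n, freqSq n * (conj (fc f n) * fc ψ n).re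
      + invArea * ∫ x, φ (f x) * ψ x ≤ H * (invArea * ∫ x, ψ x)

/-- The embedding of the constants into `L²(𝕋²)`. -/
def constL2 : ℝ →L[ℝ] L2T := Lp.constL 2 volume ℝ

lemma coeFn_sub_const (f : L2T) (c : ℝ) : (f - constL2 c : L2T) =ᵐ[volume] fun x => f x - c := by
  filter_upwards [Lp.coeFn_sub f (constL2 c), Lp.coeFn_const 2 (volume : Measure T2) c]
    with x h1 h2
  rw [h1, Pi.sub_apply]
  congr 1

/-- The difference of the inequality for `f` and the equation for `y` is tested with `(f - y)₊`. The
Laplacian has the good sign since `s ↦ (s - y)₊` is monotone, and the one-sided bound on `φ` leaves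
only `α ‖(f - y)₊‖²`. -/
lemma SubSlice.inner_posPart_le {f g : L2T} {H y : ℝ} (h : SubSlice ε H φ f g) (hε : 0 < ε)
    (hα : OneSided α φ) (hy : y ∈ Ioo (-1 : ℝ) 1) :
    2 * inner ℝ (Lp.posPart (f - constL2 y))
      (g - constL2 (ε⁻¹ * (H - φ y)))
      ≤ 2 * α * ε⁻¹ * ‖Lp.posPart (f - constL2 y)‖ ^ 2 := by
  set ψ := Lp.posPart (f - constL2 y) with hψ
  set c := ε⁻¹ * (H - φ y) with hc
  have hψe : ∀ᵐ x, ψ x = max (f x - y) 0 := by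
    filter_upwards [Lp.coeFn_posPart (f - constL2 y), coeFn_sub_const f y] with x h1 h2
    rw [h1, h2]
  have hψ0 : ∀ᵐ x, 0 ≤ ψ x := by
    filter_upwards [hψe] with x hx
    rw [hx]
    exact le_max_right _ _
  have hmono : Monotone fun s : ℝ => max (s - y) 0 := fun s r hsr => by
    dsimp only
    gcongr
  have hgrad : 0 ≤ ∑' n, freqSq n * (conj (fc f n) * fc ψ n).re := by
    have := tsum_freqSq_pairing_nonneg h.inH2 hmono ((memLp_congr_ae hψe).mp (Lp.memLp ψ))
    simpa only [← fc_congr_ae hψe] using this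
  have hmain := h.le ψ hψ0
  have i1 : Integrable (fun x => ψ x * g x) := (Lp.memLp ψ).integrable_mul (Lp.memLp g)
  have i2 : Integrable (fun x => φ (f x) * ψ x) := h.memLp.integrable_mul (Lp.memLp ψ)
  have i3 : Integrable (fun x => ψ x) := integrable_L2 ψ
  have i4 : Integrable (fun x => ψ x ^ 2) := (Lp.memLp ψ).integrable_sq
  have hpt : ∫ x, φ y * ψ x - φ (f x) * ψ x ≤ ∫ x, α * ψ x ^ 2 := by
    refine integral_mono_ae ((i3.const_mul _).sub i2) (i4.const_mul _) ?_
    filter_upwards [hψe, h.interior] with x hx hf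
    rw [hx]
    rcases le_total (f x - y) 0 with h1 | h1
    · rw [max_eq_right h1]; simp
    · rw [max_eq_left h1]
      have := hα _ hf _ hy
      nlinarith
  rw [integral_sub (i3.const_mul _) i2, integral_const_mul, integral_const_mul, ← norm_L2_sq] at hpt
  have hin : inner ℝ ψ (g - constL2 c) = (∫ x, ψ x * g x) - c * ∫ x, ψ x := by
    rw [L2.inner_def, ← integral_const_mul, ← integral_sub i1 (i3.const_mul _)]
    refine integral_congr_ae ?_
    filter_upwards [coeFn_sub_const g c] with x hx
    rw [hx]
    simp only [RCLike.inner_apply, conj_trivial]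
    ring
  have hA := invArea_pos
  have h1 : ε * (∫ x, ψ x * g x) + (∫ x, φ (f x) * ψ x) ≤ H * ∫ x, ψ x := by
    have : invArea * (ε * (∫ x, ψ x * g x) + (∫ x, φ (f x) * ψ x))
        ≤ invArea * (H * ∫ x, ψ x) := by linarith
    exact le_of_mul_le_mul_left this hA
  have h2 : ε * inner ℝ ψ (g - constL2 c) ≤ α * ‖ψ‖ ^ 2 := by
    rw [hin, mul_sub, ← mul_assoc ε c, hc, mul_inv_cancel_left₀ hε.ne']
    linarith
  calc _ = 2 * ε⁻¹ * (ε * inner ℝ ψ (g - constL2 c)) := by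
        field_simp
    _ ≤ 2 * ε⁻¹ * (α * ‖ψ‖ ^ 2) := by gcongr
    _ = _ := by ring

/-- The comparison principle for `ε ∂ₜθ - Δθ + φ(θ) ≤ H`. -/
lemma ae_le_barrier (hε : 0 < ε) (hα0 : 0 ≤ α) (hα : OneSided α φ) {θ g : ℝ → L2T} {y : ℝ → ℝ}
    (hθ : IsPrimitive θ g 0 b) (hy : IsPrimitive y (fun t => ε⁻¹ * (H t - φ (y t))) 0 b)
    (hym : ∀ t ∈ Icc 0 b, y t ∈ Ioo (-1 : ℝ) 1)
    (hs : ∀ᵐ t, t ∈ Ioo 0 b → SubSlice ε (H t) φ (θ t) (g t)) (h0 : ∀ᵐ x, θ 0 x ≤ y 0) :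
    ∀ t ∈ Icc 0 b, ∀ᵐ x, θ t x ≤ y t := by
  have hF := (hθ.sub (hy.clm constL2)).norm_posPart_sq
  intro t ht
  -- The Grönwall rate `2α/ε` is not uniform in `ε`, which is harmless because the initial value is
  -- zero.
  have hg := hF.gronwall (c := 2 * α * ε⁻¹) (k := fun _ => 0)
    (mul_nonneg (mul_nonneg zero_le_two hα0) (inv_pos.mpr hε).le) intervalIntegrable_const
    (fun _ => le_rfl) (by
      filter_upwards [hs] with s hs hm
      rw [add_zero]
      exact (hs hm).inner_posPart_le hε hα (hym s (Ioo_subset_Icc_self hm))) t ht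
  have e0 : ‖Lp.posPart (θ 0 - constL2 (y 0))‖ ^ 2 = 0 := by
    rw [norm_posPart_sq]
    refine integral_eq_zero_of_ae ?_
    filter_upwards [h0, coeFn_sub_const (θ 0) (y 0)] with x h1 h2
    rw [h2, max_eq_right (by linarith)]
    simp
  rw [e0] at hg
  simp only [intervalIntegral.integral_zero, add_zero, mul_zero] at hg
  have e1 : Lp.posPart (θ t - constL2 (y t)) = 0 :=
    norm_eq_zero.mp (pow_eq_zero_iff two_ne_zero |>.mp (le_antisymm hg (sq_nonneg _)))
  filter_upwards [Lp.coeFn_posPart (θ t - constL2 (y t)), coeFn_sub_const (θ t) (y t),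
    Lp.coeFn_zero ℝ 2 (volume : Measure T2)] with x h1 h2 h3
  rw [e1, h3, h2] at h1
  have h4 : θ t x - y t ≤ max (θ t x - y t) 0 := le_max_left _ _
  rw [← h1] at h4
  simpa using h4

/-- The two-sided weak bound on the source gives both one-sided inequalities. The lower one is
recast as an upper one for `-f` with the reflected nonlinearity, so a single comparison principle
serves both. -/
lemma Slice.subSlice {R c₀ G : ℝ} {u : Fin 2 → L2T} {f g : L2T} (hε : ε ∈ Ioc (0 : ℝ) 1)
    (h : Slice ε R φ u f g) (hc : Coercive c₀ φ) (hG : ‖energyMap hε g‖ ^ 2 ≤ G) :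
    SubSlice ε (Slice.sourceBound c₀ R G g) φ f g ∧
      SubSlice ε (Slice.sourceBound c₀ R G g) (fun s => -φ (-s)) (-f) (-g) := by
  have habs : ∀ ψ : L2T, (∀ᵐ x, 0 ≤ ψ x) → ∫ x, |ψ x| = ∫ x, ψ x := fun ψ hψ =>
    integral_congr_ae (hψ.mono fun x hx => abs_of_nonneg hx)
  have hneg := Lp.coeFn_neg f
  have hφn : ∀ᵐ x, -φ (-(-f : L2T) x) = -φ (f x) := by
    filter_upwards [hneg] with x hx
    rw [hx, Pi.neg_apply, neg_neg]
  have hfcn : ∀ n, fc (-f : L2T) n = -fc f n := fun n => by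
    have := fc_coeFn_smul (-1) f n
    rw [neg_one_smul] at this
    simpa using this
  refine ⟨⟨h.mem.inH2, h.mem.interior, h.mem.phi_l2, fun ψ hψ => ?_⟩, ⟨?_, ?_, ?_, fun ψ hψ => ?_⟩⟩
  · have := (abs_le.mp (h.abs_tested_le hε hc hG ψ)).2
    rwa [habs ψ hψ] at this
  · have := h.mem.inH2
    unfold InH2 at this ⊢
    simpa only [hfcn, norm_neg] using this
  · filter_upwards [hneg, h.mem.interior] with x h1 h2
    rw [h1, Pi.neg_apply]
    exact ⟨by linarith [h2.2], by linarith [h2.1]⟩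
  · exact (memLp_congr_ae hφn).mpr h.mem.phi_l2.neg
  · have := (abs_le.mp (h.abs_tested_le hε hc hG ψ)).1
    rw [habs ψ hψ] at this
    have e1 : ∫ x, ψ x * (-g : L2T) x = -∫ x, ψ x * g x := by
      rw [← integral_neg]
      refine integral_congr_ae ?_
      filter_upwards [Lp.coeFn_neg g] with x hx
      rw [hx, Pi.neg_apply, mul_neg]
    have e2 : ∫ x, -φ (-(-f : L2T) x) * ψ x = -∫ x, φ (f x) * ψ x := by
      rw [← integral_neg]
      refine integral_congr_ae ?_
      filter_upwards [hφn] with x hx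
      rw [hx, neg_mul]
    have e3 : ∑' n, freqSq n * (conj (fc (-f : L2T) n) * fc ψ n).re
        = -∑' n, freqSq n * (conj (fc f n) * fc ψ n).re := by
      rw [← tsum_neg]
      refine tsum_congr fun n => ?_
      rw [hfcn, map_neg, neg_mul, Complex.neg_re, mul_neg]
    rw [e1, e2, e3]
    linarith

/-- The energy estimate for the solution of `ε y' + φ(y) = H`. -/
lemma integral_barrier_sq_le (hε : 0 < ε) {Φ : ℝ → ℝ} {B : ℝ} {y : ℝ → ℝ}
    (hΦ : ∀ s ∈ Icc a b, HasDerivAt Φ (φ s) s) (hφ : ContinuousOn φ (Icc a b))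
    (hB : ∀ s ∈ Icc a b, |Φ s| ≤ B)
    (hy : IsPrimitive y (fun t => ε⁻¹ * (H t - φ (y t))) 0 T)
    (hym : ∀ t ∈ Icc 0 T, y t ∈ Icc a b) (hH : IntervalIntegrable H volume 0 T)
    (hH2 : IntervalIntegrable (fun t => H t ^ 2) volume 0 T) :
    IntervalIntegrable (fun t => φ (y t) ^ 2) volume 0 T ∧
      ∫ t in 0..T, φ (y t) ^ 2 ≤ (∫ t in 0..T, H t ^ 2) + 4 * ε * B := by
  obtain ⟨K, hK⟩ := isCompact_Icc.exists_bound_of_continuousOn hφ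
  have hT := hy.le
  have m0 : (0 : ℝ) ∈ Icc 0 T := left_mem_Icc.mpr hT
  have mT : T ∈ Icc 0 T := right_mem_Icc.mpr hT
  have hK0 : 0 ≤ K := (norm_nonneg _).trans (hK _ (hym 0 m0))
  -- The equation is multiplied by `φ(y)`: the term `ε φ(y) y'` is the derivative of `ε Φ(y)`, which
  -- contributes at most `2εB`. Absorbing half of `∫ φ(y)²` doubles this to `4εB`.
  have hP : IsPrimitive (fun t => Φ (y t)) (fun t => φ (y t) * (ε⁻¹ * (H t - φ (y t)))) 0 T := by
    refine hy.comp_lipschitz (K := K) (fun s hs r hr => ?_) hK0 ?_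
    · exact (convex_Icc a b).norm_image_sub_le_of_norm_hasDerivWithin_le
        (fun x hx => (hΦ x hx).hasDerivWithinAt) hK (hym r hr) (hym s hs)
    · filter_upwards [hy.ae_hasDerivAt] with t ht hm
      exact (hΦ _ (hym t (Ioo_subset_Icc_self hm))).comp t (ht hm)
  have hc : ContinuousOn (fun t => φ (y t)) (uIcc 0 T) := by
    rw [uIcc_of_le hT]
    exact hφ.comp hy.continuousOn hym
  have i1 : IntervalIntegrable (fun t => φ (y t) ^ 2) volume 0 T := (hc.pow 2).intervalIntegrable
  have i2 : IntervalIntegrable (fun t => φ (y t) * H t) volume 0 T := hH.continuousOn_mul hc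
  refine ⟨i1, ?_⟩
  have e := hP.sub_eq m0 mT
  have e2 : ∫ t in 0..T, φ (y t) * (ε⁻¹ * (H t - φ (y t)))
      = ε⁻¹ * ((∫ t in 0..T, φ (y t) * H t) - ∫ t in 0..T, φ (y t) ^ 2) := by
    rw [← intervalIntegral.integral_sub i2 i1, ← intervalIntegral.integral_const_mul]
    refine intervalIntegral.integral_congr fun t _ => ?_
    ring
  rw [e2] at e
  have e3 : ε * (Φ (y T) - Φ (y 0))
      = (∫ t in 0..T, φ (y t) * H t) - ∫ t in 0..T, φ (y t) ^ 2 := by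
    rw [e, mul_inv_cancel_left₀ hε.ne']
  have hle : ∫ t in 0..T, φ (y t) * H t
      ≤ 1 / 2 * (∫ t in 0..T, φ (y t) ^ 2) + 1 / 2 * ∫ t in 0..T, H t ^ 2 := by
    rw [← intervalIntegral.integral_const_mul, ← intervalIntegral.integral_const_mul,
      ← intervalIntegral.integral_add (i1.const_mul _) (hH2.const_mul _)]
    refine intervalIntegral.integral_mono_on hT i2 ((i1.const_mul _).add (hH2.const_mul _))
      fun t _ => ?_
    nlinarith [sq_nonneg (φ (y t) - H t)]
  have b1 := abs_le.mp (hB _ (hym T mT))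
  have b0 := abs_le.mp (hB _ (hym 0 m0))
  nlinarith

end Comparison

/-! ### Properties of the singular potential -/

section Potential

variable {Φ : ℝ → ℝ}

namespace IsSingularPotential

lemma hasDerivAt (h : IsSingularPotential Φ) {s : ℝ} (hs : s ∈ Ioo (-1 : ℝ) 1) :
    HasDerivAt Φ (deriv Φ s) s :=
  ((h.smooth.differentiableOn (by simp)).differentiableAt (isOpen_Ioo.mem_nhds hs)).hasDerivAt

lemma contDiffOn_deriv (h : IsSingularPotential Φ) : ContDiffOn ℝ 1 (deriv Φ) (Ioo (-1) 1) :=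
  h.smooth.deriv_of_isOpen isOpen_Ioo (by
    rw [one_add_one_eq_two]
    exact WithTop.coe_le_coe.mpr (le_top : (2 : ℕ∞) ≤ ⊤))

lemma exists_abs_le (h : IsSingularPotential Φ) :
    ∃ B, 0 ≤ B ∧ ∀ s ∈ Ioo (-1 : ℝ) 1, |Φ s| ≤ B := by
  obtain ⟨B, hB⟩ := isCompact_Icc.exists_bound_of_continuousOn h.continuousOn
  exact ⟨B, (norm_nonneg _).trans (hB 0 ⟨by norm_num, by norm_num⟩),
    fun s hs => hB s (Ioo_subset_Icc_self hs)⟩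

/-- The lower bound on `φ'` makes `s ↦ φ(s) + α s` monotone. -/
lemma exists_oneSided (h : IsSingularPotential Φ) : ∃ α, 0 ≤ α ∧ OneSided α (deriv Φ) := by
  obtain ⟨α, C₁, C₂, C₃, hα, -, -, -, hb⟩ := h.bounds
  refine ⟨α, hα.le, ?_⟩
  have hd : ∀ s ∈ Ioo (-1 : ℝ) 1, DifferentiableAt ℝ (deriv Φ) s := fun s hs =>
    (h.contDiffOn_deriv.differentiableOn (by simp)).differentiableAt (isOpen_Ioo.mem_nhds hs)
  have hmono : MonotoneOn (fun s => deriv Φ s + α * s) (Ioo (-1) 1) := by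
    apply monotoneOn_of_deriv_nonneg (convex_Ioo _ _)
    · exact h.contDiffOn_deriv.continuousOn.add (by fun_prop)
    · rw [interior_Ioo]
      exact fun s hs => ((hd s hs).add (by fun_prop)).differentiableWithinAt
    · rw [interior_Ioo]
      intro s hs
      have := ((hd s hs).hasDerivAt.add ((hasDerivAt_id s).const_mul α)).deriv
      change 0 ≤ deriv (deriv Φ + fun y => α * id y) s
      rw [this]
      linarith [(hb s hs).1]
  intro s hs r hr
  rcases le_total s r with h1 | h1
  · have := hmono hs hr h1
    dsimp only at this
    nlinarith
  · have := hmono hr hs h1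
    dsimp only at this
    nlinarith

/-- Arbitrarily near the endpoints, `φ` is as large as desired. -/
lemma exists_barrier_level (h : IsSingularPotential Φ) (A c : ℝ) (hc : c < 1) :
    ∃ b ∈ Ioo (0 : ℝ) 1, c ≤ b ∧ ∀ s ∈ Ico b 1, A ≤ deriv Φ s ∧ deriv Φ (-s) ≤ -A := by
  have h1 := h.tendsto_right.eventually_ge_atTop A
  have h2 := h.tendsto_left.eventually_le_atBot (-A)
  rw [nhdsWithin, eventually_inf_principal, Metric.eventually_nhds_iff] at h1 h2
  obtain ⟨r₁, hr₁, h1⟩ := h1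
  obtain ⟨r₂, hr₂, h2⟩ := h2
  set r := min r₁ r₂ with hr
  have hr0 : 0 < r := lt_min hr₁ hr₂
  have e1 : r ≤ r₁ := min_le_left _ _
  have e2 : r ≤ r₂ := min_le_right _ _
  refine ⟨max (max c (1 / 2)) (1 - r / 2), ⟨?_, ?_⟩, ?_, fun s hs => ⟨?_, ?_⟩⟩
  · exact lt_max_of_lt_left (lt_max_of_lt_right (by norm_num))
  · exact max_lt (max_lt hc (by norm_num)) (by linarith)
  · exact (le_max_left _ _).trans (le_max_left _ _)
  · have hs1 := (le_max_right _ _).trans hs.1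
    refine h1 (y := s) ?_ hs.2
    rw [Real.dist_eq, abs_lt]
    constructor <;> linarith [hs.2]
  · have hs1 := (le_max_right _ _).trans hs.1
    refine h2 (y := -s) ?_ (by simpa using hs.2)
    rw [Real.dist_eq, abs_lt]
    constructor <;> linarith [hs.2]

/-- Near the endpoints `φ(s)` and `s` have the same sign and `|s| ≥ 1/2`, so `φ(s) s ≥ |φ(s)|/2`. On
the remaining compact interval `|φ| ≤ B`, and `c₀ = 2B` suffices. -/
lemma exists_coercive (h : IsSingularPotential Φ) : ∃ c₀, 0 ≤ c₀ ∧ Coercive c₀ (deriv Φ) := by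
  obtain ⟨b, hb, hbc, hlev⟩ := h.exists_barrier_level 0 (1 / 2) (by norm_num)
  obtain ⟨B, hB⟩ := (isCompact_Icc (a := -b) (b := b)).exists_bound_of_continuousOn
    (h.contDiffOn_deriv.continuousOn.mono fun s hs =>
      (⟨by linarith [hs.1, hb.2], by linarith [hs.2, hb.2]⟩ : s ∈ Ioo (-1 : ℝ) 1))
  have hB0 : 0 ≤ B := (norm_nonneg _).trans (hB 0 ⟨by linarith [hb.1], hb.1.le⟩)
  refine ⟨2 * B, by positivity, fun s hs => ?_⟩
  rcases le_or_gt b s with h1 | h1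
  · have := (hlev s ⟨h1, hs.2⟩).1
    rw [abs_of_nonneg this]
    nlinarith
  rcases le_or_gt s (-b) with h2 | h2
  · have := (hlev (-s) ⟨by linarith, by linarith [hs.1]⟩).2
    rw [neg_neg, neg_zero] at this
    rw [abs_of_nonpos this]
    nlinarith
  · have h3 : |deriv Φ s| ≤ B := hB s ⟨h2.le, h1.le⟩
    have h4 : |deriv Φ s * s| ≤ B := by
      rw [abs_mul]
      exact (mul_le_of_le_one_right (abs_nonneg _) (abs_le.mpr ⟨hs.1.le, hs.2.le⟩)).trans h3
    linarith [(abs_le.mp h4).1]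

lemma exists_lipschitzOnWith (h : IsSingularPotential Φ) {b : ℝ} (hb : b < 1) :
    ∃ K, LipschitzOnWith K (deriv Φ) (Icc (-b) b) :=
  (h.contDiffOn_deriv.mono fun s hs =>
    (⟨by linarith [hs.1], by linarith [hs.2]⟩ : s ∈ Ioo (-1 : ℝ) 1)).exists_lipschitzOnWith
      one_ne_zero (convex_Icc _ _) isCompact_Icc

end IsSingularPotential

end Potential

/-! ### The upper barrier for solutions -/

section Barrier

variable {ε T α b B y₀ : ℝ} {φ Φ H : ℝ → ℝ} {θ g : ℝ → L2T}

/-- A spatially constant upper bound, with an estimate independent of `ε`. -/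
lemma exists_upper_bound (hε : 0 < ε) (hT : 0 < T) (hα0 : 0 ≤ α) (hα : OneSided α φ)
    (hb : b ∈ Ioo (0 : ℝ) 1) (hΦ : ∀ s ∈ Ioo (-1 : ℝ) 1, HasDerivAt Φ (φ s) s)
    (hB : ∀ s ∈ Ioo (-1 : ℝ) 1, |Φ s| ≤ B) {K : NNReal} (hK : LipschitzOnWith K φ (Icc (-b) b))
    (hH : IntervalIntegrable H volume 0 T) (hH2 : IntervalIntegrable (fun t => H t ^ 2) volume 0 T)
    (hl : ∀ t, φ (-b) ≤ H t) (hr : ∀ t, H t ≤ φ b) (hy₀ : y₀ ∈ Icc (-b) b)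
    (hθ : ∀ c ∈ Ioo 0 T, IsPrimitive θ g 0 c)
    (hs : ∀ᵐ t, t ∈ Ioo 0 T → SubSlice ε (H t) φ (θ t) (g t)) (h0 : ∀ᵐ x, θ 0 x ≤ y₀) :
    ∃ y : ℝ → ℝ, (∀ t ∈ Icc 0 T, y t ∈ Icc (-b) b) ∧
      IntervalIntegrable (fun t => φ (y t) ^ 2) volume 0 T ∧
      ∫ t in 0..T, φ (y t) ^ 2 ≤ (∫ t in 0..T, H t ^ 2) + 4 * ε * B ∧
      ∀ t ∈ Ioo 0 T, ∀ᵐ x, θ t x ≤ y t := by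
  have hsub : Icc (-b) b ⊆ Ioo (-1 : ℝ) 1 := fun s hs =>
    ⟨by linarith [hs.1, hb.2], by linarith [hs.2, hb.2]⟩
  obtain ⟨y, hy, hy0, hym⟩ := exists_barrier hε hT.le (by linarith [hb.1]) hK hH hl hr hy₀
  obtain ⟨i1, i2⟩ := integral_barrier_sq_le hε (fun s hs => hΦ s (hsub hs)) hK.continuousOn
    (fun s hs => hB s (hsub hs)) hy hym hH hH2
  refine ⟨y, hym, i1, i2, fun t ht => ?_⟩
  refine ae_le_barrier hε hα0 hα (hθ t ht) (hy.mono le_rfl ht.1.le ht.2.le)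
    (fun s hs => hsub (hym s ⟨hs.1, hs.2.trans ht.2.le⟩)) ?_ (by rwa [hy0]) t ⟨ht.1.le, le_rfl⟩
  filter_upwards [hs] with s h1 h2
  exact h1 ⟨h2.1, h2.2.trans ht.2⟩

/-- Monotone convergence: the energy bounds hold on `(0, c)` for each `c < T`, with one constant. -/
lemma lintegral_Ioo_le {T : ℝ} {F : ℝ → ℝ≥0∞} {K : ℝ≥0∞} (hT : 0 < T)
    (h : ∀ c ∈ Ioo 0 T, ∫⁻ t in Ioo 0 c, F t ≤ K) : ∫⁻ t in Ioo 0 T, F t ≤ K := by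
  obtain ⟨c, hmono, hc, hlim⟩ := exists_seq_strictMono_tendsto' hT
  have hU : ⋃ k, Ioo 0 (c k) = Ioo 0 T := by
    ext t
    simp only [mem_iUnion, mem_Ioo]
    constructor
    · rintro ⟨k, h1, h2⟩
      exact ⟨h1, h2.trans (hc k).2⟩
    · rintro ⟨h1, h2⟩
      obtain ⟨k, hk⟩ := (hlim.eventually (lt_mem_nhds h2)).exists
      exact ⟨k, h1, hk⟩
  rw [← hU, setLIntegral_iUnion_of_directed]
  · exact iSup_le fun k => h _ (hc k)
  · exact directed_of_isDirected_le fun i j hij => Ioo_subset_Ioo_right (hmono.monotone hij)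

/-- The symbol is at least `ε`. For fixed `ε` this makes the source bounded in time, which is what
strict separation uses. -/
lemma mul_invArea_norm_sq_le (hε : ε ∈ Ioc (0 : ℝ) 1) (f : L2T) :
    ε * (invArea * ‖f‖ ^ 2) ≤ ‖energyMap hε f‖ ^ 2 := by
  refine hasSum_le (fun n => ?_) ((hasSum_norm_fc_L2 f).mul_left ε) (hasSum_norm_sq_energyMap hε f)
  refine mul_le_mul_of_nonneg_right ?_ (sq_nonneg _)
  unfold symb
  linarith [inv_nonneg.mpr (freqSq_nonneg n)]

end Barrier

/-! ### A bound of the source by a function of time -/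

section Source

variable {ε T R α M c₀ : ℝ} {φ : ℝ → ℝ} {u : ℝ → Fin 2 → L2T} {θ₀ : L2T} {θ g : ℝ → L2T}

lemma derivBound_nonneg (α T M R : ℝ) : 0 ≤ derivBound α T M R := by
  have := invArea_pos
  unfold derivBound initialBound
  positivity

/-- The part of `sourceBound` that does not depend on the time derivative. -/
def sourceConst (c₀ R G : ℝ) : ℝ :=
  2 * Slice.ellipticConst c₀ R G
    + 4 * √(3 * besselSum ^ 2 * (R ^ 2 * (2 * Slice.ellipticConst c₀ R G)))

/-- The factor of the norm of the time derivative in `sourceBound`. -/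
def sourceFactor : ℝ := 4 * √(besselSum * invArea)

lemma sourceBound_eq (c₀ R G : ℝ) (g : L2T) :
    Slice.sourceBound c₀ R G g = sourceConst c₀ R G + sourceFactor * ‖g‖ := by
  unfold Slice.sourceBound sourceConst sourceFactor
  ring

lemma sourceFactor_nonneg : 0 ≤ sourceFactor := by
  unfold sourceFactor
  positivity

lemma sourceConst_nonneg {G : ℝ} (hc : 0 ≤ c₀) (hG : 0 ≤ G) : 0 ≤ sourceConst c₀ R G := by
  have : 0 ≤ Slice.ellipticConst c₀ R G := by
    unfold Slice.ellipticConst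
    positivity
  unfold sourceConst
  positivity

/-- A bound for the square integral of the source. -/
def sourceIntegralBound (c₀ α T M R : ℝ) : ℝ :=
  2 * sourceConst c₀ R (derivBound α T M R) ^ 2 * T
    + 2 * sourceFactor ^ 2 * (invArea⁻¹ * dissipationBound α T M R)

/-- The right-hand side in the comparison with functions of time. -/
lemma Evolution.exists_source (hε : ε ∈ Ioc (0 : ℝ) 1) (hα : OneSided α φ)
    (hT : 0 < T) (hc : Coercive c₀ φ) (hc₀ : 0 ≤ c₀) (hu : IsVelocity T R u)
    (hw : IsWeakSolution ε T φ u θ₀ θ) (h0 : phaseNormSq ε φ θ₀ ≤ ENNReal.ofReal (M ^ 2))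
    (h : Evolution ε T R φ u θ g) :
    ∃ H : ℝ → ℝ, ∃ A : ℝ, (∀ t, 0 ≤ H t) ∧ (∀ t, H t ≤ A) ∧ IntervalIntegrable H volume 0 T ∧
      IntervalIntegrable (fun t => H t ^ 2) volume 0 T ∧
      ∫ t in 0..T, H t ^ 2 ≤ sourceIntegralBound c₀ α T M R ∧
      ∀ᵐ t, t ∈ Ioo 0 T → SubSlice ε (H t) φ (θ t) (g t) ∧
        SubSlice ε (H t) (fun s => -φ (-s)) (-θ t) (-g t) := by
  obtain ⟨hG, hD⟩ := h.energy_le hε hα hT hu hw h0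
  set G := derivBound α T M R with hGdef
  have hG0 : 0 ≤ G := derivBound_nonneg α T M R
  have hA := invArea_pos
  have hD0 : 0 ≤ dissipationBound α T M R := by
    have := Slice.energyConst_nonneg α R
    have := derivBound_nonneg α T M R
    unfold dissipationBound initialBound
    positivity
  have hDT := lintegral_Ioo_le hT hD
  have hgm : AEStronglyMeasurable (fun t => invArea * ‖g t‖ ^ 2) (volume.restrict (Ioo 0 T)) :=
    (h.measurable.norm.pow 2).const_mul _
  have hgI : Integrable (fun t => invArea * ‖g t‖ ^ 2) (volume.restrict (Ioo 0 T)) := by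
    refine ⟨hgm, ?_⟩
    rw [hasFiniteIntegral_iff_ofReal (Eventually.of_forall fun t => by positivity)]
    exact hDT.trans_lt ENNReal.ofReal_lt_top
  have hg2 : IntervalIntegrable (fun t => ‖g t‖ ^ 2) volume 0 T := by
    apply intervalIntegrable_of_integrable_Ioo hT.le
    refine (hgI.const_mul invArea⁻¹).congr (Eventually.of_forall fun t => ?_)
    simp only [inv_mul_cancel_left₀ hA.ne']
  have hg2le : ∫ t in 0..T, ‖g t‖ ^ 2 ≤ invArea⁻¹ * dissipationBound α T M R := by
    rw [← inv_mul_cancel_left₀ hA.ne' (∫ t in 0..T, ‖g t‖ ^ 2)]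
    refine mul_le_mul_of_nonneg_left ?_ (inv_pos.mpr hA).le
    rw [← intervalIntegral.integral_const_mul, intervalIntegral.integral_of_le hT.le,
      integral_Ioc_eq_integral_Ioo,
      integral_eq_lintegral_of_nonneg_ae (Eventually.of_forall fun t => by positivity) hgm]
    exact ENNReal.toReal_le_of_le_ofReal hD0 hDT
  set S := sourceConst c₀ R G with hS
  have hS0 : 0 ≤ S := sourceConst_nonneg hc₀ hG0
  have hF0 := sourceFactor_nonneg
  -- `A` depends on `ε` and is used only for the confinement of the barrier, never in the integral
  -- bound. Truncating at `A` makes `H` bounded at every time; by the energy bound it changes `H`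
  -- only on a null set.
  set A := S + sourceFactor * √(G * (ε * invArea)⁻¹) with hAdef
  have hA0 : 0 ≤ A := by positivity
  set H : ℝ → ℝ := fun t => min (S + sourceFactor * ‖g t‖) A with hH
  have hHS : ∀ t, H t ≤ S + sourceFactor * ‖g t‖ := fun t => min_le_left _ _
  have hHA : ∀ t, H t ≤ A := fun t => min_le_right _ _
  have hH0 : ∀ t, 0 ≤ H t := fun t => le_min (by positivity) hA0
  have hHm : AEStronglyMeasurable H (volume.restrict (Ioo 0 T)) :=
    ((h.measurable.norm.const_mul _).const_add _).inf aestronglyMeasurable_const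
  have hHI : IntervalIntegrable H volume 0 T :=
    intervalIntegrable_of_integrable_Ioo hT.le (Integrable.of_bound hHm A
      (Eventually.of_forall fun t => by rw [Real.norm_of_nonneg (hH0 t)]; exact hHA t))
  have hHI2 : IntervalIntegrable (fun t => H t ^ 2) volume 0 T :=
    intervalIntegrable_of_integrable_Ioo hT.le (Integrable.of_bound (hHm.pow 2) (A ^ 2)
      (Eventually.of_forall fun t => by
        rw [Real.norm_of_nonneg (sq_nonneg _)]
        exact pow_le_pow_left₀ (hH0 t) (hHA t) 2))
  refine ⟨H, A, hH0, hHA, hHI, hHI2, ?_, ?_⟩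
  · have hle : ∫ t in 0..T, H t ^ 2
        ≤ ∫ t in 0..T, (2 * S ^ 2 + 2 * sourceFactor ^ 2 * ‖g t‖ ^ 2) := by
      refine intervalIntegral.integral_mono_on hT.le hHI2
        (intervalIntegrable_const.add (hg2.const_mul _)) fun t _ => ?_
      refine (pow_le_pow_left₀ (hH0 t) (hHS t) 2).trans ?_
      nlinarith [sq_nonneg (S - sourceFactor * ‖g t‖)]
    refine hle.trans ?_
    rw [intervalIntegral.integral_add intervalIntegrable_const (hg2.const_mul _),
      intervalIntegral.integral_const, intervalIntegral.integral_const_mul, sub_zero, smul_eq_mul]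
    unfold sourceIntegralBound
    have := mul_le_mul_of_nonneg_left hg2le (by positivity : 0 ≤ 2 * sourceFactor ^ 2)
    rw [← hGdef, ← hS]
    linarith
  · filter_upwards [h.slice, hG] with t h1 h2 hm
    have e : H t = Slice.sourceBound c₀ R G (g t) := by
      rw [sourceBound_eq, hH]
      refine min_eq_left ?_
      rw [hAdef]
      gcongr
      refine Real.le_sqrt_of_sq_le ?_
      rw [← div_eq_mul_inv, le_div_iff₀ (mul_pos hε.1 hA)]
      have := mul_invArea_norm_sq_le hε (g t)
      linarith [h2 hm]
    rw [e]
    exact (h1 hm).subSlice hε hc (h2 hm)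

end Source

/-! ### The `L²(0, T; L^∞)` estimate and the separation -/

section Main

variable {ε T R M : ℝ} {Φ : ℝ → ℝ} {u : ℝ → Fin 2 → L2T} {θ₀ : L2T} {θ : ℝ → L2T}

/-- On an interval of length 2, `φ` is increasing up to an error `2α`. Thus `s ≤ p` bounds `φ(s)`
from above by `φ(p)`, and `-q ≤ s` bounds it from below by `φ(-q)`. -/
lemma abs_le_of_oneSided {φ : ℝ → ℝ} {α s p q : ℝ} (hα0 : 0 ≤ α) (hα : OneSided α φ)
    (hs : s ∈ Ioo (-1 : ℝ) 1) (hp : p ∈ Ioo (-1 : ℝ) 1) (hq : q ∈ Ioo (-1 : ℝ) 1) (h1 : s ≤ p)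
    (h2 : -s ≤ q) : |φ s| ≤ |φ p| + |-φ (-q)| + 2 * α := by
  have hmono : ∀ x ∈ Ioo (-1 : ℝ) 1, ∀ y ∈ Ioo (-1 : ℝ) 1, x ≤ y → φ x ≤ φ y + 2 * α := by
    intro x hx y hy hxy
    rcases hxy.eq_or_lt with rfl | hlt
    · linarith
    · have h3 := hα y hy x hx
      have h4 : 0 < y - x := sub_pos.mpr hlt
      have h5 : -α * (y - x) ≤ φ y - φ x := by
        refine le_of_mul_le_mul_right ?_ h4
        linarith
      have h6 : α * (y - x) ≤ α * 2 :=
        mul_le_mul_of_nonneg_left (by linarith [hx.1, hy.2]) hα0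
      linarith
  have a1 := hmono s hs p hp h1
  have a2 := hmono (-q) ⟨by linarith [hq.2], by linarith [hq.1]⟩ s hs (by linarith)
  have b1 := le_abs_self (φ p)
  have b2 := le_abs_self (-φ (-q))
  have b3 := abs_nonneg (φ p)
  have b4 := abs_nonneg (-φ (-q))
  rw [abs_le]
  constructor <;> linarith

/-- The estimate of `φ(θ)` in `L²(0, T; L^∞)` and the strict separation of `θ` from `±1`. -/
theorem IsWeakSolution.separation {α c₀ B : ℝ} (hΦ : IsSingularPotential Φ) (hT : 0 < T)
    (hα0 : 0 ≤ α) (hα : OneSided α (deriv Φ)) (hc₀ : 0 ≤ c₀) (hc : Coercive c₀ (deriv Φ))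
    (hB : ∀ s ∈ Ioo (-1 : ℝ) 1, |Φ s| ≤ B) (hε : ε ∈ Ioc (0 : ℝ) 1) {δ₀ : ℝ}
    (hδ : δ₀ ∈ Ioo (0 : ℝ) 1) (hu : IsVelocity T R u)
    (h0 : phaseNormSq ε (deriv Φ) θ₀ ≤ ENNReal.ofReal (M ^ 2))
    (hθ₀ : eLpNorm θ₀ ∞ volume ≤ ENNReal.ofReal (1 - δ₀))
    (hw : IsWeakSolution ε T (deriv Φ) u θ₀ θ) :
    ∫⁻ τ in Ioo 0 T, eLpNorm (fun x => deriv Φ (θ τ x)) ∞ volume ^ 2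
      ≤ ENNReal.ofReal (6 * (sourceIntegralBound c₀ α T M R + 4 * B) + 12 * α ^ 2 * T) ∧
    essSup (fun τ => eLpNorm (θ τ) ∞ volume) (volume.restrict (Ioo 0 T)) < 1 := by
  obtain ⟨g, hev⟩ := hw.exists_evolution hT hu
  obtain ⟨H, A, hH0, hHA, hHI, hHI2, hHle, hsl⟩ :=
    hev.exists_source hε hα hT hc hc₀ hu hw h0
  -- The level must be at least `1 - δ₀`, to contain the initial datum, and high enough that `φ(b) ≥
  -- A ≥ H` and `φ(-b) ≤ -A ≤ H`.
  obtain ⟨b, hb, hbδ, hlev⟩ := hΦ.exists_barrier_level A (1 - δ₀) (by linarith [hδ.1])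
  obtain ⟨K, hK⟩ := hΦ.exists_lipschitzOnWith hb.2
  have hA0 : 0 ≤ A := (hH0 0).trans (hHA 0)
  have hB0 : 0 ≤ B := (abs_nonneg _).trans (hB 0 ⟨by norm_num, by norm_num⟩)
  obtain ⟨lev1, lev2⟩ := hlev b ⟨le_rfl, hb.2⟩
  have hy₀ : 1 - δ₀ ∈ Icc (-b) b := ⟨by linarith [hb.1, hδ.2], hbδ⟩
  have hinit : ∀ᵐ x, |θ 0 x| ≤ 1 - δ₀ := by
    rw [hw.initial]
    rw [eLpNorm_exponent_top] at hθ₀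
    filter_upwards [ae_le_eLpNormEssSup (f := θ₀) (μ := (volume : Measure T2))] with x hx
    have := hx.trans hθ₀
    rw [← ofReal_norm, ENNReal.ofReal_le_ofReal_iff (by linarith [hδ.2])] at this
    exact this
  have hneg : ∀ s ∈ Ioo (-1 : ℝ) 1, -s ∈ Ioo (-1 : ℝ) 1 := fun s hs =>
    ⟨by linarith [hs.2], by linarith [hs.1]⟩
  obtain ⟨p, hp, hp2, hple, hpθ⟩ := exists_upper_bound hε.1 hT hα0 hα hb
    (fun s hs => hΦ.hasDerivAt hs) hB hK hHI hHI2 (fun t => by linarith [hH0 t])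
    (fun t => (hHA t).trans lev1) hy₀ hev.primitive
    (hsl.mono fun t ht hm => (ht hm).1) (hinit.mono fun x hx => (le_abs_self _).trans hx)
  -- The lower barrier is the upper barrier of `-θ`, for the reflected potential `Φ(-s)`, with the
  -- same `H`, `b` and Lipschitz constant.
  obtain ⟨q, hq, hq2, hqle, hqθ⟩ := exists_upper_bound (φ := fun s => -deriv Φ (-s))
    (Φ := fun s => Φ (-s)) (K := K) (θ := fun t => -θ t) (g := fun t => -g t) hε.1 hT hα0
    (fun s hs r hr => by
      have := hα _ (hneg s hs) _ (hneg r hr)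
      linarith)
    hb (fun s hs => by
      have := (hΦ.hasDerivAt (hneg s hs)).comp s (hasDerivAt_neg s)
      rwa [mul_neg_one] at this)
    (fun s hs => hB _ (hneg s hs))
    (LipschitzOnWith.of_dist_le_mul fun s hs r hr => by
      rw [dist_neg_neg, ← dist_neg_neg s r]
      exact hK.dist_le_mul _ ⟨by linarith [hs.2], by linarith [hs.1]⟩ _
        ⟨by linarith [hr.2], by linarith [hr.1]⟩)
    hHI hHI2 (fun t => by rw [neg_neg]; linarith [hH0 t])
    (fun t => by linarith [hHA t]) hy₀ (fun c hc => (hev.primitive c hc).neg)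
    (hsl.mono fun t ht hm => (ht hm).2) (by
      filter_upwards [hinit, Lp.coeFn_neg (θ 0)] with x h1 h2
      rw [h2]
      exact (neg_le_abs _).trans h1)
  have hbar : ∀ {y : ℝ → ℝ}, (∀ t ∈ Icc 0 T, y t ∈ Icc (-b) b) → ∀ t ∈ Ioo 0 T,
      y t ∈ Ioo (-1 : ℝ) 1 := fun {y} hy t ht => by
    have := hy t (Ioo_subset_Icc_self ht)
    exact ⟨by linarith [this.1, hb.2], by linarith [this.2, hb.2]⟩
  have hq' : ∀ t ∈ Ioo 0 T, ∀ᵐ x, -θ t x ≤ q t := fun t ht => by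
    filter_upwards [hqθ t ht, Lp.coeFn_neg (θ t)] with x h1 h2
    rwa [h2] at h1
  constructor
  · set P : ℝ → ℝ := fun t =>
      3 * deriv Φ (p t) ^ 2 + 3 * (-deriv Φ (-q t)) ^ 2 + 12 * α ^ 2 with hP
    have hPI : IntervalIntegrable P volume 0 T :=
      ((hp2.const_mul 3).add (hq2.const_mul 3)).add intervalIntegrable_const
    have hPle : ∫ t in 0..T, P t
        ≤ 6 * (sourceIntegralBound c₀ α T M R + 4 * B) + 12 * α ^ 2 * T := by
      rw [hP, intervalIntegral.integral_add ((hp2.const_mul 3).add (hq2.const_mul 3))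
        intervalIntegrable_const, intervalIntegral.integral_add (hp2.const_mul 3) (hq2.const_mul 3),
        intervalIntegral.integral_const_mul, intervalIntegral.integral_const_mul,
        intervalIntegral.integral_const, sub_zero, smul_eq_mul]
      have : ε * B ≤ 1 * B := mul_le_mul_of_nonneg_right hε.2 hB0
      linarith
    have hpt : ∀ t ∈ Ioo 0 T, eLpNorm (fun x => deriv Φ (θ t x)) ∞ volume ^ 2
        ≤ ENNReal.ofReal (P t) := fun t ht => by
      set L := |deriv Φ (p t)| + |-deriv Φ (-q t)| + 2 * α with hL
      have hL0 : 0 ≤ L := by positivity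
      have h1 : eLpNorm (fun x => deriv Φ (θ t x)) ∞ volume ≤ ENNReal.ofReal L := by
        rw [eLpNorm_exponent_top]
        refine eLpNormEssSup_le_of_ae_bound ?_
        filter_upwards [(hw.mem t ⟨ht.1.le, ht.2⟩).interior, hpθ t ht, hq' t ht] with x a1 a2 a3
        exact abs_le_of_oneSided hα0 hα a1 (hbar hp t ht) (hbar hq t ht) a2 a3
      refine (pow_le_pow_left₀ zero_le h1 2).trans ?_
      rw [← ENNReal.ofReal_pow hL0]
      apply ENNReal.ofReal_le_ofReal
      rw [hP, hL]
      dsimp only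
      rw [← sq_abs (deriv Φ (p t)), ← sq_abs (-deriv Φ (-q t))]
      generalize |deriv Φ (p t)| = x
      generalize |-deriv Φ (-q t)| = y
      -- This is `(x + y + 2α)² ≤ 3x² + 3y² + 3(2α)²`, the source of the constants 3 and 12 in `P`.
      nlinarith [sq_nonneg (x - y), sq_nonneg (x - 2 * α), sq_nonneg (y - 2 * α)]
    refine (setLIntegral_mono' measurableSet_Ioo hpt).trans ?_
    have hPI' : IntegrableOn P (Ioo 0 T) :=
      (intervalIntegrable_iff_integrableOn_Ioo_of_le hT.le).mp hPI
    rw [← ofReal_integral_eq_lintegral_ofReal hPI'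
      (Eventually.of_forall fun t => by rw [hP]; positivity)]
    apply ENNReal.ofReal_le_ofReal
    rwa [← integral_Ioc_eq_integral_Ioo, ← intervalIntegral.integral_of_le hT.le]
  -- Both barriers stay below the same `b < 1` at all times, which gives separation uniformly up to
  -- `T`.
  · refine (essSup_le_of_ae_le (ENNReal.ofReal b) ?_).trans_lt (by
      rw [ENNReal.ofReal_lt_one]; exact hb.2)
    refine (ae_restrict_iff' measurableSet_Ioo).mpr (Eventually.of_forall fun t ht => ?_)
    dsimp only
    rw [eLpNorm_exponent_top]
    refine eLpNormEssSup_le_of_ae_bound ?_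
    filter_upwards [hpθ t ht, hq' t ht] with x a1 a2
    have b1 := (hp t (Ioo_subset_Icc_self ht)).2
    have b2 := (hq t (Ioo_subset_Icc_self ht)).2
    exact abs_le.mpr ⟨by linarith, by linarith⟩

end Main

end CahnHilliard

end

theorem lemma5p2 (Φ : ℝ → ℝ) (hΦ : CahnHilliard.IsSingularPotential Φ)
    (T : ℝ) (hT : 0 < T) (M R : ℝ) :
    ∃ C : ℝ, ∀ ε ∈ Ioc (0 : ℝ) 1, ∀ δ₀ ∈ Ioo (0 : ℝ) 1,
      ∀ u : ℝ → Fin 2 → CahnHilliard.L2T, CahnHilliard.IsVelocity T R u →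
      ∀ θ₀ : CahnHilliard.L2T, CahnHilliard.InPhaseSpace ε (deriv Φ) θ₀ →
        CahnHilliard.phaseNormSq ε (deriv Φ) θ₀ ≤ ENNReal.ofReal (M ^ 2) →
        eLpNorm θ₀ ∞ volume ≤ ENNReal.ofReal (1 - δ₀) →
      ∀ θ : ℝ → CahnHilliard.L2T,
        CahnHilliard.IsWeakSolution ε T (deriv Φ) u θ₀ θ →
        ∫⁻ τ in Ioo 0 T, eLpNorm (fun x => deriv Φ (θ τ x)) ∞ volume ^ 2 ≤ ENNReal.ofReal C ∧
        essSup (fun τ => eLpNorm (θ τ) ∞ volume) (volume.restrict (Ioo 0 T)) < 1 := by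
  obtain ⟨α, hα0, hα⟩ := hΦ.exists_oneSided
  obtain ⟨c₀, hc₀, hc⟩ := hΦ.exists_coercive
  obtain ⟨B, -, hB⟩ := hΦ.exists_abs_le
  -- The constant is read off from `separation` by unification; it involves only `α`, `c₀`, `B`,
  -- which come from `Φ`, and `T`, `M`, `R`.
  exact ⟨_, fun ε hε δ₀ hδ u hu θ₀ _ h0 hθ₀ θ hw =>
    hw.separation hΦ hT hα0 hα hc₀ hc hB hε hδ hu h0 hθ₀⟩
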